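/- Let $D=(0,L)^d$ with $d\in\{1,2\}$, $L>0$, let $T>0$, let $q\ge 3$ be an odd integer, and let $H^1_0(D)$ carry the norm $\|v\|_{H^1}=(\|v\|_{L^2}^2+\|\nabla v\|_{L^2}^2)^{1/2}$. Let $C_G\in\mathbb R$, $\sigma>0$ and $M\ge 0$. Then there is a constant $C$, depending only on $d,L,T,q,C_G,\sigma,M$, such that the following holds. Let $W$ be a real Wiener process with respect to a filtration $(\mathcal F_t)_{t\ge0}$ on a probability space. Let $G:H^1_0(D)\to H^1_0(D)$ have Gateaux derivatives $DG(u)\in\mathcal L(H^1_0,H^1_0)$ and $D^2G(u)\in\mathcal L(H^1_0,\mathcal L(H^1_0,H^1_0))$ and satisfy, for all $u,v\in H^1_0(D)$, $$\|G(u)-G(v)\|_{H^1}\le C_G\|u-v\|_{H^1},\quad \|G(u)\|_{H^1}\le C_G(\|u\|_{H^1}+1),$$ $$\|DG(u)\|\le C_G,\quad \|D^2G(u)\|\le C_G,\quad \|(DG(u)-DG(v))G(v)\|_{H^1}\le C_G\|u-v\|_{H^1}.$$ Let $u_0$ be an $\mathcal F_0$-measurable $H^1_0(D)$-valued random variable with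 $\mathbb E\|u_0\|_{H^1}^2\le M$. Let $\mathcal T_h$ be a conforming simplicial triangulation of $\overline D$ (finitely many simplices) which is quasi-uniform with constant $\sigma$, i.e. every $K\in\mathcal T_h$ contains a closed ball of radius $h/\sigma$, $h=\max_{K'\in\mathcal T_h}\operatorname{diam}K'$. If $d=2$, assume that for every edge $E$ of the triangulation that is not contained in $\partial D$ $$\sum_{K\supset E}\cot\theta_E^K\ge 0,$$ where $\theta_E^K$ is the angle of the triangle $K$ opposite to $E$ (that is, the triangulation is Delaunay). If $d=1$ there is no such condition. Let $V_h=\{v\in H^1_0(D)\cap C(\overline D): v|_K \text{ is affine for all } K\in\mathcal T_h\}$, let $P_h:L^2(D)\to V_h$ be the $L^2$-projection, let $I_hf=\sum_i f(a_i)\varphi_i$ be the nodal interpolant, where $a_i$ are the vertices of $\mathcal T_h$ and $\varphi_i$ is the continuous piecewise affine function with $\varphi_i(a_j)=\delta_{ij}$, and let $\Delta_h:V_h\to V_h$ be the discrete Laplacian, $(\Delta_hv,w)=-(\nabla v,\nabla w)$ for all $w\in V_h$. Let $N\ge1$, $\tau=T/N$, $t_n=n\tau$, $\Delta W_n=W(t_{n+1})-W(t_n)$,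 and let $u_h^0,\dots,u_h^N$ be $V_h$-valued random variables, $u_h^n$ being $\mathcal F_{t_n}$-measurable, with $u_h^0=P_hu_0$ almost surely and, for $0\le n<N$, almost surely $$(u_h^{n+1}-u_h^n,v)+\tau(\nabla u_h^{n+1},\nabla v)=\tau\bigl(I_h[u_h^{n+1}-(u_h^{n+1})^q],v\bigr)+(G(u_h^n),v)\,\Delta W_n+\tfrac12\bigl(DG(u_h^n)G(u_h^n),v\bigr)\bigl[(\Delta W_n)^2-\tau\bigr]$$ for all $v\in V_h$. Then $$\sup_{0\le n\le N}\mathbb E\|\nabla u_h^n\|_{L^2}^2+\frac14\sum_{n=0}^{N-1}\mathbb E\|\nabla(u_h^{n+1}-u_h^n)\|_{L^2}^2+\tau\sum_{n=0}^{N-1}\mathbb E\|\Delta_hu_h^{n+1}\|_{L^2}^2\le C .$$ -/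

import Mathlib

open MeasureTheory ProbabilityTheory
open scoped NNReal ENNReal InnerProductSpace

noncomputable section

namespace MilsteinFEM

/-- Euclidean space `ℝᵈ`. -/
abbrev Eu (d : ℕ) : Type := EuclideanSpace ℝ (Fin d)

/-- The domain `D = (0, L)ᵈ`. -/
def cube (d : ℕ) (L : ℝ) : Set (Eu d) := {x | ∀ i, x i ∈ Set.Ioo 0 L}

/-- `L²(D)`. -/
abbrev L2 (d : ℕ) (L : ℝ) : Type := Lp ℝ 2 (volume.restrict (cube d L))

/-- `L²(D; ℝᵈ)`. -/
abbrev L2vec (d : ℕ) (L : ℝ) : Type := Lp (Eu d) 2 (volume.restrict (cube d L))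

/-- `L²(D) × L²(D; ℝᵈ)` with the Hilbert norm; it contains the pairs `(v, ∇v)`, whose norm is
the full norm `(‖v‖² + ‖∇v‖²)^(1/2)` of `H¹(D)`. -/
abbrev PairSpace (d : ℕ) (L : ℝ) : Type := WithLp 2 (L2 d L × L2vec d L)

/-- The pairs `(φ, ∇φ)` with `φ ∈ C_c^∞(D)`. -/
def testPairs (d : ℕ) (L : ℝ) : Submodule ℝ (PairSpace d L) where
  carrier := {p | ∃ φ : Eu d → ℝ, ContDiff ℝ (⊤ : ℕ∞) φ ∧ HasCompactSupport φ ∧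
    tsupport φ ⊆ cube d L ∧ p.fst =ᵐ[volume.restrict (cube d L)] φ ∧
    p.snd =ᵐ[volume.restrict (cube d L)] gradient φ}
  zero_mem' := by
    refine ⟨fun _ => 0, contDiff_const, HasCompactSupport.zero, by simp [tsupport], ?_, ?_⟩
    · exact Lp.coeFn_zero ℝ 2 _
    · filter_upwards [Lp.coeFn_zero (Eu d) 2 (volume.restrict (cube d L))] with x hx
      have h0 : gradient (fun _ : Eu d => (0 : ℝ)) x = 0 := by simp [gradient]
      rw [h0]
      exact hx
  add_mem' := by
    rintro p q ⟨φ, h1, h2, h3, h4, h5⟩ ⟨ψ, k1, k2, k3, k4, k5⟩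
    refine ⟨φ + ψ, h1.add k1, h2.add k2,
      (tsupport_add φ ψ).trans (Set.union_subset h3 k3), ?_, ?_⟩
    · filter_upwards [Lp.coeFn_add p.fst q.fst, h4, k4] with x hx a b
      change (p.fst + q.fst : L2 d L) x = _
      rw [hx, Pi.add_apply, Pi.add_apply, a, b]
    · filter_upwards [Lp.coeFn_add p.snd q.snd, h5, k5] with x hx a b
      change (p.snd + q.snd : L2vec d L) x = _
      have h0 : gradient (φ + ψ) x = gradient φ x + gradient ψ x := by
        simp only [gradient]
        rw [fderiv_add (h1.differentiable (by simp) x) (k1.differentiable (by simp) x), map_add]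
      rw [hx, Pi.add_apply, h0, a, b]
  smul_mem' := by
    rintro c p ⟨φ, h1, h2, h3, h4, h5⟩
    refine ⟨c • φ, h1.const_smul c, h2.smul_left (f := fun _ => c),
      (closure_mono (Function.support_const_smul_subset c φ)).trans h3, ?_, ?_⟩
    · filter_upwards [Lp.coeFn_smul c p.fst, h4] with x hx a
      change (c • p.fst : L2 d L) x = _
      rw [hx, Pi.smul_apply, Pi.smul_apply, a]
    · filter_upwards [Lp.coeFn_smul c p.snd, h5] with x hx a
      change (c • p.snd : L2vec d L) x = _
      have h0 : gradient (c • φ) x = c • gradient φ x := by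
        simp only [gradient]
        rw [fderiv_const_smul (h1.differentiable (by simp) x), map_smul]
      rw [hx, Pi.smul_apply, h0, a]

/-- `H¹₀(D)`, the closure of `C_c^∞(D)` in the norm `(‖v‖² + ‖∇v‖²)^(1/2)`. An element is stored
as the pair `(v, ∇v)` of a function and its weak gradient. -/
def H10 (d : ℕ) (L : ℝ) : Type := (testPairs d L).topologicalClosure

instance (d : ℕ) (L : ℝ) : NormedAddCommGroup (H10 d L) :=
  inferInstanceAs (NormedAddCommGroup (testPairs d L).topologicalClosure)

instance (d : ℕ) (L : ℝ) : InnerProductSpace ℝ (H10 d L) :=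
  inferInstanceAs (InnerProductSpace ℝ (testPairs d L).topologicalClosure)

instance (d : ℕ) (L : ℝ) : CompleteSpace (H10 d L) :=
  inferInstanceAs (CompleteSpace (testPairs d L).topologicalClosure)

variable {d : ℕ} {L : ℝ}

/-- The underlying function in `L²(D)`. -/
def val (v : H10 d L) : L2 d L := v.1.fst

/-- The weak gradient. -/
def grad (v : H10 d L) : L2vec d L := v.1.snd

theorem val_add (v w : H10 d L) : val (v + w) = val v + val w := rfl
theorem grad_add (v w : H10 d L) : grad (v + w) = grad v + grad w := rfl
theorem val_smul (c : ℝ) (v : H10 d L) : val (c • v) = c • val v := rfl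
theorem grad_smul (c : ℝ) (v : H10 d L) : grad (c • v) = c • grad v := rfl

theorem isOpen_cube (d : ℕ) (L : ℝ) : IsOpen (cube d L) := by
  have : cube d L = ⋂ i, (fun x : Eu d => x i) ⁻¹' Set.Ioo 0 L := by
    ext x; simp [cube]
  rw [this]
  exact isOpen_iInter_of_finite fun i => isOpen_Ioo.preimage (by fun_prop)

theorem memLp_test {F : Type*} [NormedAddCommGroup F] (φ : Eu d → F) (hφ : Continuous φ)
    (hc : HasCompactSupport φ) : MemLp φ 2 (volume.restrict (cube d L)) :=
  (hφ.memLp_of_hasCompactSupport hc).restrict _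

/-- The weak gradient of an element of `H¹₀(D)` satisfies the integration by parts formula. -/
theorem weak_grad (v : H10 d L) (φ : Eu d → ℝ) (hφ : ContDiff ℝ (⊤ : ℕ∞) φ)
    (hc : HasCompactSupport φ) (i : Fin d) :
    ∫ x in cube d L, val v x * fderiv ℝ φ x (EuclideanSpace.single i 1) =
      - ∫ x in cube d L, (grad v x) i * φ x := by
  have c1 : Continuous fun x => fderiv ℝ φ x (EuclideanSpace.single i (1 : ℝ)) :=
    (hφ.continuous_fderiv (by simp)).clm_apply continuous_const
  have s1 : HasCompactSupport fun x => fderiv ℝ φ x (EuclideanSpace.single i (1 : ℝ)) :=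
    hc.fderiv_apply ℝ _
  have c2 : Continuous fun x => φ x • (EuclideanSpace.single i (1 : ℝ) : Eu d) :=
    hφ.continuous.smul continuous_const
  have s2 : HasCompactSupport fun x => φ x • (EuclideanSpace.single i (1 : ℝ) : Eu d) :=
    hc.smul_right
  set Φ : L2 d L := (memLp_test _ c1 s1).toLp _ with hΦ
  set Ψ : L2vec d L := (memLp_test _ c2 s2).toLp _ with hΨ
  have e1 : ∀ f : L2 d L, ⟪Φ, f⟫_ℝ =
      ∫ x in cube d L, f x * fderiv ℝ φ x (EuclideanSpace.single i 1) := by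
    intro f
    rw [L2.inner_def]
    refine integral_congr_ae ?_
    filter_upwards [(memLp_test _ c1 s1).coeFn_toLp (μ := volume.restrict (cube d L))] with x hx
    rw [hΦ, hx]
    rfl
  have e2 : ∀ f : L2vec d L, ⟪Ψ, f⟫_ℝ = ∫ x in cube d L, (f x) i * φ x := by
    intro f
    rw [L2.inner_def]
    refine integral_congr_ae ?_
    filter_upwards [(memLp_test _ c2 s2).coeFn_toLp (μ := volume.restrict (cube d L))] with x hx
    rw [hΨ, hx, inner_smul_left, EuclideanSpace.inner_single_left]
    simp [mul_comm]
  rw [← e1, ← e2]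
  have hclosed : IsClosed {p : PairSpace d L | ⟪Φ, p.fst⟫_ℝ = -⟪Ψ, p.snd⟫_ℝ} := by
    refine isClosed_eq ?_ ?_
    · exact continuous_const.inner (WithLp.prod_continuous_ofLp 2 _ _).fst
    · exact (continuous_const.inner (WithLp.prod_continuous_ofLp 2 _ _).snd).neg
  have hsub : (testPairs d L : Set (PairSpace d L)) ⊆
      {p : PairSpace d L | ⟪Φ, p.fst⟫_ℝ = -⟪Ψ, p.snd⟫_ℝ} := by
    rintro p ⟨ψ, h1, h2, h3, h4, h5⟩
    have d1 : ∀ x, DifferentiableAt ℝ ψ x := fun x => h1.differentiable (by simp) x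
    have d2 : ∀ x, DifferentiableAt ℝ φ x := fun x => hφ.differentiable (by simp) x
    have c3 : Continuous fun x => fderiv ℝ ψ x (EuclideanSpace.single i (1 : ℝ)) :=
      (h1.continuous_fderiv (by simp)).clm_apply continuous_const
    have s3 : HasCompactSupport fun x => fderiv ℝ ψ x (EuclideanSpace.single i (1 : ℝ)) :=
      h2.fderiv_apply ℝ _
    change ⟪Φ, p.fst⟫_ℝ = -⟪Ψ, p.snd⟫_ℝ
    rw [e1, e2]
    have f1 : ∫ x in cube d L, p.fst x * fderiv ℝ φ x (EuclideanSpace.single i 1) =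
        ∫ x, ψ x * fderiv ℝ φ x (EuclideanSpace.single i 1) := by
      rw [← setIntegral_eq_integral_of_forall_compl_eq_zero (s := cube d L)
        (f := fun x => ψ x * fderiv ℝ φ x (EuclideanSpace.single i 1))]
      · refine integral_congr_ae ?_
        filter_upwards [h4] with x hx
        rw [hx]
      · intro x hx
        rw [image_eq_zero_of_notMem_tsupport fun h => hx (h3 h), zero_mul]
    have f2 : ∫ x in cube d L, (p.snd x) i * φ x =
        ∫ x, fderiv ℝ ψ x (EuclideanSpace.single i 1) * φ x := by
      rw [← setIntegral_eq_integral_of_forall_compl_eq_zero (s := cube d L)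
        (f := fun x => fderiv ℝ ψ x (EuclideanSpace.single i 1) * φ x)]
      · refine integral_congr_ae ?_
        filter_upwards [h5] with x hx
        rw [hx]
        congr 1
        rw [← inner_gradient_left, EuclideanSpace.inner_single_right]
        simp
      · intro x hx
        have : x ∉ tsupport (fderiv ℝ ψ) := fun h => hx (h3 (tsupport_fderiv_subset ℝ h))
        rw [image_eq_zero_of_notMem_tsupport this]
        simp
    rw [f1, f2]
    exact integral_mul_fderiv_eq_neg_fderiv_mul_of_integrable
      ((c3.mul hφ.continuous).integrable_of_hasCompactSupport s3.mul_right)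
      ((h1.continuous.mul c1).integrable_of_hasCompactSupport h2.mul_right)
      ((h1.continuous.mul hφ.continuous).integrable_of_hasCompactSupport h2.mul_right)
      (fun x _ => d1 x) (fun x _ => d2 x)
  exact closure_minimal hsub hclosed v.2

/-- An element of `H¹₀(D)` is determined by its function. -/
theorem eq_zero_of_val_eq_zero (v : H10 d L) (h : val v = 0) : v = 0 := by
  have hg : grad v = 0 := by
    refine Lp.ext ?_
    have key : ∀ i : Fin d, ∀ᵐ x ∂(volume.restrict (cube d L)), (grad v x) i = 0 := by
      intro i
      have hm : MemLp (fun x => (grad v x) i) 2 (volume.restrict (cube d L)) :=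
        (Lp.memLp (grad v)).eval_piLp i
      have : IsFiniteMeasure (volume.restrict (cube d L)) := by
        refine ⟨?_⟩
        rw [Measure.restrict_apply_univ]
        refine (Bornology.IsBounded.subset (t := cube d L) ?_ subset_rfl).measure_lt_top
        refine (Metric.isBounded_closedBall (x := (0 : Eu d)) (r := √(d * L ^ 2))).subset ?_
        intro x hx
        rw [mem_closedBall_zero_iff, EuclideanSpace.norm_eq]
        refine Real.sqrt_le_sqrt ?_
        calc ∑ j, ‖x j‖ ^ 2 ≤ ∑ _j : Fin d, L ^ 2 := by
              refine Finset.sum_le_sum fun j _ => ?_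
              have := hx j
              rw [Real.norm_eq_abs, sq_abs]
              nlinarith [this.1, this.2]
          _ = d * L ^ 2 := by simp
      have hi : IntegrableOn (fun x => (grad v x) i) (cube d L) := hm.integrable (by norm_num)
      have := (isOpen_cube d L).ae_eq_zero_of_integral_contDiff_smul_eq_zero
        (f := fun x => (grad v x) i) (μ := volume) hi.locallyIntegrableOn ?_
      · exact (ae_restrict_iff' (isOpen_cube d L).measurableSet).2 this
      · intro φ hφ hc hs
        have hw := weak_grad v φ hφ hc i
        have hz : ∫ x in cube d L, val v x * fderiv ℝ φ x (EuclideanSpace.single i 1) = 0 := by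
          rw [h]
          refine integral_eq_zero_of_ae ?_
          filter_upwards [Lp.coeFn_zero ℝ 2 (volume.restrict (cube d L))] with x hx
          rw [hx]
          simp
        rw [hz, eq_comm, neg_eq_zero] at hw
        rw [← setIntegral_eq_integral_of_forall_compl_eq_zero (s := cube d L), ← hw]
        · refine integral_congr_ae (Filter.Eventually.of_forall fun x => ?_)
          simp [mul_comm]
        · intro x hx
          rw [image_eq_zero_of_notMem_tsupport fun h => hx (hs h), zero_smul]
    filter_upwards [ae_all_iff.2 key, Lp.coeFn_zero (Eu d) 2 (volume.restrict (cube d L))]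
      with x hx h0
    rw [h0]
    ext i
    simpa using hx i
  refine Subtype.ext ?_
  exact WithLp.ofLp_injective 2 (Prod.ext h hg)

/-- A conforming simplicial triangulation `𝒯_h` of the closure of `D`: finitely many simplices
which meet in common faces, cover `D̄`, and are faces of `d`-dimensional ones. -/
structure Triangulation (d : ℕ) (L : ℝ) extends Geometry.SimplicialComplex ℝ (Eu d) where
  finite_faces : faces.Finite
  space_eq : toSimplicialComplex.space = closure (cube d L)
  pure : ∀ s ∈ faces, ∃ K ∈ faces, s ⊆ K ∧ K.card = d + 1

namespace Triangulation

variable (𝒯 : Triangulation d L)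

/-- The elements `K ∈ 𝒯_h`, given by their vertex sets; the simplex itself is the convex hull. -/
def elements : Set (Finset (Eu d)) := {K | K ∈ 𝒯.faces ∧ K.card = d + 1}

/-- The vertices (nodes) `a_i` of the triangulation. -/
def nodes : Set (Eu d) := {a | {a} ∈ 𝒯.faces}

theorem finite_nodes : 𝒯.nodes.Finite :=
  𝒯.finite_faces.preimage (Finset.singleton_injective.injOn)

/-- The vertices `c` opposite to the edge with endpoints `a`, `b` in the elements that contain
this edge (for `d ≤ 2`: one vertex for each such triangle, and none if `d = 1`). -/
def apexes (a b : Eu d) : Set (Eu d) :=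
  {c | c ≠ a ∧ c ≠ b ∧ ∃ K ∈ 𝒯.elements, a ∈ K ∧ b ∈ K ∧ c ∈ K}

/-- The mesh condition `∑_{K ⊃ E} cot θ_E^K ≥ 0` for all edges `E` that are not part of the
boundary, where `θ_E^K` is the angle of the triangle `K` opposite to `E`. It says that the two
angles opposite to an interior edge have sum at most `π`, i.e. that the triangulation is Delaunay.
For `d = 1` it is void. -/
def IsDelaunay : Prop :=
  ∀ a b : Eu d, a ≠ b → (∃ K ∈ 𝒯.elements, a ∈ K ∧ b ∈ K) →
    ¬ segment ℝ a b ⊆ frontier (cube d L) →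
    0 ≤ ∑ᶠ c ∈ 𝒯.apexes a b, Real.cot (EuclideanGeometry.angle a c b)

/-- Quasi-uniformity with constant `σ`: every element contains a ball of radius `h / σ`, where `h`
is the largest diameter of an element. -/
def IsQuasiUniform (σ : ℝ) : Prop :=
  ∀ K ∈ 𝒯.elements, ∀ K' ∈ 𝒯.elements, ∃ x : Eu d,
    Metric.closedBall x (Metric.diam (convexHull ℝ (K' : Set (Eu d))) / σ) ⊆
      convexHull ℝ (K : Set (Eu d))

/-- `g` is a continuous representative of `v`, affine on every element. -/
def IsRep (v : H10 d L) (g : Eu d → ℝ) : Prop :=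
  ContinuousOn g (closure (cube d L)) ∧
  val v =ᵐ[volume.restrict (cube d L)] g ∧
  ∀ K ∈ 𝒯.elements, ∃ A : Eu d →ᵃ[ℝ] ℝ, Set.EqOn g A (convexHull ℝ (K : Set (Eu d)))

variable {𝒯} in
theorem IsRep.add {v w : H10 d L} {f g : Eu d → ℝ} (hf : 𝒯.IsRep v f) (hg : 𝒯.IsRep w g) :
    𝒯.IsRep (v + w) (f + g) := by
  refine ⟨hf.1.add hg.1, ?_, fun K hK => ?_⟩
  · filter_upwards [hf.2.1, hg.2.1, Lp.coeFn_add (val v) (val w)] with x h1 h2 h3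
    rw [val_add, h3, Pi.add_apply, Pi.add_apply, h1, h2]
  · obtain ⟨A, hA⟩ := hf.2.2 K hK
    obtain ⟨B, hB⟩ := hg.2.2 K hK
    exact ⟨A + B, fun x hx => by simp [hA hx, hB hx]⟩

variable {𝒯} in
theorem IsRep.smul {v : H10 d L} {f : Eu d → ℝ} (c : ℝ) (hf : 𝒯.IsRep v f) :
    𝒯.IsRep (c • v) (c • f) := by
  refine ⟨hf.1.const_smul c, ?_, fun K hK => ?_⟩
  · filter_upwards [hf.2.1, Lp.coeFn_smul c (val v)] with x h1 h2
    rw [val_smul, h2, Pi.smul_apply, Pi.smul_apply, h1]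
  · obtain ⟨A, hA⟩ := hf.2.2 K hK
    exact ⟨c • A, fun x hx => by simp [hA hx]⟩

/-- The `P₁`-Lagrange space `V_h`: the functions in `H¹₀(D)` that are continuous on `D̄` and affine
on every element of the triangulation. -/
def Vh : Submodule ℝ (H10 d L) where
  carrier := {v | ∃ g, 𝒯.IsRep v g}
  zero_mem' := ⟨0, continuousOn_const, Lp.coeFn_zero ℝ 2 _, fun _ _ => ⟨0, fun _ _ => rfl⟩⟩
  add_mem' := by
    rintro v w ⟨f, hf⟩ ⟨g, hg⟩
    exact ⟨f + g, hf.add hg⟩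
  smul_mem' := by
    rintro c v ⟨f, hf⟩
    exact ⟨c • f, hf.smul c⟩

/-- The continuous function that represents `v ∈ V_h` (unique on `D̄`). -/
def rep (v : 𝒯.Vh) : Eu d → ℝ := v.2.choose

theorem rep_spec (v : 𝒯.Vh) : 𝒯.IsRep v (𝒯.rep v) := v.2.choose_spec

theorem rep_unique {v : H10 d L} {f g : Eu d → ℝ} (hf : 𝒯.IsRep v f) (hg : 𝒯.IsRep v g) :
    Set.EqOn f g (closure (cube d L)) := by
  have h : Set.EqOn f g (cube d L) :=
    MeasureTheory.Measure.eqOn_open_of_ae_eq (hf.2.1.symm.trans hg.2.1) (isOpen_cube d L)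
      (hf.1.mono subset_closure) (hg.1.mono subset_closure)
  exact h.of_subset_closure hf.1 hg.1 subset_closure subset_rfl

theorem nodes_subset : 𝒯.nodes ⊆ closure (cube d L) := by
  intro a ha
  rw [← 𝒯.space_eq]
  exact 𝒯.toSimplicialComplex.subset_space (s := {a}) ha (by simp)

/-- The nodal values of a finite element function, as a linear map. -/
def nodalValues : 𝒯.Vh →ₗ[ℝ] (𝒯.nodes → ℝ) where
  toFun v a := 𝒯.rep v a
  map_add' v w := by
    funext a
    exact 𝒯.rep_unique (𝒯.rep_spec (v + w)) ((𝒯.rep_spec v).add (𝒯.rep_spec w))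
      (𝒯.nodes_subset a.2)
  map_smul' c v := by
    funext a
    exact 𝒯.rep_unique (𝒯.rep_spec (c • v)) ((𝒯.rep_spec v).smul c) (𝒯.nodes_subset a.2)

theorem nodalValues_injective : Function.Injective 𝒯.nodalValues := by
  refine (injective_iff_map_eq_zero _).2 fun v hv => ?_
  have h0 : ∀ a ∈ 𝒯.nodes, 𝒯.rep v a = 0 := fun a ha => congrFun hv ⟨a, ha⟩
  obtain ⟨-, h2, h3⟩ := 𝒯.rep_spec v
  have hz : ∀ x ∈ closure (cube d L), 𝒯.rep v x = 0 := by
    intro x hx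
    rw [← 𝒯.space_eq, Geometry.SimplicialComplex.mem_space_iff] at hx
    obtain ⟨s, hs, hxs⟩ := hx
    obtain ⟨K, hK, hsK, hcard⟩ := 𝒯.pure s hs
    have hxK : x ∈ convexHull ℝ (K : Set (Eu d)) :=
      convexHull_mono (Finset.coe_subset.2 hsK) hxs
    obtain ⟨A, hA⟩ := h3 K ⟨hK, hcard⟩
    have hpre : convexHull ℝ (K : Set (Eu d)) ⊆ A ⁻¹' {0} := by
      refine convexHull_min (fun a ha => ?_) ((convex_singleton 0).affine_preimage A)
      have haK : {a} ∈ 𝒯.faces := 𝒯.down_closed hK (by simpa using ha) (by simp)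
      have := hA (subset_convexHull ℝ _ ha)
      rw [h0 a haK] at this
      exact this.symm
    rw [hA hxK]
    exact hpre hxK
  have hval : val (v : H10 d L) = 0 := by
    refine Lp.ext ?_
    filter_upwards [h2, Lp.coeFn_zero ℝ 2 (volume.restrict (cube d L)),
      ae_restrict_mem (isOpen_cube d L).measurableSet] with x hx h0 hxm
    rw [hx, h0, hz x (subset_closure hxm)]
    rfl
  exact Subtype.ext (eq_zero_of_val_eq_zero _ hval)

instance : FiniteDimensional ℝ 𝒯.Vh :=
  haveI := 𝒯.finite_nodes.to_subtype
  Module.Finite.of_injective 𝒯.nodalValues 𝒯.nodalValues_injective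

/-- Every linear functional on `V_h` is represented in the `L²(D)` inner product. -/
theorem exists_l2_repr (ℓ : 𝒯.Vh →ₗ[ℝ] ℝ) :
    ∃! z : 𝒯.Vh, ∀ w : 𝒯.Vh, ⟪val (z : H10 d L), val (w : H10 d L)⟫_ℝ = ℓ w := by
  let B : 𝒯.Vh →ₗ[ℝ] Module.Dual ℝ 𝒯.Vh := LinearMap.mk₂ ℝ
    (fun z w => ⟪val (z : H10 d L), val (w : H10 d L)⟫_ℝ)
    (fun a b c => by rw [Submodule.coe_add, val_add, inner_add_left])
    (fun c a b => by rw [Submodule.coe_smul, val_smul, real_inner_smul_left, smul_eq_mul])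
    (fun a b c => by rw [Submodule.coe_add, val_add, inner_add_right])
    (fun c a b => by rw [Submodule.coe_smul, val_smul, real_inner_smul_right, smul_eq_mul])
  have hB : ∀ z w, B z w = ⟪val (z : H10 d L), val (w : H10 d L)⟫_ℝ := fun z w => rfl
  have hinj : Function.Injective B := by
    refine (injective_iff_map_eq_zero _).2 fun z hz => ?_
    have := hB z z
    rw [hz, LinearMap.zero_apply, eq_comm, inner_self_eq_zero] at this
    exact Subtype.ext (eq_zero_of_val_eq_zero _ this)
  have hsurj : Function.Surjective B :=
    (LinearMap.injective_iff_surjective_of_finrank_eq_finrank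
      Subspace.dual_finrank_eq.symm).1 hinj
  obtain ⟨z, hz⟩ := hsurj ℓ
  refine ⟨z, fun w => by rw [← hB, hz], fun y hy => hinj ?_⟩
  rw [hz]
  exact LinearMap.ext hy

/-- The `L²`-projection `P_h : L²(D) → V_h`, `(P_h f, w) = (f, w)` for all `w ∈ V_h`. -/
def proj (f : L2 d L) : 𝒯.Vh :=
  (𝒯.exists_l2_repr
    { toFun := fun w => ⟪f, val (w : H10 d L)⟫_ℝ
      map_add' := fun v w => inner_add_right f (val (v : H10 d L)) (val (w : H10 d L))
      map_smul' := fun c w => inner_smul_right f (val (w : H10 d L)) c }).choose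

theorem proj_spec (f : L2 d L) (w : 𝒯.Vh) :
    ⟪val (𝒯.proj f : H10 d L), val (w : H10 d L)⟫_ℝ = ⟪f, val (w : H10 d L)⟫_ℝ :=
  (𝒯.exists_l2_repr _).choose_spec.1 w

/-- The discrete Laplacian `Δ_h : V_h → V_h`, `(Δ_h v, w) = -(∇v, ∇w)` for all `w ∈ V_h`. -/
def laplacian (v : 𝒯.Vh) : 𝒯.Vh :=
  (𝒯.exists_l2_repr
    { toFun := fun w => -⟪grad (v : H10 d L), grad (w : H10 d L)⟫_ℝ
      map_add' := fun w z => by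
        rw [Submodule.coe_add, grad_add, inner_add_right, neg_add]
      map_smul' := fun c w => by
        rw [Submodule.coe_smul, grad_smul, inner_smul_right, RingHom.id_apply, smul_eq_mul,
          mul_neg] }).choose

theorem laplacian_spec (v w : 𝒯.Vh) :
    ⟪val (𝒯.laplacian v : H10 d L), val (w : H10 d L)⟫_ℝ =
      -⟪grad (v : H10 d L), grad (w : H10 d L)⟫_ℝ :=
  (𝒯.exists_l2_repr _).choose_spec.1 w

/-- `w` are barycentric coordinates of the point `x` in a simplex of the triangulation with
vertex set `K ∋ a`. -/
def IsBary (a x : Eu d) (p : Finset (Eu d) × (Eu d → ℝ)) : Prop :=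
  p.1 ∈ 𝒯.faces ∧ a ∈ p.1 ∧ (∀ v ∈ p.1, 0 ≤ p.2 v) ∧ ∑ v ∈ p.1, p.2 v = 1 ∧
    ∑ v ∈ p.1, p.2 v • v = x

open Classical in
/-- The nodal basis (hat) function `φ_a` of the node `a`: at a point of a simplex with vertex `a`
it is the barycentric coordinate belonging to `a`, elsewhere it is `0`. -/
def hat (a x : Eu d) : ℝ :=
  if h : ∃ p, 𝒯.IsBary a x p then h.choose.2 a else 0

/-- The nodal interpolant `I_h f = ∑_i f(a_i) φ_i`. -/
def interp (f : Eu d → ℝ) (x : Eu d) : ℝ :=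
  ∑ a ∈ 𝒯.finite_nodes.toFinset, f a * 𝒯.hat a x

end Triangulation

/-- The assumptions on the diffusion `G : H¹₀(D) → H¹₀(D)` with Gateaux derivative `DG` and second
Gateaux derivative `D2G`, all with the constant `C`: global Lipschitz continuity and linear growth,
bounded first and second derivatives, and Lipschitz continuity of `u ↦ DG(u) G(v)` at `v`. -/
structure NoiseAssumptions (C : ℝ) (G : H10 d L → H10 d L) (DG : H10 d L → H10 d L →L[ℝ] H10 d L)
    (D2G : H10 d L → H10 d L →L[ℝ] H10 d L →L[ℝ] H10 d L) : Prop where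
  gateaux : ∀ u v, HasLineDerivAt ℝ G (DG u v) u v
  gateaux2 : ∀ u v, HasLineDerivAt ℝ DG (D2G u v) u v
  lipschitz : ∀ v w, ‖G v - G w‖ ≤ C * ‖v - w‖
  growth : ∀ v, ‖G v‖ ≤ C * (‖v‖ + 1)
  deriv_bound : ∀ u, ‖DG u‖ ≤ C
  deriv2_bound : ∀ u, ‖D2G u‖ ≤ C
  milstein : ∀ u v, ‖(DG u - DG v) (G v)‖ ≤ C * ‖u - v‖

/-- `W` is a real Wiener process with respect to the filtration `𝓕`. -/
structure IsWiener {Ω : Type*} {m : MeasurableSpace Ω} (P : Measure Ω) (𝓕 : Filtration ℝ≥0 m)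
    (W : ℝ≥0 → Ω → ℝ) : Prop where
  brownian : IsBrownianReal W P
  adapted : ∀ t, Measurable[𝓕 t] (W t)
  indep : ∀ s t, s ≤ t →
    Indep (MeasurableSpace.comap (fun ω => W t ω - W s ω) inferInstance) (𝓕 s) P

/-- The increment `ΔW_n = W(t_{n+1}) - W(t_n)` for `t_n = n τ`. -/
def increment {Ω : Type*} (W : ℝ≥0 → Ω → ℝ) (τ : ℝ≥0) (n : ℕ) (ω : Ω) : ℝ :=
  W ((n + 1 : ℕ) * τ) ω - W (n * τ) ω

/-- `u = (u_h^n)_{0 ≤ n ≤ N}` solves the fully discrete interpolated Milstein scheme with step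
`τ`, exponent `q` and initial value `u₀`. -/
structure IsSolution {Ω : Type*} {m : MeasurableSpace Ω} (P : Measure Ω) (𝓕 : Filtration ℝ≥0 m)
    (W : ℝ≥0 → Ω → ℝ) (𝒯 : Triangulation d L) (q : ℕ) (G : H10 d L → H10 d L)
    (DG : H10 d L → H10 d L →L[ℝ] H10 d L) (u₀ : Ω → H10 d L) (τ : ℝ≥0) (N : ℕ)
    (u : ℕ → Ω → 𝒯.Vh) : Prop where
  adapted : ∀ n ≤ N, StronglyMeasurable[𝓕 (n * τ)] (u n)
  initial : ∀ᵐ ω ∂P, u 0 ω = 𝒯.proj (val (u₀ ω))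
  step : ∀ n < N, ∀ᵐ ω ∂P, ∀ v : 𝒯.Vh,
    ⟪val (u (n + 1) ω - u n ω : H10 d L), val (v : H10 d L)⟫_ℝ
      + τ * ⟪grad (u (n + 1) ω : H10 d L), grad (v : H10 d L)⟫_ℝ
    = τ * (∫ x in cube d L,
        𝒯.interp (fun y => 𝒯.rep (u (n + 1) ω) y - 𝒯.rep (u (n + 1) ω) y ^ q) x
          * val (v : H10 d L) x)
      + ⟪val (G (u n ω)), val (v : H10 d L)⟫_ℝ * increment W τ n ω
      + 1 / 2 * ⟪val (DG (u n ω) (G (u n ω))), val (v : H10 d L)⟫_ℝ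
          * (increment W τ n ω ^ 2 - τ)

/-- The second moment `E[‖X‖²]`, with values in `[0, ∞]`. -/
def secondMoment {Ω : Type*} {m : MeasurableSpace Ω} {F : Type*} [NormedAddCommGroup F]
    (P : Measure Ω) (X : Ω → F) : ℝ≥0∞ :=
  ∫⁻ ω, ‖X ω‖ₑ ^ 2 ∂P

end MilsteinFEM

end

/-!
The scheme is tested with `-Δ_h u^{n+1}`. Three facts about the finite element space make this
work.

* On a Delaunay triangulation the stiffness matrix has nonpositive off-diagonal entries, by the
  cotangent formula (`cross_mul_inner_eq`, `sum_cotSum_nonneg`). Hence `(∇v, ∇w) ≥ 0` whenever the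
  nodal values of `w` are a monotone function of those of `v` (`Triangulation.inner_grad_nonneg`).
  The nonlinearity `t - t ^ q` is the difference of a function with values in `[-1, 1]` and a
  nondecreasing function. The nodal interpolation acts on nodal values, so that the monotone part
  has the good sign when tested with `-Δ_h u^{n+1}`, while the bounded part costs `|D| / 2` and
  half of `‖Δ_h u^{n+1}‖²` (`Triangulation.integral_interp_laplacian_le`). Both parts vanish on
  the boundary, because continuous functions in `H¹₀(D)` do (`eq_zero_of_mem_frontier`), and
  conversely nodal data that vanish on the boundary belong to elements of `V_h`
  (`Triangulation.exists_rep_eq`).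

* On a quasi-uniform triangulation the `L²` projection is stable in `H¹`. The dual form
  `|(v, Δ_h w)| ≤ c ‖∇v‖ ‖∇w‖` is `Triangulation.abs_inner_laplacian_le`. It follows from the inverse
  estimate (`Triangulation.norm_grad_le_of_mesh`) and a quasi-interpolant
  (`Triangulation.exists_quasiInterpolant`): the nodal interpolant of averages over balls of
  radius `h`, after a dilation of `D` that pushes the boundary out by `h`, so that boundary values
  stay zero.

* The Poincaré inequality (`norm_val_le`) bounds `‖G(u)‖_{H¹}` by a multiple of `‖∇u‖ + 1`.

In the noise terms `Δ_h u^{n+1}` is split into `Δ_h u^n`, whose products with the increments are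
integrable with mean zero, and `Δ_h (u^{n+1} - u^n)`, which is absorbed in the numerical
dissipation by the stability estimate (`Triangulation.energy_step`). Taking expectations, with the
second and fourth moments of Gaussian increments, gives `expected_energy_step`, and a discrete
Gronwall inequality (`discrete_gronwall`) finishes the proof. The stability estimate also bounds
`‖∇ P_h u₀‖` (`Triangulation.norm_grad_proj_le`).
-/

noncomputable section

namespace MilsteinFEM

/-! ### The Poincaré inequality and traces in `H¹₀(D)` -/

section

/-- The Cauchy-Schwarz inequality against the constant `1`. -/
theorem sq_lintegral_le {α : Type*} {m : MeasurableSpace α} {μ : Measure α} {f : α → ℝ≥0∞}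
    (hf : AEMeasurable f μ) : (∫⁻ x, f x ∂μ) ^ 2 ≤ μ Set.univ * ∫⁻ x, f x ^ 2 ∂μ := by
  have h := ENNReal.lintegral_mul_le_Lp_mul_Lq μ Real.HolderConjugate.two_two
    (f := fun _ => 1) (g := f) aemeasurable_const hf
  simp only [Pi.mul_apply, one_mul, ENNReal.one_rpow, lintegral_const] at h
  calc (∫⁻ x, f x ∂μ) ^ 2
      ≤ (μ Set.univ ^ (1 / 2 : ℝ) * (∫⁻ x, f x ^ (2 : ℝ) ∂μ) ^ (1 / 2 : ℝ)) ^ 2 := by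
        gcongr
    _ = _ := by
        rw [mul_pow, ← ENNReal.rpow_natCast, ← ENNReal.rpow_natCast, ← ENNReal.rpow_mul,
          ← ENNReal.rpow_mul]
        norm_num

variable {d : ℕ} {L : ℝ}

theorem continuous_gradient {φ : Eu d → ℝ} (hφ : ContDiff ℝ 1 φ) : Continuous (gradient φ) :=
  (InnerProductSpace.toDual ℝ (Eu d)).symm.continuous.comp (hφ.continuous_fderiv (by simp))

/-- The fundamental theorem of calculus along a segment, combined with the Cauchy-Schwarz
inequality. -/
theorem enorm_sub_sq_le {φ : Eu d → ℝ} (hφ : ContDiff ℝ 1 φ) (p q : Eu d) :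
    ‖φ p - φ q‖ₑ ^ 2 ≤
      ‖p - q‖ₑ ^ 2 * ∫⁻ t in Set.Icc (0 : ℝ) 1, ‖gradient φ (q + t • (p - q))‖ₑ ^ 2 := by
  have hg := continuous_gradient hφ
  have hcont : Continuous fun t : ℝ => gradient φ (q + t • (p - q)) := by fun_prop
  have h1 : φ p - φ q = ∫ t in (0 : ℝ)..1, ⟪gradient φ (q + t • (p - q)), p - q⟫_ℝ := by
    have hd : ∀ t ∈ Set.uIcc (0 : ℝ) 1, HasDerivAt (fun t : ℝ => φ (q + t • (p - q)))
        ⟪gradient φ (q + t • (p - q)), p - q⟫_ℝ t := by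
      intro t _
      have h2 : HasDerivAt (fun t : ℝ => q + t • (p - q)) (p - q) t := by
        simpa using ((hasDerivAt_id t).smul_const (p - q)).const_add q
      have h3 := ((hφ.differentiable (by simp)) (q + t • (p - q))).hasFDerivAt.comp_hasDerivAt t h2
      rw [inner_gradient_left]
      exact h3
    rw [intervalIntegral.integral_eq_sub_of_hasDerivAt hd
      (Continuous.intervalIntegrable (by fun_prop) _ _)]
    simp
  have h2 : ‖φ p - φ q‖ₑ ≤
      ∫⁻ t in Set.Icc (0 : ℝ) 1, ‖gradient φ (q + t • (p - q))‖ₑ * ‖p - q‖ₑ := by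
    rw [h1, intervalIntegral.integral_of_le zero_le_one, ← integral_Icc_eq_integral_Ioc]
    refine (enorm_integral_le_lintegral_enorm _).trans (lintegral_mono fun t => ?_)
    rw [← ofReal_norm, ← ofReal_norm, ← ofReal_norm,
      ← ENNReal.ofReal_mul (norm_nonneg _)]
    exact ENNReal.ofReal_le_ofReal (norm_inner_le_norm _ _)
  calc ‖φ p - φ q‖ₑ ^ 2
      ≤ (∫⁻ t in Set.Icc (0 : ℝ) 1, ‖gradient φ (q + t • (p - q))‖ₑ * ‖p - q‖ₑ) ^ 2 := by gcongr
    _ ≤ (volume.restrict (Set.Icc (0 : ℝ) 1)) Set.univ *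
          ∫⁻ t in Set.Icc (0 : ℝ) 1, (‖gradient φ (q + t • (p - q))‖ₑ * ‖p - q‖ₑ) ^ 2 :=
        sq_lintegral_le (by fun_prop)
    _ = _ := by
        simp only [mul_pow]
        rw [lintegral_mul_const' _ _ (by simp), mul_comm (∫⁻ t in _, _)]
        simp

/-- Change of variables under a dilation by a factor `≥ 1`. -/
theorem setLIntegral_dilation_le (f : Eu d → ℝ≥0∞) {S S' : Set (Eu d)}
    (hS : MeasurableSet S) (hS' : MeasurableSet S') {s : ℝ} (hs : 1 ≤ s) (k : Eu d)
    (h : ∀ y ∈ S, s • y + k ∈ S') :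
    ∫⁻ y in S, f (s • y + k) ≤ ∫⁻ z in S', f z := by
  have h0 : s ≠ 0 := by positivity
  rw [← lintegral_indicator hS, ← lintegral_indicator hS']
  calc ∫⁻ y, S.indicator (fun y => f (s • y + k)) y
      ≤ ∫⁻ y, S'.indicator f (s • y + k) := by
        refine lintegral_mono fun y => ?_
        by_cases hy : y ∈ S
        · simp [hy, h y hy]
        · simp [hy]
    _ = ENNReal.ofReal |(s ^ Module.finrank ℝ (Eu d))⁻¹| * ∫⁻ y, S'.indicator f (y + k) := by
        have hm := lintegral_map_equiv (μ := (volume : Measure (Eu d)))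
          (fun y => S'.indicator f (y + k)) (Homeomorph.smulOfNeZero s h0).toMeasurableEquiv
        have : Measure.map ((Homeomorph.smulOfNeZero s h0).toMeasurableEquiv)
            (volume : Measure (Eu d)) = ENNReal.ofReal |(s ^ Module.finrank ℝ (Eu d))⁻¹| • volume :=
          Measure.map_addHaar_smul volume h0
        rw [this, lintegral_smul_measure, smul_eq_mul] at hm
        exact hm.symm
    _ ≤ 1 * ∫⁻ y, S'.indicator f (y + k) := by
        gcongr
        rw [ENNReal.ofReal_le_one, abs_of_nonneg (by positivity)]
        exact inv_le_one_of_one_le₀ (one_le_pow₀ hs)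
    _ = ∫⁻ z, S'.indicator f z := by
        rw [one_mul, lintegral_add_right_eq_self (μ := volume) (fun z => S'.indicator f z) k]

/-- The `L²(S)`-norm of the difference of `φ` along the displacement from `y + q` to `s y + p` is at
most the length of the displacement times the norm of `∇φ`: the intermediate maps of the
displacement are dilations by a factor `≥ 1`, under which integrals do not increase. -/
theorem lintegral_displacement_le {φ : Eu d → ℝ} (hφ : ContDiff ℝ 1 φ) {S S' : Set (Eu d)}
    (hS : MeasurableSet S) (hS' : MeasurableSet S') {s : ℝ} (hs : 1 ≤ s) (p q : Eu d)
    (h : ∀ y ∈ S, ∀ t ∈ Set.Icc (0 : ℝ) 1, (y + q) + t • ((s • y + p) - (y + q)) ∈ S')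
    {δ : ℝ} (hδ : ∀ y ∈ S, ‖(s • y + p) - (y + q)‖ ≤ δ) :
    ∫⁻ y in S, ‖φ (s • y + p) - φ (y + q)‖ₑ ^ 2 ≤
      ENNReal.ofReal δ ^ 2 * ∫⁻ z in S', ‖gradient φ z‖ₑ ^ 2 := by
  have hg := continuous_gradient hφ
  calc ∫⁻ y in S, ‖φ (s • y + p) - φ (y + q)‖ₑ ^ 2
      ≤ ∫⁻ y in S, ENNReal.ofReal δ ^ 2 * ∫⁻ t in Set.Icc (0 : ℝ) 1,
          ‖gradient φ ((y + q) + t • ((s • y + p) - (y + q)))‖ₑ ^ 2 := by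
        refine setLIntegral_mono' hS fun y hy => (enorm_sub_sq_le hφ _ _).trans ?_
        gcongr
        rw [← ofReal_norm]
        exact ENNReal.ofReal_le_ofReal (hδ y hy)
    _ = ENNReal.ofReal δ ^ 2 * ∫⁻ t in Set.Icc (0 : ℝ) 1, ∫⁻ y in S,
          ‖gradient φ ((y + q) + t • ((s • y + p) - (y + q)))‖ₑ ^ 2 := by
        rw [lintegral_const_mul' _ _ (by simp), lintegral_lintegral_swap]
        have : Continuous fun x : Eu d × ℝ =>
            gradient φ ((x.1 + q) + x.2 • ((s • x.1 + p) - (x.1 + q))) := by fun_prop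
        exact (this.measurable.enorm.pow_const 2).aemeasurable
    _ ≤ ENNReal.ofReal δ ^ 2 * ∫⁻ t in Set.Icc (0 : ℝ) 1, ∫⁻ z in S', ‖gradient φ z‖ₑ ^ 2 := by
        refine mul_le_mul' le_rfl (setLIntegral_mono' measurableSet_Icc fun t ht => ?_)
        have e : ∀ y : Eu d, (y + q) + t • ((s • y + p) - (y + q)) =
            (1 + t * (s - 1)) • y + (q + t • (p - q)) := fun y => by module
        simp only [e]
        refine setLIntegral_dilation_le (fun z => ‖gradient φ z‖ₑ ^ 2) hS hS' ?_ _ fun y hy => ?_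
        · have : 0 ≤ t * (s - 1) := mul_nonneg ht.1 (sub_nonneg.2 hs)
          linarith
        · rw [← e]
          exact h y hy t ht
    _ = _ := by simp

theorem enorm_sq_eq_lintegral {α F : Type*} {m : MeasurableSpace α} {μ : Measure α}
    [NormedAddCommGroup F] (f : Lp F 2 μ) : ‖f‖ₑ ^ 2 = ∫⁻ x, ‖f x‖ₑ ^ 2 ∂μ := by
  rw [Lp.enorm_def]
  have := eLpNorm_nnreal_pow_eq_lintegral (f := f) (μ := μ) (p := 2) (by norm_num)
  simpa using this

/-- Closed conditions on pairs `(v, ∇v)` extend from test functions to `H¹₀(D)`. -/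
theorem H10.induction_closed {P : PairSpace d L → Prop} (hP : IsClosed {p | P p})
    (h : ∀ p ∈ testPairs d L, P p) (v : H10 d L) : P v.1 :=
  closure_minimal h hP v.2

theorem continuous_fst : Continuous fun p : PairSpace d L => p.fst :=
  (WithLp.prod_continuous_ofLp 2 _ _).fst

theorem continuous_snd : Continuous fun p : PairSpace d L => p.snd :=
  (WithLp.prod_continuous_ofLp 2 _ _).snd

theorem gradient_eq_zero_of_tsupport_subset {φ : Eu d → ℝ} {s : Set (Eu d)}
    (h : tsupport φ ⊆ s) {x : Eu d} (hx : x ∉ s) : gradient φ x = 0 := by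
  have : x ∉ tsupport (fderiv ℝ φ) := fun k => hx (h (tsupport_fderiv_subset ℝ k))
  rw [gradient, image_eq_zero_of_notMem_tsupport this, map_zero]

theorem lintegral_gradient_sq {p : PairSpace d L} {φ : Eu d → ℝ} (h : tsupport φ ⊆ cube d L)
    (hp : p.snd =ᵐ[volume.restrict (cube d L)] gradient φ) :
    ∫⁻ z, ‖gradient φ z‖ₑ ^ 2 = ‖p.snd‖ₑ ^ 2 := by
  rw [enorm_sq_eq_lintegral, ← setLIntegral_eq_of_support_subset (s := cube d L)]
  · exact (lintegral_congr_ae (hp.mono fun x hx => by simp only [hx])).symm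
  · intro x hx
    by_contra hc
    exact hx (by simp [gradient_eq_zero_of_tsupport_subset h hc])

/-- If the translate of `S ⊆ D` by `e` lies outside `D`, then the `L²(S)`-norm of a function in
`H¹₀(D)` is at most `‖e‖` times the norm of its gradient. -/
theorem setLIntegral_val_sq_le {S : Set (Eu d)} (hS : MeasurableSet S) (hSD : S ⊆ cube d L)
    (e : Eu d) (he : ∀ y ∈ S, y + e ∉ cube d L) (v : H10 d L) :
    ∫⁻ x in S, ‖val v x‖ₑ ^ 2 ≤ (‖e‖ₑ * ‖grad v‖ₑ) ^ 2 := by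
  let R := LpToLpRestrictCLM (Eu d) ℝ ℝ (volume.restrict (cube d L)) 2 S
  have hR : ∀ f : L2 d L, ‖R f‖ₑ ^ 2 = ∫⁻ x in S, ‖f x‖ₑ ^ 2 := by
    intro f
    rw [enorm_sq_eq_lintegral]
    have h1 := LpToLpRestrictCLM_coeFn ℝ S f
    refine (lintegral_congr_ae (g := fun x => ‖f x‖ₑ ^ 2)
      (h1.mono fun x hx => by simp only [R, hx])).trans ?_
    rw [Measure.restrict_restrict_of_subset hSD]
  have hcl : IsClosed {p : PairSpace d L | ‖R p.fst‖ ≤ ‖e‖ * ‖p.snd‖} :=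
    isClosed_le (R.continuous.comp continuous_fst).norm
      (continuous_const.mul continuous_snd.norm)
  have key := H10.induction_closed hcl ?_ v
  · rw [← hR]
    gcongr
    rw [← ofReal_norm, ← ofReal_norm, ← ofReal_norm, ← ENNReal.ofReal_mul (norm_nonneg _)]
    exact ENNReal.ofReal_le_ofReal key
  · rintro p ⟨φ, h1, h2, h3, h4, h5⟩
    have h6 := lintegral_displacement_le (h1.of_le (by simp)) hS MeasurableSet.univ le_rfl e 0
      (fun y _ t _ => Set.mem_univ _) (δ := ‖e‖) (fun y _ => by simp)
    rw [Measure.restrict_univ, lintegral_gradient_sq h3 h5, ofReal_norm, ← mul_pow] at h6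
    have h7 : ‖R p.fst‖ₑ ^ 2 ≤ (‖e‖ₑ * ‖p.snd‖ₑ) ^ 2 := by
      rw [hR]
      refine le_trans (le_of_eq ?_) h6
      refine lintegral_congr_ae ?_
      filter_upwards [ae_restrict_of_ae_restrict_of_subset hSD h4, ae_restrict_mem hS] with x hx hxS
      rw [hx, one_smul, image_eq_zero_of_notMem_tsupport (fun k => he x hxS (h3 k))]
      simp
    have h8 := (ENNReal.pow_le_pow_left_iff (by norm_num)).1 h7
    rw [← ofReal_norm, ← ofReal_norm, ← ofReal_norm, ← ENNReal.ofReal_mul (norm_nonneg _)] at h8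
    exact (ENNReal.ofReal_le_ofReal_iff (by positivity)).1 h8

/-- The Poincaré inequality in `H¹₀(D)`. -/
theorem norm_val_le (hd : 0 < d) (hL : 0 ≤ L) (v : H10 d L) : ‖val v‖ ≤ L * ‖grad v‖ := by
  have h := setLIntegral_val_sq_le (isOpen_cube d L).measurableSet subset_rfl
    (EuclideanSpace.single ⟨0, hd⟩ L) (fun y hy k => ?_) v
  · rw [← enorm_sq_eq_lintegral] at h
    have h8 := (ENNReal.pow_le_pow_left_iff (by norm_num)).1 h
    rw [← ofReal_norm, ← ofReal_norm, ← ofReal_norm, ← ENNReal.ofReal_mul (norm_nonneg _)] at h8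
    simpa [abs_of_nonneg hL] using (ENNReal.ofReal_le_ofReal_iff (by positivity)).1 h8
  · have h1 := (hy ⟨0, hd⟩).1
    have h2 := (k ⟨0, hd⟩).2
    simp at h2
    linarith

theorem closure_cube (hL : 0 < L) : closure (cube d L) = {x | ∀ i, x i ∈ Set.Icc 0 L} := by
  have h : cube d L = (EuclideanSpace.equiv (Fin d) ℝ).toHomeomorph ⁻¹'
      (Set.univ.pi fun _ => Set.Ioo 0 L) := by
    ext x; simp [cube]
  rw [h, ← Homeomorph.preimage_closure, closure_pi_set]
  ext x
  simp [closure_Ioo hL.ne, Pi.le_def, forall_and]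

theorem exists_apply_eq_of_mem_frontier (hL : 0 < L) {a : Eu d} (ha : a ∈ frontier (cube d L)) :
    ∃ i, a i = 0 ∨ a i = L := by
  rw [(isOpen_cube d L).frontier_eq, closure_cube hL] at ha
  obtain ⟨h1, h2⟩ := ha
  simp only [cube, Set.mem_ofPred_eq, not_forall] at h2
  obtain ⟨i, hi⟩ := h2
  refine ⟨i, ?_⟩
  by_contra! hc
  exact hi ⟨lt_of_le_of_ne (h1 i).1 (Ne.symm hc.1), lt_of_le_of_ne (h1 i).2 hc.2⟩

theorem norm_le_of_forall_abs_le {y : Eu d} {r : ℝ} (hr : 0 ≤ r) (h : ∀ j, |y j| ≤ r) :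
    ‖y‖ ≤ √d * r := by
  rw [EuclideanSpace.norm_eq]
  refine Real.sqrt_le_iff.2 ⟨by positivity, ?_⟩
  rw [mul_pow, Real.sq_sqrt (by positivity)]
  calc ∑ j, ‖y j‖ ^ 2 ≤ ∑ _j : Fin d, r ^ 2 := by
        refine Finset.sum_le_sum fun j _ => ?_
        gcongr
        exact h j
    _ = d * r ^ 2 := by simp

theorem volume_box (l u : Fin d → ℝ) :
    volume {x : Eu d | ∀ j, x j ∈ Set.Ioo (l j) (u j)} = ∏ j, ENNReal.ofReal (u j - l j) := by
  rw [← Real.volume_pi_Ioo, ← (EuclideanSpace.volume_preserving_symm_measurableEquiv_toLp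
    (Fin d)).measure_preimage (MeasurableSet.univ_pi fun _ => measurableSet_Ioo).nullMeasurableSet]
  congr 1
  ext x
  simp

/-- Functions in `H¹₀(D)` with a continuous representative vanish on the boundary: in a strip of
width `ε` the square integral of such a function is `O(ε²)`, while the volume of the strip near a
boundary point is of order `ε`. -/
theorem eq_zero_of_mem_frontier (hL : 0 < L) {v : H10 d L} {g : Eu d → ℝ}
    (hg : ContinuousOn g (closure (cube d L))) (hv : val v =ᵐ[volume.restrict (cube d L)] g)
    {a : Eu d} (ha : a ∈ frontier (cube d L)) : g a = 0 := by
  by_contra hne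
  obtain ⟨i, hi⟩ := exists_apply_eq_of_mem_frontier hL ha
  have haD := frontier_subset_closure ha
  have haI : ∀ j, a j ∈ Set.Icc 0 L := by rwa [closure_cube hL] at haD
  set c := |g a| / 2 with hc
  have hc0 : 0 < c := by positivity
  obtain ⟨r, hr, hball⟩ : ∃ r > 0, ∀ x ∈ closure (cube d L), dist x a < r → c ≤ |g x| := by
    obtain ⟨r, hr, h⟩ := Metric.continuousOn_iff.1 hg a haD c hc0
    refine ⟨r, hr, fun x hx hxa => ?_⟩
    have h1 := h x hx hxa
    rw [Real.dist_eq] at h1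
    have h2 := abs_sub_abs_le_abs_sub (g a) (g x)
    rw [abs_sub_comm] at h2
    linarith
  obtain ⟨ρ, hρ, hρL, hρr⟩ : ∃ ρ > 0, ρ ≤ L / 2 ∧ √d * ρ < r := by
    refine ⟨min (L / 2) (r / (√d + 1)), by positivity, min_le_left _ _, ?_⟩
    calc √d * min (L / 2) (r / (√d + 1)) ≤ √d * (r / (√d + 1)) := by
          gcongr; exact min_le_right _ _
      _ < r := by
          rw [mul_div_assoc', div_lt_iff₀ (by positivity)]
          nlinarith
  have key : ∀ ε, 0 < ε → ε ≤ ρ →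
      c ^ 2 * ρ ^ (Finset.univ.erase i).card ≤ ε * ‖grad v‖ ^ 2 := by
    intro ε hε hερ
    -- A box in `D` with the corner `a`, the side `ε` normal to the face and the sides `ρ` along it.
    let w : Fin d → ℝ := fun j => if j = i then ε else ρ
    have hw : ∀ j, 0 < w j ∧ w j ≤ ρ := fun j => by
      simp only [w]; split_ifs <;> simp [*]
    let l : Fin d → ℝ := fun j => if a j ≤ L / 2 then a j else a j - w j
    have hl : ∀ j, l j ≤ a j ∧ a j ≤ l j + w j ∧ 0 ≤ l j ∧ l j + w j ≤ L := fun j => by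
      have := hw j
      have := haI j
      simp only [l]
      split_ifs with h
      · exact ⟨le_rfl, by linarith, this.1, by linarith⟩
      · push Not at h
        exact ⟨by linarith, by linarith, by linarith, by linarith [this.2]⟩
    let S : Set (Eu d) := {x | ∀ j, x j ∈ Set.Ioo (l j) (l j + w j)}
    have hSD : S ⊆ cube d L := fun x hx j =>
      ⟨(hl j).2.2.1.trans_lt (hx j).1, (hx j).2.trans_le (hl j).2.2.2⟩
    have hSm : MeasurableSet S := by
      have : S = ⋂ j, (fun x : Eu d => x j) ⁻¹' Set.Ioo (l j) (l j + w j) := by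
        ext x; simp [S]
      rw [this]
      exact MeasurableSet.iInter fun j => measurableSet_Ioo.preimage (by fun_prop)
    have hSc : ∀ x ∈ S, c ≤ |g x| := fun x hx => by
      refine hball x (subset_closure (hSD hx)) (lt_of_le_of_lt ?_ hρr)
      rw [dist_eq_norm]
      refine norm_le_of_forall_abs_le hρ.le fun j => ?_
      rw [PiLp.sub_apply, abs_le]
      have h1 := hl j
      have h2 := hx j
      have h3 := hw j
      exact ⟨by linarith [h2.1], by linarith [h2.2]⟩
    have hvol : volume S = ENNReal.ofReal (ε * ρ ^ (Finset.univ.erase i).card) := by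
      rw [volume_box l fun j => l j + w j, ← Finset.mul_prod_erase _ _ (Finset.mem_univ i),
        Finset.prod_congr rfl (g := fun _ => ENNReal.ofReal ρ)]
      · rw [Finset.prod_const, ← ENNReal.ofReal_pow hρ.le,
          ← ENNReal.ofReal_mul (by simp [w, hε.le])]
        simp [w]
      · intro j hj
        simp [w, Finset.ne_of_mem_erase hj]
    have h1 := setLIntegral_val_sq_le hSm hSD
      (EuclideanSpace.single i (if a i ≤ L / 2 then -ε else ε)) (fun y hy k => ?_) v
    · have h2 : ENNReal.ofReal (c ^ 2) * volume S ≤ ∫⁻ x in S, ‖val v x‖ₑ ^ 2 := by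
        rw [← setLIntegral_const]
        refine lintegral_mono_ae ?_
        filter_upwards [ae_restrict_of_ae_restrict_of_subset hSD hv, ae_restrict_mem hSm]
          with x hx hxS
        rw [hx, ← ofReal_norm, ← ENNReal.ofReal_pow (norm_nonneg _)]
        refine ENNReal.ofReal_le_ofReal ?_
        gcongr
        exact hSc x hxS
      have h3 := h2.trans h1
      rw [hvol, ← ofReal_norm, ← ofReal_norm, ← ENNReal.ofReal_mul (norm_nonneg _),
        ← ENNReal.ofReal_mul (by positivity), ← ENNReal.ofReal_pow (by positivity),
        ENNReal.ofReal_le_ofReal_iff (by positivity)] at h3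
      have h4 : ‖(EuclideanSpace.single i (if a i ≤ L / 2 then -ε else ε) : Eu d)‖ = ε := by
        split_ifs <;> simp [abs_of_pos hε]
      rw [h4] at h3
      refine le_of_mul_le_mul_left ?_ hε
      linarith
    · have h2 := hy i
      have h3 := k i
      simp only [l, w, if_true] at h2
      simp only [PiLp.add_apply, PiLp.single_apply, if_true] at h3
      rcases hi with h0 | h0
      · have : a i ≤ L / 2 := by rw [h0]; positivity
        simp only [this, if_true] at h2 h3
        linarith [h2.2, h3.1]
      · have : ¬ a i ≤ L / 2 := by rw [h0]; linarith
        simp only [this, if_false] at h2 h3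
        linarith [h2.1, h3.2]
  set κ := c ^ 2 * ρ ^ (Finset.univ.erase i).card with hκ
  have hκ0 : 0 < κ := by positivity
  have h1 := key (min ρ (κ / (2 * (‖grad v‖ ^ 2 + 1)))) (by positivity) (min_le_left _ _)
  have h2 : min ρ (κ / (2 * (‖grad v‖ ^ 2 + 1))) * ‖grad v‖ ^ 2 ≤
      κ / (2 * (‖grad v‖ ^ 2 + 1)) * (‖grad v‖ ^ 2 + 1) := by
    gcongr
    · exact min_le_right _ _
    · linarith
  have h3 : κ / (2 * (‖grad v‖ ^ 2 + 1)) * (‖grad v‖ ^ 2 + 1) = κ / 2 := by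
    field_simp
  linarith

end

/-! ### Barycentric coordinates and nodal interpolation -/

section

variable {d : ℕ} {L : ℝ}
namespace Triangulation
variable (𝒯 : Triangulation d L)

theorem finite_elements : 𝒯.elements.Finite := 𝒯.finite_faces.subset fun _ h => h.1

instance : Finite 𝒯.elements := 𝒯.finite_elements.to_subtype

instance : Fintype 𝒯.elements := Fintype.ofFinite _

variable {𝒯} in
theorem mem_nodes {K : Finset (Eu d)} (hK : K ∈ 𝒯.faces) {a : Eu d} (ha : a ∈ K) : a ∈ 𝒯.nodes :=
  𝒯.down_closed hK (by simpa using ha) (by simp)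

theorem exists_bary (K : 𝒯.elements) : ∃ lam : Eu d → (Eu d →ᵃ[ℝ] ℝ), (∀ a ∉ K.1, lam a = 0) ∧
    (∀ a ∈ K.1, ∀ b ∈ K.1, lam a b = if a = b then 1 else 0) ∧ (∀ x, ∑ a ∈ K.1, lam a x = 1) ∧
    (∀ x, ∑ a ∈ K.1, lam a x • a = x) ∧
    (∀ x ∈ convexHull ℝ (K.1 : Set (Eu d)), ∀ a, 0 ≤ lam a x) := by
  classical
  obtain ⟨K, hK, hcard⟩ := K
  have hind := 𝒯.indep hK
  have htot : affineSpan ℝ (Set.range ((↑) : K → Eu d)) = ⊤ := by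
    rw [hind.affineSpan_eq_top_iff_card_eq_finrank_add_one]
    simp [hcard]
  obtain ⟨B, hB⟩ : ∃ B : AffineBasis K ℝ (Eu d), ∀ i, B i = i := ⟨⟨(↑), hind, htot⟩, fun _ => rfl⟩
  have hBr : Set.range B = (K : Set (Eu d)) := by
    ext x; simp [hB]
  refine ⟨fun a => if h : a ∈ K then B.coord ⟨a, h⟩ else 0, fun a ha => by simp [ha],
    fun a ha b hb => ?_, fun x => ?_, fun x => ?_, fun x hx a => ?_⟩
  · have := B.coord_apply ⟨a, ha⟩ ⟨b, hb⟩
    simpa [ha, hB] using this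
  · rw [← B.sum_coord_apply_eq_one x, ← Finset.sum_coe_sort]
    exact Finset.sum_congr rfl fun i _ => by simp
  · conv_rhs => rw [← B.linear_combination_coord_eq_self x]
    rw [← Finset.sum_coe_sort]
    exact Finset.sum_congr rfl fun i _ => by simp [hB]
  · rw [← hBr, B.convexHull_eq_nonneg_coord] at hx
    by_cases ha : a ∈ K
    · simpa [ha] using hx ⟨a, ha⟩
    · simp [ha]

/-- The barycentric coordinate of the element `K` that belongs to the vertex `a`, as an affine
function on the whole space; it is `0` if `a` is not a vertex of `K`. -/
def bary (K : 𝒯.elements) : Eu d → (Eu d →ᵃ[ℝ] ℝ) := (𝒯.exists_bary K).choose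

theorem bary_of_notMem (K : 𝒯.elements) {a : Eu d} (ha : a ∉ K.1) : 𝒯.bary K a = 0 :=
  (𝒯.exists_bary K).choose_spec.1 a ha

theorem bary_apply (K : 𝒯.elements) {a b : Eu d} (ha : a ∈ K.1) (hb : b ∈ K.1)
    [Decidable (a = b)] : 𝒯.bary K a b = if a = b then 1 else 0 := by
  have := (𝒯.exists_bary K).choose_spec.2.1 a ha b hb
  rw [bary, this]
  congr

theorem sum_bary (K : 𝒯.elements) (x : Eu d) : ∑ a ∈ K.1, 𝒯.bary K a x = 1 :=
  (𝒯.exists_bary K).choose_spec.2.2.1 x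

theorem sum_bary_smul (K : 𝒯.elements) (x : Eu d) : ∑ a ∈ K.1, 𝒯.bary K a x • a = x :=
  (𝒯.exists_bary K).choose_spec.2.2.2.1 x

theorem bary_nonneg (K : 𝒯.elements) {x : Eu d} (hx : x ∈ convexHull ℝ (K.1 : Set (Eu d)))
    (a : Eu d) : 0 ≤ 𝒯.bary K a x :=
  (𝒯.exists_bary K).choose_spec.2.2.2.2 x hx a

/-- Barycentric coordinates in a simplex of the triangulation are unique. -/
theorem weights_unique {s : Finset (Eu d)} (hs : s ∈ 𝒯.faces) {w w' : Eu d → ℝ}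
    (h1 : ∑ v ∈ s, w v = ∑ v ∈ s, w' v) (h2 : ∑ v ∈ s, w v • v = ∑ v ∈ s, w' v • v)
    {a : Eu d} (ha : a ∈ s) : w a = w' a := by
  have := affineIndependent_iff.1 (𝒯.indep hs) Finset.univ (fun v => w v - w' v)
    (by
      rw [Finset.univ_eq_attach, Finset.sum_attach s (fun v => w v - w' v),
        Finset.sum_sub_distrib, h1, sub_self])
    (by
      rw [Finset.univ_eq_attach, Finset.sum_attach s (fun v => (w v - w' v) • v)]
      simp only [sub_smul, Finset.sum_sub_distrib, h2, sub_self])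
    ⟨a, ha⟩ (Finset.mem_univ _)
  exact sub_eq_zero.1 this

/-- The weight of a node in barycentric coordinates of a point of an element does not depend on
the simplex of the triangulation in which the coordinates are taken. -/
theorem IsBary.eq_bary {𝒯 : Triangulation d L} {a x : Eu d} {p : Finset (Eu d) × (Eu d → ℝ)}
    (hp : 𝒯.IsBary a x p) (K : 𝒯.elements) (hx : x ∈ convexHull ℝ (K.1 : Set (Eu d))) :
    p.2 a = 𝒯.bary K a x := by
  classical
  obtain ⟨s, w⟩ := p
  obtain ⟨hs, has, hw, hw1, hwx⟩ := hp
  have hxs : x ∈ convexHull ℝ (s : Set (Eu d)) := Finset.mem_convexHull'.2 ⟨w, hw, hw1, hwx⟩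
  -- By conformity `x` is a convex combination of common vertices; both sets of coordinates are
  -- the extension of these weights by zero.
  have h := 𝒯.inter_subset_convexHull hs K.2.1 ⟨hxs, hx⟩
  rw [← Finset.coe_inter, Finset.mem_convexHull'] at h
  obtain ⟨μ, -, hμ1, hμx⟩ := h
  have e1 : ∀ t : Finset (Eu d), s ∩ K.1 ⊆ t →
      ∑ v ∈ t, (if v ∈ s ∩ K.1 then μ v else 0) = 1 := fun t ht => by
    rw [← hμ1, Finset.sum_ite_mem, Finset.inter_eq_right.2 ht]
  have e2 : ∀ t : Finset (Eu d), s ∩ K.1 ⊆ t →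
      ∑ v ∈ t, (if v ∈ s ∩ K.1 then μ v else 0) • v = x := fun t ht => by
    simp only [ite_smul, zero_smul]
    rw [← hμx, Finset.sum_ite_mem, Finset.inter_eq_right.2 ht]
  have k1 : w a = if a ∈ s ∩ K.1 then μ a else 0 :=
    𝒯.weights_unique hs (w' := fun v => if v ∈ s ∩ K.1 then μ v else 0)
      (by rw [hw1, e1 s Finset.inter_subset_left])
      (by rw [hwx, e2 s Finset.inter_subset_left]) has
  change w a = _
  by_cases ha : a ∈ K.1
  · rw [k1]
    exact (𝒯.weights_unique K.2.1 (w := fun v => 𝒯.bary K v x)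
      (w' := fun v => if v ∈ s ∩ K.1 then μ v else 0)
      (by rw [𝒯.sum_bary, e1 K.1 Finset.inter_subset_right])
      (by rw [𝒯.sum_bary_smul, e2 K.1 Finset.inter_subset_right]) ha).symm
  · rw [k1, 𝒯.bary_of_notMem K ha]
    simp [ha]

theorem hat_eq_bary (K : 𝒯.elements) {x : Eu d} (hx : x ∈ convexHull ℝ (K.1 : Set (Eu d)))
    (a : Eu d) : 𝒯.hat a x = 𝒯.bary K a x := by
  rw [hat]
  split_ifs with h
  · exact IsBary.eq_bary h.choose_spec K hx
  · rw [𝒯.bary_of_notMem K fun ha => h ⟨(K.1, fun v => 𝒯.bary K v x), K.2.1, ha,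
      fun v _ => 𝒯.bary_nonneg K hx v, 𝒯.sum_bary K x, 𝒯.sum_bary_smul K x⟩]
    rfl

theorem exists_mem_element {x : Eu d} (hx : x ∈ closure (cube d L)) :
    ∃ K : 𝒯.elements, x ∈ convexHull ℝ (K.1 : Set (Eu d)) := by
  rw [← 𝒯.space_eq, Geometry.SimplicialComplex.mem_space_iff] at hx
  obtain ⟨s, hs, hxs⟩ := hx
  obtain ⟨K, hK, hsK, hcard⟩ := 𝒯.pure s hs
  exact ⟨⟨K, hK, hcard⟩, convexHull_mono (Finset.coe_subset.2 hsK) hxs⟩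

theorem convexHull_subset_closure (K : 𝒯.elements) :
    convexHull ℝ (K.1 : Set (Eu d)) ⊆ closure (cube d L) := by
  rw [← 𝒯.space_eq]
  exact Geometry.SimplicialComplex.convexHull_subset_space K.2.1

theorem exists_element_of_mem_nodes {a : Eu d} (ha : a ∈ 𝒯.nodes) : ∃ K : 𝒯.elements, a ∈ K.1 := by
  obtain ⟨K, hK, hsK, hcard⟩ := 𝒯.pure _ ha
  exact ⟨⟨K, hK, hcard⟩, by simpa using hsK⟩

theorem iUnion_elements : ⋃ K : 𝒯.elements, convexHull ℝ (K.1 : Set (Eu d)) =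
    closure (cube d L) :=
  Set.Subset.antisymm (Set.iUnion_subset 𝒯.convexHull_subset_closure) fun _ hx =>
    Set.mem_iUnion.2 (𝒯.exists_mem_element hx)

theorem hat_eq_zero_of_notMem {x : Eu d} (hx : x ∉ closure (cube d L)) (a : Eu d) :
    𝒯.hat a x = 0 := by
  rw [hat, dif_neg]
  rintro ⟨p, hp, -, h0, h1, hx'⟩
  refine hx ?_
  rw [← 𝒯.space_eq]
  exact Geometry.SimplicialComplex.convexHull_subset_space hp
    (Finset.mem_convexHull'.2 ⟨p.2, h0, h1, hx'⟩)

/-- The affine function with the values `c a` at the vertices `a` of `K`. -/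
def interpAffine (K : 𝒯.elements) (c : Eu d → ℝ) : Eu d →ᵃ[ℝ] ℝ := ∑ a ∈ K.1, c a • 𝒯.bary K a

theorem interpAffine_apply (K : 𝒯.elements) (c : Eu d → ℝ) (x : Eu d) :
    𝒯.interpAffine K c x = ∑ a ∈ K.1, c a * 𝒯.bary K a x := by
  have h : ∀ s : Finset (Eu d), (∑ a ∈ s, c a • 𝒯.bary K a) x = ∑ a ∈ s, c a * 𝒯.bary K a x := by
    classical
    intro s
    induction s using Finset.induction_on with
    | empty => simp
    | insert a s ha ih => rw [Finset.sum_insert ha, Finset.sum_insert ha, ← ih]; simp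
  exact h K.1

theorem interp_eq (K : 𝒯.elements) {x : Eu d} (hx : x ∈ convexHull ℝ (K.1 : Set (Eu d)))
    (c : Eu d → ℝ) : 𝒯.interp c x = 𝒯.interpAffine K c x := by
  rw [interp, interpAffine_apply]
  simp only [𝒯.hat_eq_bary K hx]
  refine (Finset.sum_subset (fun a ha => ?_) fun a _ ha => ?_).symm
  · simpa using mem_nodes K.2.1 ha
  · simp [𝒯.bary_of_notMem K ha]

theorem interp_eq_zero_of_notMem {x : Eu d} (hx : x ∉ closure (cube d L)) (c : Eu d → ℝ) :
    𝒯.interp c x = 0 :=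
  Finset.sum_eq_zero fun a _ => by rw [𝒯.hat_eq_zero_of_notMem hx, mul_zero]

theorem interpAffine_apply_vertex (K : 𝒯.elements) (c : Eu d → ℝ) {a : Eu d} (ha : a ∈ K.1) :
    𝒯.interpAffine K c a = c a := by
  classical
  rw [interpAffine_apply, Finset.sum_eq_single a]
  · simp [𝒯.bary_apply K ha ha]
  · intro b hb hba
    simp [𝒯.bary_apply K hb ha, hba]
  · exact fun h => absurd ha h

theorem interp_apply_node (c : Eu d → ℝ) {a : Eu d} (ha : a ∈ 𝒯.nodes) : 𝒯.interp c a = c a := by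
  obtain ⟨K, hK⟩ := 𝒯.exists_element_of_mem_nodes ha
  rw [𝒯.interp_eq K (subset_convexHull ℝ _ hK), 𝒯.interpAffine_apply_vertex K c hK]

theorem abs_interp_le {c : Eu d → ℝ} {B : ℝ} (hB : ∀ a ∈ 𝒯.nodes, |c a| ≤ B) {x : Eu d}
    (hx : x ∈ closure (cube d L)) : |𝒯.interp c x| ≤ B := by
  obtain ⟨K, hK⟩ := 𝒯.exists_mem_element hx
  rw [𝒯.interp_eq K hK, interpAffine_apply]
  calc |∑ a ∈ K.1, c a * 𝒯.bary K a x| ≤ ∑ a ∈ K.1, |c a * 𝒯.bary K a x| :=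
        Finset.abs_sum_le_sum_abs _ _
    _ ≤ ∑ a ∈ K.1, B * 𝒯.bary K a x := by
        refine Finset.sum_le_sum fun a ha => ?_
        rw [abs_mul, abs_of_nonneg (𝒯.bary_nonneg K hK a)]
        exact mul_le_mul_of_nonneg_right (hB a (mem_nodes K.2.1 ha)) (𝒯.bary_nonneg K hK a)
    _ = B := by rw [← Finset.mul_sum, 𝒯.sum_bary, mul_one]

/-- A face of the cube that contains a point of an element contains every vertex of the element
with a positive weight. -/
theorem interp_eq_zero_of_mem_frontier (hL : 0 < L) {c : Eu d → ℝ}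
    (hc : ∀ a ∈ 𝒯.nodes, a ∈ frontier (cube d L) → c a = 0) {x : Eu d}
    (hx : x ∈ frontier (cube d L)) : 𝒯.interp c x = 0 := by
  obtain ⟨K, hK⟩ := 𝒯.exists_mem_element (frontier_subset_closure hx)
  obtain ⟨i, hi⟩ := exists_apply_eq_of_mem_frontier hL hx
  have hxi : ∑ a ∈ K.1, 𝒯.bary K a x * a i = x i := by
    have := congrArg (fun y : Eu d => y i) (𝒯.sum_bary_smul K x)
    simpa using this
  have hfr : ∀ a ∈ K.1, a i = 0 ∨ a i = L → c a = 0 := fun a ha h => by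
    refine hc a (mem_nodes K.2.1 ha) ?_
    rw [(isOpen_cube d L).frontier_eq]
    refine ⟨𝒯.nodes_subset (mem_nodes K.2.1 ha), fun hD => ?_⟩
    have := hD i
    rcases h with h | h <;> simp [h] at this
  have hcl : ∀ a ∈ K.1, a i ∈ Set.Icc 0 L := fun a ha => by
    have := 𝒯.nodes_subset (mem_nodes K.2.1 ha)
    rw [closure_cube hL] at this
    exact this i
  rw [𝒯.interp_eq K hK, interpAffine_apply]
  refine Finset.sum_eq_zero fun a ha => ?_
  have hlam := 𝒯.bary_nonneg K hK
  rcases hi with h0 | h0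
  · have h1 : 𝒯.bary K a x * a i = 0 :=
      (Finset.sum_eq_zero_iff_of_nonneg fun b hb => mul_nonneg (hlam b) (hcl b hb).1).1
        (hxi.trans h0) a ha
    rcases mul_eq_zero.1 h1 with h | h
    · simp [h]
    · simp [hfr a ha (Or.inl h)]
  · have h2 : ∑ a ∈ K.1, 𝒯.bary K a x * (L - a i) = 0 := by
      simp only [mul_sub, Finset.sum_sub_distrib, ← Finset.sum_mul, 𝒯.sum_bary, hxi, h0]
      ring
    have h1 := (Finset.sum_eq_zero_iff_of_nonneg fun b hb =>
      mul_nonneg (hlam b) (sub_nonneg.2 (hcl b hb).2)).1 h2 a ha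
    rcases mul_eq_zero.1 h1 with h | h
    · simp [h]
    · simp [hfr a ha (Or.inr (sub_eq_zero.1 h).symm)]

/-- Two elements meet in a null set: the barycentric coordinate of a vertex of `K` that is not in
`K'` vanishes there. -/
theorem volume_inter_eq_zero {K K' : 𝒯.elements} (h : K ≠ K') :
    volume (convexHull ℝ (K.1 : Set (Eu d)) ∩ convexHull ℝ (K'.1 : Set (Eu d))) = 0 := by
  classical
  obtain ⟨a, ha, ha'⟩ : ∃ a ∈ K.1, a ∉ K'.1 := by
    by_contra! hc
    exact h (Subtype.ext (Finset.eq_of_subset_of_card_le hc (by rw [K.2.2, K'.2.2])))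
  let S : AffineSubspace ℝ (Eu d) := (AffineSubspace.mk' (0 : ℝ) ⊥).comap (𝒯.bary K a)
  have hS : ∀ x, x ∈ S ↔ 𝒯.bary K a x = 0 := fun x => by
    simp [S, AffineSubspace.mem_comap, AffineSubspace.mem_mk']
  refine measure_mono_null (t := (S : Set (Eu d))) ?_ (Measure.addHaar_affineSubspace _ _ ?_)
  · rintro x ⟨hx, hx'⟩
    refine (hS x).2 ?_
    rw [← 𝒯.hat_eq_bary K hx, 𝒯.hat_eq_bary K' hx', 𝒯.bary_of_notMem K' ha']
    rfl
  · intro ht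
    have : a ∈ S := ht ▸ AffineSubspace.mem_top ℝ _ a
    rw [hS, 𝒯.bary_apply K ha ha] at this
    simp at this

theorem isClosed_element (K : 𝒯.elements) : IsClosed (convexHull ℝ (K.1 : Set (Eu d))) :=
  (K.1.finite_toSet.isCompact_convexHull ℝ).isClosed

theorem measurableSet_element (K : 𝒯.elements) :
    MeasurableSet (convexHull ℝ (K.1 : Set (Eu d))) := (𝒯.isClosed_element K).measurableSet

end Triangulation

theorem convex_cube : Convex ℝ (cube d L) := by
  intro x hx y hy a b ha hb hab i
  have := (convex_Ioo (0 : ℝ) L) (hx i) (hy i) ha hb hab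
  simpa using this

theorem isCompact_closure_cube (hL : 0 < L) : IsCompact (closure (cube d L)) := by
  refine Metric.isCompact_of_isClosed_isBounded isClosed_closure ?_
  refine (Metric.isBounded_closedBall (x := (0 : Eu d)) (r := √d * L)).subset fun x hx => ?_
  rw [closure_cube hL] at hx
  rw [mem_closedBall_zero_iff]
  exact norm_le_of_forall_abs_le hL.le fun j => by
    rw [abs_of_nonneg (hx j).1]; exact (hx j).2

theorem isFiniteMeasure_cube (hL : 0 < L) : IsFiniteMeasure (volume.restrict (cube d L)) := by
  refine ⟨?_⟩
  rw [Measure.restrict_apply_univ]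
  exact (measure_mono subset_closure).trans_lt (isCompact_closure_cube hL).measure_lt_top

theorem restrict_closure_cube :
    (volume : Measure (Eu d)).restrict (closure (cube d L)) = volume.restrict (cube d L) :=
  Measure.restrict_congr_set
    (closure_ae_eq_of_null_frontier (convex_cube.addHaar_frontier (μ := volume)))

namespace Triangulation
variable (𝒯 : Triangulation d L)

/-- Integrals over `D` are sums of integrals over the elements. -/
theorem restrict_cube_eq_sum : (volume : Measure (Eu d)).restrict (cube d L) =
    Measure.sum fun K : 𝒯.elements => volume.restrict (convexHull ℝ (K.1 : Set (Eu d))) := by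
  rw [← restrict_closure_cube, ← 𝒯.iUnion_elements]
  exact Measure.restrict_iUnion_ae (fun K K' h => 𝒯.volume_inter_eq_zero h)
    fun K => (𝒯.measurableSet_element K).nullMeasurableSet

theorem ae_element_mem_interior (K : 𝒯.elements) :
    ∀ᵐ x ∂(volume.restrict (convexHull ℝ (K.1 : Set (Eu d)))),
      x ∈ interior (convexHull ℝ (K.1 : Set (Eu d))) := by
  rw [← Measure.restrict_congr_set (interior_ae_eq_of_null_frontier
    ((convex_convexHull ℝ (K.1 : Set (Eu d))).addHaar_frontier volume))]
  exact ae_restrict_mem isOpen_interior.measurableSet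

theorem ae_mem_interior : ∀ᵐ x ∂(volume.restrict (cube d L)),
    ∃ K : 𝒯.elements, x ∈ interior (convexHull ℝ (K.1 : Set (Eu d))) := by
  rw [𝒯.restrict_cube_eq_sum, Measure.ae_sum_iff]
  exact fun K => (𝒯.ae_element_mem_interior K).mono fun x hx => ⟨K, hx⟩

theorem ae_element_of_ae (K : 𝒯.elements) {p : Eu d → Prop}
    (h : ∀ᵐ x ∂(volume.restrict (cube d L)), p x) :
    ∀ᵐ x ∂(volume.restrict (convexHull ℝ (K.1 : Set (Eu d)))), p x := by
  rw [𝒯.restrict_cube_eq_sum, Measure.ae_sum_iff] at h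
  exact h K

end Triangulation

end

/-! ### Smooth approximation of Lipschitz functions -/

section

variable {d : ℕ} {L : ℝ}

open Filter Topology in
/-- A function with pointwise Lipschitz constant `M` at every point is `M`-Lipschitz. -/
theorem lipschitz_of_forall_eventually {E : Type*} [NormedAddCommGroup E] [NormedSpace ℝ E]
    {f : E → ℝ} {M : ℝ} (h : ∀ x, ∀ᶠ y in 𝓝 x, |f y - f x| ≤ M * ‖y - x‖) (x y : E) :
    |f y - f x| ≤ M * ‖y - x‖ := by
  have hf : Continuous f := by
    refine continuous_iff_continuousAt.2 fun x => ?_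
    rw [ContinuousAt, tendsto_iff_dist_tendsto_zero]
    simp only [Real.dist_eq]
    have h1 : Continuous fun y => M * ‖y - x‖ := by fun_prop
    have h2 : Tendsto (fun y => M * ‖y - x‖) (𝓝 x) (𝓝 0) := by simpa using h1.tendsto x
    exact squeeze_zero' (Eventually.of_forall fun _ => abs_nonneg _) (h x) h2
  let γ : ℝ → E := fun t => x + t • (y - x)
  have hγ : Continuous γ := by fun_prop
  have key := image_le_of_liminf_slope_right_le_deriv_boundary (a := 0) (b := 1)
    (f := fun t => |f (γ t) - f x|) (B := fun t => M * ‖y - x‖ * t) (B' := fun _ => M * ‖y - x‖)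
    (by fun_prop) (by simp [γ]) (by fun_prop)
    (fun t _ => by simpa using ((hasDerivAt_id t).const_mul (M * ‖y - x‖)).hasDerivWithinAt)
    (fun t _ r hr => by
      have h1 : ∀ᶠ z in 𝓝[>] t, |f (γ z) - f (γ t)| ≤ M * ‖γ z - γ t‖ :=
        ((hγ.tendsto t).eventually (h (γ t))).filter_mono nhdsWithin_le_nhds
      refine Eventually.frequently ?_
      filter_upwards [h1, self_mem_nhdsWithin] with z hz hzt
      have hzt' : 0 < z - t := sub_pos.2 hzt
      refine lt_of_le_of_lt ?_ hr
      rw [slope_def_field, div_le_iff₀ hzt']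
      have e : γ z - γ t = (z - t) • (y - x) := by simp only [γ]; module
      rw [e, norm_smul, Real.norm_of_nonneg hzt'.le] at hz
      have h2 := abs_sub_abs_le_abs_sub (f (γ z) - f x) (f (γ t) - f x)
      rw [sub_sub_sub_cancel_right] at h2
      linarith)
    (show (1 : ℝ) ∈ Set.Icc 0 1 by simp)
  simpa [γ] using key

/-- The gradient of an affine function. -/
def gradOf (A : Eu d →ᵃ[ℝ] ℝ) : Eu d :=
  (InnerProductSpace.toDual ℝ (Eu d)).symm (LinearMap.toContinuousLinearMap A.linear)

theorem inner_gradOf (A : Eu d →ᵃ[ℝ] ℝ) (z : Eu d) : ⟪gradOf A, z⟫_ℝ = A.linear z := by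
  rw [gradOf, InnerProductSpace.toDual_symm_apply]
  rfl

theorem affine_sub_eq_inner (A : Eu d →ᵃ[ℝ] ℝ) (x y : Eu d) :
    A y - A x = ⟪gradOf A, y - x⟫_ℝ := by
  rw [inner_gradOf, ← vsub_eq_sub (A y), ← A.linearMap_vsub, vsub_eq_sub]

theorem gradient_eq_of_eventually {f : Eu d → ℝ} {a x : Eu d}
    (h : ∀ᶠ y in nhds x, f y = f x + ⟪a, y - x⟫_ℝ) : gradient f x = a := by
  refine HasGradientAt.gradient (hasGradientAt_iff_hasFDerivAt.2 ?_)
  have h1 : HasFDerivAt (fun y => f x + innerSL ℝ a (y - x)) (innerSL ℝ a) x :=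
    ((innerSL ℝ a).hasFDerivAt.comp x ((hasFDerivAt_id x).sub_const x)).const_add (f x)
  exact h1.congr_of_eventuallyEq h

/-- Contraction of `g` towards the centre of `D` by the factor `1 + ε`, followed by mollification at
a scale proportional to `ε`, gives a test function; where `g` is affine, so is the result. -/
theorem exists_smooth_approx (hL : 0 < L) {g : Eu d → ℝ} {M : ℝ} (hM : 0 ≤ M)
    (hg : ∀ x y, |g y - g x| ≤ M * ‖y - x‖) (hgc : Continuous g) (hg0 : ∀ x ∉ cube d L, g x = 0)
    {ε : ℝ} (hε : 0 < ε) (hε1 : ε ≤ 1) :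
    ∃ φ : Eu d → ℝ, ContDiff ℝ (⊤ : ℕ∞) φ ∧ HasCompactSupport φ ∧ tsupport φ ⊆ cube d L ∧
      (∀ x y, |φ y - φ x| ≤ 2 * M * ‖y - x‖) ∧
      (∀ x ∈ cube d L, |φ x - g x| ≤ M * ((√d + 1) * L * ε)) ∧
      ∀ x ∈ cube d L, ∀ A : Eu d →ᵃ[ℝ] ℝ,
        (∀ y ∈ Metric.ball x (((√d + 1) * L + 1) * ε), g y = A y) →
        gradient φ x = (1 + ε) • gradOf A := by
  set s := 1 + ε with hs
  -- The contraction moves the support away from the boundary by at least `L ε / 4`, more than `r`.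
  set r := L * ε / 8 with hr
  have hr0 : 0 < r := by positivity
  let m : Eu d := WithLp.toLp 2 fun _ => L / 2
  have hm : ∀ i, m i = L / 2 := fun _ => rfl
  let ρ : ContDiffBump (0 : Eu d) := ⟨r / 2, r, by positivity, by linarith⟩
  let w : Eu d → ℝ := ρ.normed volume
  have hw0 : ∀ t, 0 ≤ w t := fun t => ρ.nonneg_normed t
  have hwr : ∀ t, r ≤ ‖t‖ → w t = 0 := fun t ht => by
    by_contra hc
    have : t ∈ Function.support w := hc
    rw [ρ.support_normed_eq, mem_ball_zero_iff] at this
    exact absurd this (not_lt.2 ht)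
  have hwc : Continuous w := ρ.continuous_normed
  have hws : HasCompactSupport w := ρ.hasCompactSupport_normed
  have hint : ∀ F : Eu d → ℝ, Continuous F → Integrable fun t => w t * F t := fun F hF =>
    (hwc.mul hF).integrable_of_hasCompactSupport hws.mul_right
  have havg : ∀ F H : Eu d → ℝ, Continuous F → Continuous H → ∀ B : ℝ,
      (∀ t, ‖t‖ < r → |F t - H t| ≤ B) → |(∫ t, w t * F t) - ∫ t, w t * H t| ≤ B := by
    intro F H hF hH B hB
    rw [← integral_sub (hint F hF) (hint H hH)]
    calc |∫ t, (w t * F t - w t * H t)| ≤ ∫ t, w t * B := by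
          rw [← Real.norm_eq_abs]
          refine norm_integral_le_of_norm_le (hint (fun _ => B) continuous_const)
            (Filter.Eventually.of_forall fun t => ?_)
          rw [← mul_sub, norm_mul, Real.norm_of_nonneg (hw0 t)]
          rcases lt_or_ge ‖t‖ r with h | h
          · exact mul_le_mul_of_nonneg_left (hB t h) (hw0 t)
          · simp [hwr t h]
      _ = B := by
          rw [integral_mul_const]
          have : ∫ t, w t = 1 := ρ.integral_normed
          rw [this, one_mul]
  have hconst : ∀ k : ℝ, ∫ t, w t * k = k := fun k => by
    rw [integral_mul_const]
    have : ∫ t, w t = 1 := ρ.integral_normed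
    rw [this, one_mul]
  -- `φ x` is the weighted average of `g (T x t)` over `‖t‖ < r`.
  let T : Eu d → Eu d → Eu d := fun x t => m + s • (x - t - m)
  have hT : ∀ x, Continuous (T x) := fun x => by fun_prop
  have hTx : ∀ x ∈ cube d L, ∀ t, ‖t‖ < r → ‖T x t - x‖ ≤ (√d + 1) * L * ε := by
    intro x hx t ht
    have e : T x t - x = ε • (x - m) - s • t := by simp only [T, hs]; module
    have h1 : ‖x - m‖ ≤ √d * L := norm_le_of_forall_abs_le hL.le fun j => by
      rw [PiLp.sub_apply, hm, abs_le]
      exact ⟨by linarith [(hx j).1], by linarith [(hx j).2]⟩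
    calc ‖T x t - x‖ ≤ ‖ε • (x - m)‖ + ‖s • t‖ := by rw [e]; exact norm_sub_le _ _
      _ = ε * ‖x - m‖ + s * ‖t‖ := by
          rw [norm_smul, norm_smul, Real.norm_of_nonneg hε.le,
            Real.norm_of_nonneg (by linarith : (0 : ℝ) ≤ s)]
      _ ≤ ε * (√d * L) + 2 * r := by
          gcongr
          linarith
      _ ≤ (√d + 1) * L * ε := by
          rw [hr]; nlinarith [mul_pos hL hε]
  let φ : Eu d → ℝ := fun x => ∫ t, w t * g (T x t)
  have hφ : φ = convolution w (fun z => g (m + s • (z - m))) (ContinuousLinearMap.lsmul ℝ ℝ)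
      volume := rfl
  have hsupp : Function.support φ ⊆ {x | ∀ i, |x i - L / 2| ≤ L / 2 * (1 - ε / 4)} := by
    intro x hx
    by_contra hc
    refine hx ?_
    simp only [Set.mem_ofPred_eq, not_forall, not_le] at hc
    obtain ⟨i, hi⟩ := hc
    refine integral_eq_zero_of_ae (Filter.Eventually.of_forall fun t => ?_)
    change w t * g (T x t) = 0
    rcases lt_or_ge ‖t‖ r with h | h
    · rw [hg0, mul_zero]
      intro hD
      have h1 := hD i
      have h2 : T x t i = L / 2 + s * (x i - t i - L / 2) := by simp [T, hm]
      have h3 : |t i| ≤ ‖t‖ := PiLp.norm_apply_le t i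
      have h4 : |T x t i - L / 2| < L / 2 := by
        rw [abs_lt]; exact ⟨by linarith [h1.1], by linarith [h1.2]⟩
      have h5 : |x i - L / 2| - |t i| ≤ |x i - t i - L / 2| := by
        have := abs_sub_abs_le_abs_sub (x i - L / 2) (t i)
        rwa [show x i - L / 2 - t i = x i - t i - L / 2 by ring] at this
      rw [h2, add_sub_cancel_left, abs_mul, abs_of_nonneg (by linarith : (0 : ℝ) ≤ s)] at h4
      have h6 : L / 2 * (1 - ε / 4) - r < |x i - t i - L / 2| := by linarith
      have h7 : s * (L / 2 * (1 - ε / 4) - r) < L / 2 := by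
        refine lt_trans ?_ h4
        exact mul_lt_mul_of_pos_left h6 (by linarith)
      rw [hs, hr] at h7
      nlinarith [mul_pos hL hε, mul_nonneg (mul_pos hL hε).le (sub_nonneg.2 hε1)]
    · rw [hwr t h, zero_mul]
  have hts : tsupport φ ⊆ {x | ∀ i, |x i - L / 2| ≤ L / 2 * (1 - ε / 4)} := by
    refine closure_minimal hsupp ?_
    have : {x : Eu d | ∀ i, |x i - L / 2| ≤ L / 2 * (1 - ε / 4)} =
        ⋂ i, {x | |x i - L / 2| ≤ L / 2 * (1 - ε / 4)} := by ext; simp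
    rw [this]
    exact isClosed_iInter fun i => isClosed_le (by fun_prop) continuous_const
  have htc : tsupport φ ⊆ cube d L := hts.trans fun x hx i => by
    have h1 := abs_le.1 (hx i)
    exact ⟨by nlinarith [mul_pos hL hε, h1.1], by nlinarith [mul_pos hL hε, h1.2]⟩
  refine ⟨φ, ?_, ?_, htc, fun x y => ?_, fun x hx => ?_, fun x hx A hA => ?_⟩
  · rw [hφ]
    exact hws.contDiff_convolution_left _ ρ.contDiff_normed
      (Continuous.locallyIntegrable (by fun_prop))
  · exact (isCompact_closure_cube hL).of_isClosed_subset (isClosed_tsupport φ)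
      (htc.trans subset_closure)
  · refine havg (fun t => g (T y t)) (fun t => g (T x t)) (by fun_prop) (by fun_prop) _
      fun t _ => ?_
    have e : T y t - T x t = s • (y - x) := by simp only [T]; module
    refine (hg _ _).trans ?_
    rw [e, norm_smul, Real.norm_of_nonneg (by linarith : (0 : ℝ) ≤ s)]
    have : s ≤ 2 := by linarith
    nlinarith [mul_nonneg hM (norm_nonneg (y - x))]
  · rw [← hconst (g x)]
    refine havg (fun t => g (T x t)) (fun _ => g x) (by fun_prop) (by fun_prop) _
      fun t ht => (hg _ _).trans ?_
    exact mul_le_mul_of_nonneg_left (hTx x hx t ht) hM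
  · refine gradient_eq_of_eventually ?_
    filter_upwards [Metric.ball_mem_nhds x (half_pos hε)] with y hy
    rw [mem_ball_iff_norm] at hy
    rw [← hconst (⟪s • gradOf A, y - x⟫_ℝ), ← integral_add (hint _ (by fun_prop))
      (hint _ (by fun_prop)), ← sub_eq_zero, ← abs_nonpos_iff]
    have e0 : (fun t => w t * g (T x t) + w t * ⟪s • gradOf A, y - x⟫_ℝ) =
        fun t => w t * (g (T x t) + ⟪s • gradOf A, y - x⟫_ℝ) := by ext; ring
    rw [e0]
    refine havg (fun t => g (T y t)) (fun t => g (T x t) + ⟪s • gradOf A, y - x⟫_ℝ)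
      (by fun_prop) (by fun_prop) _ fun t ht => ?_
    have e : T y t - T x t = s • (y - x) := by simp only [T]; module
    have h1 := hTx x hx t ht
    have h2 : ‖s • (y - x)‖ < ε := by
      rw [norm_smul, Real.norm_of_nonneg (by linarith : (0 : ℝ) ≤ s)]
      nlinarith [norm_nonneg (y - x)]
    rw [hA (T y t), hA (T x t), add_comm, ← sub_sub, sub_right_comm, affine_sub_eq_inner, e,
      real_inner_smul_left, real_inner_smul_right, sub_self, abs_zero]
    · rw [mem_ball_iff_norm]; linarith
    · rw [mem_ball_iff_norm]
      calc ‖T y t - x‖ ≤ ‖T y t - T x t‖ + ‖T x t - x‖ := norm_sub_le_norm_sub_add_norm_sub _ _ _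
        _ < ((√d + 1) * L + 1) * ε := by rw [e]; linarith

end

/-! ### Lipschitz functions in `H¹₀(D)` and finite element functions -/

section

variable {d : ℕ} {L : ℝ}

open Filter Topology in
/-- Dominated convergence in `L²` on a finite measure space. -/
theorem tendsto_toLp_of_bounded {α F : Type*} {m : MeasurableSpace α} {μ : Measure α}
    [IsFiniteMeasure μ] [NormedAddCommGroup F] {f : ℕ → α → F} {g : α → F}
    (hf : ∀ n, MemLp (f n) 2 μ) (hg : MemLp g 2 μ) {B : ℝ}
    (hB : ∀ n, ∀ᵐ x ∂μ, ‖f n x - g x‖ ≤ B)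
    (hlim : ∀ᵐ x ∂μ, Tendsto (fun n => f n x) atTop (𝓝 (g x))) :
    Tendsto (fun n => (hf n).toLp (f n)) atTop (𝓝 (hg.toLp g)) := by
  rw [tendsto_iff_edist_tendsto_0]
  have h1 : Tendsto (fun n => ∫⁻ x, ‖f n x - g x‖ₑ ^ 2 ∂μ) atTop (𝓝 (∫⁻ _, 0 ∂μ)) := by
    refine tendsto_lintegral_of_dominated_convergence' (fun _ => ENNReal.ofReal B ^ 2)
      (fun n => ?_) (fun n => ?_) ?_ ?_
    · exact ((hf n).1.sub hg.1).enorm.pow_const 2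
    · filter_upwards [hB n] with x hx
      rw [← ofReal_norm]
      gcongr
    · simp [lintegral_const, ENNReal.mul_eq_top, measure_ne_top]
    · filter_upwards [hlim] with x hx
      have h2 : Tendsto (fun n => ‖f n x - g x‖ₑ) atTop (𝓝 0) := by
        have := (hx.sub_const (g x)).enorm
        simpa using this
      have h3 := ((ENNReal.continuous_pow 2).tendsto 0).comp h2
      rw [zero_pow two_ne_zero] at h3
      exact h3
  have h2 : ∀ n, edist ((hf n).toLp (f n)) (hg.toLp g) ^ 2 = ∫⁻ x, ‖f n x - g x‖ₑ ^ 2 ∂μ := by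
    intro n
    rw [edist_eq_enorm_sub, ← MemLp.toLp_sub, enorm_sq_eq_lintegral]
    refine lintegral_congr_ae ?_
    filter_upwards [((hf n).sub hg).coeFn_toLp] with x hx
    rw [hx, Pi.sub_apply]
  have h3 : Tendsto (fun n => (edist ((hf n).toLp (f n)) (hg.toLp g) ^ 2) ^ (1 / 2 : ℝ)) atTop
      (𝓝 (0 ^ (1 / 2 : ℝ))) := by
    refine (ENNReal.continuous_rpow_const.tendsto 0).comp ?_
    simpa only [h2, lintegral_zero] using h1
  have h4 : ∀ a : ℝ≥0∞, (a ^ 2) ^ (1 / 2 : ℝ) = a := fun a => by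
    rw [← ENNReal.rpow_natCast, ← ENNReal.rpow_mul]; norm_num
  simp only [h4] at h3
  rwa [ENNReal.zero_rpow_of_pos (by norm_num)] at h3

open Filter Topology in
/-- A Lipschitz function that vanishes off `D` and is affine near almost every point of `D` is in
`H¹₀(D)`: it is the limit of mollifications of its contractions towards the centre of `D`. -/
theorem exists_H10_of_lipschitz (hL : 0 < L) {g : Eu d → ℝ} {M : ℝ≥0} (hg : LipschitzWith M g)
    (hg0 : ∀ x ∉ cube d L, g x = 0)
    (haff : ∀ᵐ x ∂(volume.restrict (cube d L)), ∃ A : Eu d →ᵃ[ℝ] ℝ, ∀ᶠ y in 𝓝 x, g y = A y) :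
    ∃ v : H10 d L, val v =ᵐ[volume.restrict (cube d L)] g ∧
      grad v =ᵐ[volume.restrict (cube d L)] gradient g := by
  have := isFiniteMeasure_cube (d := d) hL
  have hD := (isOpen_cube d L).measurableSet
  have hgl : ∀ x y, |g y - g x| ≤ M * ‖y - x‖ := fun x y => by
    simpa [Real.dist_eq, dist_eq_norm] using hg.dist_le_mul y x
  let ε : ℕ → ℝ := fun n => 1 / ((n : ℝ) + 1)
  have hε : ∀ n, 0 < ε n := fun n => Nat.one_div_pos_of_nat
  have hε1 : ∀ n, ε n ≤ 1 := fun n => by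
    simp only [ε]
    rw [div_le_one (by positivity)]
    linarith [(Nat.cast_nonneg n : (0 : ℝ) ≤ n)]
  have hεlim : Tendsto ε atTop (𝓝 0) := tendsto_one_div_add_atTop_nhds_zero_nat
  choose φ h1 h2 h3 h4 h5 h6 using fun n => exists_smooth_approx hL M.2 hgl hg.continuous hg0
    (hε n) (hε1 n)
  have hnorm : ∀ (f : Eu d → ℝ) (x : Eu d), ‖gradient f x‖ = ‖fderiv ℝ f x‖ := fun f x =>
    (InnerProductSpace.toDual ℝ (Eu d)).symm.norm_map _
  have hgm : Measurable (gradient g) :=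
    (InnerProductSpace.toDual ℝ (Eu d)).symm.continuous.measurable.comp (measurable_fderiv ℝ g)
  have hgb : ∀ x, ‖gradient g x‖ ≤ M := fun x => by
    rw [hnorm]; exact norm_fderiv_le_of_lipschitz ℝ hg
  have hφb : ∀ n x, ‖gradient (φ n) x‖ ≤ 2 * M := fun n x => by
    rw [hnorm]
    refine norm_fderiv_le_of_lipschitz ℝ (C := 2 * M) (LipschitzWith.of_dist_le_mul fun x y => ?_)
    simpa [Real.dist_eq, dist_eq_norm] using h4 n y x
  have mg : MemLp g 2 (volume.restrict (cube d L)) := by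
    refine memLp_test g hg.continuous ((isCompact_closure_cube hL).of_isClosed_subset
      (isClosed_tsupport g) (closure_mono fun x hx => ?_))
    by_contra hc
    exact hx (hg0 x hc)
  have mgg : MemLp (gradient g) 2 (volume.restrict (cube d L)) :=
    MemLp.of_bound hgm.aestronglyMeasurable M (Eventually.of_forall hgb)
  have mφ : ∀ n, MemLp (φ n) 2 (volume.restrict (cube d L)) := fun n =>
    memLp_test _ (h1 n).continuous (h2 n)
  have mφg : ∀ n, MemLp (gradient (φ n)) 2 (volume.restrict (cube d L)) := fun n =>
    MemLp.of_bound (continuous_gradient ((h1 n).of_le (by simp))).aestronglyMeasurable (2 * M)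
      (Eventually.of_forall (hφb n))
  set C := (√d + 1) * L with hC
  have hC0 : 0 < C := by positivity
  have lim1 : Tendsto (fun n => (mφ n).toLp (φ n)) atTop (𝓝 (mg.toLp g)) := by
    refine tendsto_toLp_of_bounded mφ mg (B := M * C) (fun n => ?_) ?_
    · filter_upwards [ae_restrict_mem hD] with x hx
      refine (h5 n x hx).trans (mul_le_mul_of_nonneg_left ?_ M.2)
      nlinarith [hε1 n]
    · filter_upwards [ae_restrict_mem hD] with x hx
      rw [tendsto_iff_norm_sub_tendsto_zero]
      refine squeeze_zero (fun _ => norm_nonneg _) (fun n => h5 n x hx) ?_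
      simpa using (hεlim.const_mul C).const_mul (M : ℝ)
  have lim2 : Tendsto (fun n => (mφg n).toLp (gradient (φ n))) atTop
      (𝓝 (mgg.toLp (gradient g))) := by
    refine tendsto_toLp_of_bounded mφg mgg (B := 2 * M + M) (fun n => ?_) ?_
    · exact Eventually.of_forall fun x => (norm_sub_le _ _).trans (add_le_add (hφb n x) (hgb x))
    · filter_upwards [ae_restrict_mem hD, haff] with x hx ⟨A, hA⟩
      have e1 : gradient g x = gradOf A := by
        refine gradient_eq_of_eventually (hA.mono fun y hy => ?_)
        rw [← affine_sub_eq_inner, hy, hA.self_of_nhds]; ring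
      obtain ⟨η, hη, hball⟩ := Metric.eventually_nhds_iff_ball.1 hA
      have e2 : ∀ᶠ n in atTop, (1 + ε n) • gradOf A = gradient (φ n) x := by
        have : Tendsto (fun n => (C + 1) * ε n) atTop (𝓝 0) := by
          simpa using hεlim.const_mul (C + 1)
        filter_upwards [this.eventually_lt_const hη] with n hn
        exact (h6 n x hx A fun y hy => hball y (Metric.ball_subset_ball hn.le hy)).symm
      rw [e1]
      refine Tendsto.congr' e2 ?_
      have := (hεlim.const_add 1).smul_const (gradOf A)
      simpa using this
  let p : ℕ → PairSpace d L := fun n =>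
    WithLp.toLp 2 ((mφ n).toLp (φ n), (mφg n).toLp (gradient (φ n)))
  have lim : Tendsto p atTop (𝓝 (WithLp.toLp 2 (mg.toLp g, mgg.toLp (gradient g)))) :=
    ((WithLp.prod_continuous_toLp 2 _ _).tendsto _).comp (lim1.prodMk_nhds lim2)
  have hmem : WithLp.toLp 2 (mg.toLp g, mgg.toLp (gradient g)) ∈
      (testPairs d L).topologicalClosure :=
    mem_closure_of_tendsto lim (Eventually.of_forall fun n =>
      ⟨φ n, h1 n, h2 n, h3 n, (mφ n).coeFn_toLp, (mφg n).coeFn_toLp⟩)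
  exact ⟨⟨_, hmem⟩, mg.coeFn_toLp, mgg.coeFn_toLp⟩

namespace Triangulation
variable (𝒯 : Triangulation d L)

open Filter Topology in
/-- Points near `x` lie in elements that contain `x`, or outside of `D̄`, so that the interpolant
is Lipschitz near `x` with the largest gradient as constant. -/
theorem exists_lipschitz_interp (hL : 0 < L) {c : Eu d → ℝ}
    (hc : ∀ a ∈ 𝒯.nodes, a ∈ frontier (cube d L) → c a = 0) :
    ∃ M : ℝ≥0, LipschitzWith M (𝒯.interp c) := by
  let M : ℝ≥0 := ∑ K : 𝒯.elements, ‖gradOf (𝒯.interpAffine K c)‖₊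
  have hM : ∀ K, ‖gradOf (𝒯.interpAffine K c)‖ ≤ M := fun K => by
    have := Finset.single_le_sum (f := fun K => ‖gradOf (𝒯.interpAffine K c)‖₊)
      (fun _ _ => zero_le) (Finset.mem_univ K)
    exact_mod_cast this
  refine ⟨M, LipschitzWith.of_dist_le_mul fun x y => ?_⟩
  rw [Real.dist_eq, dist_eq_norm]
  refine lipschitz_of_forall_eventually (fun x => ?_) y x
  have h1 : ∀ᶠ y in 𝓝 x, ∀ K : 𝒯.elements, y ∈ convexHull ℝ (K.1 : Set (Eu d)) →
      x ∈ convexHull ℝ (K.1 : Set (Eu d)) := by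
    refine eventually_all.2 fun K => ?_
    by_cases hx : x ∈ convexHull ℝ (K.1 : Set (Eu d))
    · exact Eventually.of_forall fun _ _ => hx
    · exact ((𝒯.isClosed_element K).isOpen_compl.eventually_mem hx).mono fun y hy h => absurd h hy
  have h2 : ∀ᶠ y in 𝓝 x, y ∉ closure (cube d L) → 𝒯.interp c x = 0 := by
    by_cases hx : x ∈ cube d L
    · exact ((isOpen_cube d L).eventually_mem hx).mono fun y hy h => absurd (subset_closure hy) h
    · refine Eventually.of_forall fun y _ => ?_
      by_cases hx' : x ∈ closure (cube d L)
      · exact 𝒯.interp_eq_zero_of_mem_frontier hL hc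
          (by rw [(isOpen_cube d L).frontier_eq]; exact ⟨hx', hx⟩)
      · exact 𝒯.interp_eq_zero_of_notMem hx' c
  filter_upwards [h1, h2] with y hy1 hy2
  by_cases hy : y ∈ closure (cube d L)
  · obtain ⟨K, hK⟩ := 𝒯.exists_mem_element hy
    rw [𝒯.interp_eq K hK, 𝒯.interp_eq K (hy1 K hK), affine_sub_eq_inner]
    exact (abs_real_inner_le_norm _ _).trans (by gcongr; exact hM K)
  · rw [𝒯.interp_eq_zero_of_notMem hy, hy2 hy, sub_zero, abs_zero]
    positivity

open Filter Topology in
theorem eventually_interp_eq (K : 𝒯.elements) {x : Eu d}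
    (hx : x ∈ interior (convexHull ℝ (K.1 : Set (Eu d)))) (c : Eu d → ℝ) :
    ∀ᶠ y in 𝓝 x, 𝒯.interp c y = 𝒯.interpAffine K c y :=
  (isOpen_interior.eventually_mem hx).mono fun _ hy => 𝒯.interp_eq K (interior_subset hy) c

theorem gradient_interp (K : 𝒯.elements) {x : Eu d}
    (hx : x ∈ interior (convexHull ℝ (K.1 : Set (Eu d)))) (c : Eu d → ℝ) :
    gradient (𝒯.interp c) x = gradOf (𝒯.interpAffine K c) := by
  have h := 𝒯.eventually_interp_eq K hx c
  refine gradient_eq_of_eventually (h.mono fun y hy => ?_)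
  rw [← affine_sub_eq_inner, hy, h.self_of_nhds]; ring

/-- Nodal interpolants of data that vanish at the boundary nodes belong to `V_h`, with the
elementwise gradient. -/
theorem exists_isRep_interp (hL : 0 < L) {c : Eu d → ℝ}
    (hc : ∀ a ∈ 𝒯.nodes, a ∈ frontier (cube d L) → c a = 0) :
    ∃ v : 𝒯.Vh, 𝒯.IsRep v (𝒯.interp c) ∧
      grad (v : H10 d L) =ᵐ[volume.restrict (cube d L)] gradient (𝒯.interp c) := by
  obtain ⟨M, hM⟩ := 𝒯.exists_lipschitz_interp hL hc
  have h0 : ∀ x ∉ cube d L, 𝒯.interp c x = 0 := fun x hx => by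
    by_cases hx' : x ∈ closure (cube d L)
    · exact 𝒯.interp_eq_zero_of_mem_frontier hL hc
        (by rw [(isOpen_cube d L).frontier_eq]; exact ⟨hx', hx⟩)
    · exact 𝒯.interp_eq_zero_of_notMem hx' c
  obtain ⟨v, hv, hgv⟩ := exists_H10_of_lipschitz hL hM h0
    (𝒯.ae_mem_interior.mono fun x ⟨K, hK⟩ => ⟨_, 𝒯.eventually_interp_eq K hK c⟩)
  have : 𝒯.IsRep v (𝒯.interp c) := ⟨hM.continuous.continuousOn, hv, fun K hK =>
    ⟨𝒯.interpAffine ⟨K, hK⟩ c, fun x hx => 𝒯.interp_eq ⟨K, hK⟩ hx c⟩⟩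
  exact ⟨⟨v, _, this⟩, this, hgv⟩

theorem rep_eq_zero_of_mem_frontier (hL : 0 < L) (v : 𝒯.Vh) {a : Eu d}
    (ha : a ∈ frontier (cube d L)) : 𝒯.rep v a = 0 :=
  eq_zero_of_mem_frontier hL (𝒯.rep_spec v).1 (𝒯.rep_spec v).2.1 ha

theorem exists_rep_eq (hL : 0 < L) {c : Eu d → ℝ}
    (hc : ∀ a ∈ 𝒯.nodes, a ∈ frontier (cube d L) → c a = 0) :
    ∃ v : 𝒯.Vh, (∀ a ∈ 𝒯.nodes, 𝒯.rep v a = c a) ∧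
      val (v : H10 d L) =ᵐ[volume.restrict (cube d L)] 𝒯.interp c := by
  obtain ⟨v, hv, -⟩ := 𝒯.exists_isRep_interp hL hc
  refine ⟨v, fun a ha => ?_, hv.2.1⟩
  rw [𝒯.rep_unique (𝒯.rep_spec v) hv (𝒯.nodes_subset ha), 𝒯.interp_apply_node c ha]

/-- The values and the gradient of a finite element function, in terms of its nodal values. -/
theorem val_grad_eq (hL : 0 < L) (v : 𝒯.Vh) :
    val (v : H10 d L) =ᵐ[volume.restrict (cube d L)] 𝒯.interp (𝒯.rep v) ∧
      grad (v : H10 d L) =ᵐ[volume.restrict (cube d L)] gradient (𝒯.interp (𝒯.rep v)) := by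
  obtain ⟨w, hw, hgw⟩ := 𝒯.exists_isRep_interp hL (c := 𝒯.rep v)
    fun a _ ha => 𝒯.rep_eq_zero_of_mem_frontier hL v ha
  have : w = v := by
    refine 𝒯.nodalValues_injective (funext fun a => ?_)
    change 𝒯.rep w a = 𝒯.rep v a
    rw [𝒯.rep_unique (𝒯.rep_spec w) hw (𝒯.nodes_subset a.2), 𝒯.interp_apply_node _ a.2]
  subst this
  exact ⟨hw.2.1, hgw⟩

theorem ae_element_val_eq (hL : 0 < L) (v : 𝒯.Vh) (K : 𝒯.elements) :
    ∀ᵐ x ∂(volume.restrict (convexHull ℝ (K.1 : Set (Eu d)))),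
      val (v : H10 d L) x = 𝒯.interpAffine K (𝒯.rep v) x := by
  filter_upwards [𝒯.ae_element_of_ae K (𝒯.val_grad_eq hL v).1,
    ae_restrict_mem (𝒯.measurableSet_element K)] with x hx hxK
  rw [hx, 𝒯.interp_eq K hxK]

theorem ae_element_grad_eq (hL : 0 < L) (v : 𝒯.Vh) (K : 𝒯.elements) :
    ∀ᵐ x ∂(volume.restrict (convexHull ℝ (K.1 : Set (Eu d)))),
      grad (v : H10 d L) x = gradOf (𝒯.interpAffine K (𝒯.rep v)) := by
  filter_upwards [𝒯.ae_element_of_ae K (𝒯.val_grad_eq hL v).2,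
    𝒯.ae_element_mem_interior K] with x hx hxK
  rw [hx, 𝒯.gradient_interp K hxK]

end Triangulation

end

/-! ### The stiffness matrix of a Delaunay triangulation -/

section

/-- The determinant of two vectors in the plane. -/
def cross (x y : Eu 2) : ℝ := x 0 * y 1 - x 1 * y 0

theorem inner_eq_two (x y : Eu 2) : ⟪x, y⟫_ℝ = x 0 * y 0 + x 1 * y 1 := by
  rw [PiLp.inner_apply, Fin.sum_univ_two]
  simp [mul_comm]

theorem cot_angle_eq {a b c : Eu 2} (hac : a ≠ c) (hbc : b ≠ c) :
    Real.cot (EuclideanGeometry.angle a c b) = ⟪a - c, b - c⟫_ℝ / |cross (a - c) (b - c)| := by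
  -- For collinear points both sides are `0`, by division by zero.
  have h1 : ‖a - c‖ * ‖b - c‖ ≠ 0 :=
    mul_ne_zero (norm_ne_zero_iff.2 (sub_ne_zero.2 hac)) (norm_ne_zero_iff.2 (sub_ne_zero.2 hbc))
  have h2 := InnerProductGeometry.sin_angle_mul_norm_mul_norm (a - c) (b - c)
  have h3 : ⟪a - c, a - c⟫_ℝ * ⟪b - c, b - c⟫_ℝ - ⟪a - c, b - c⟫_ℝ * ⟪a - c, b - c⟫_ℝ =
      cross (a - c) (b - c) ^ 2 := by
    simp only [inner_eq_two, cross]; ring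
  rw [h3, Real.sqrt_sq_eq_abs] at h2
  rw [Real.cot_eq_cos_div_sin, EuclideanGeometry.angle, vsub_eq_sub, vsub_eq_sub,
    InnerProductGeometry.cos_angle, ← h2, div_div, mul_comm (Real.sin _)]

/-- The area of a triangle is proportional to the determinant of two of its edges. -/
theorem exists_volume_triangle : ∃ κ : ℝ, 0 ≤ κ ∧ ∀ a b c : Eu 2,
    (volume (convexHull ℝ ({a, b, c} : Set (Eu 2)))).toReal = κ * |cross (a - c) (b - c)| := by
  let B := (EuclideanSpace.basisFun (Fin 2) ℝ).toBasis
  refine ⟨(volume (convexHull ℝ ({B 0, B 1, 0} : Set (Eu 2)))).toReal, ENNReal.toReal_nonneg,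
    fun a b c => ?_⟩
  let A : Matrix (Fin 2) (Fin 2) ℝ := !![(a - c) 0, (b - c) 0; (a - c) 1, (b - c) 1]
  let M : Eu 2 →ₗ[ℝ] Eu 2 := Matrix.toLin B B A
  have hdet : LinearMap.det M = cross (a - c) (b - c) := by
    simp only [M, LinearMap.det_toLin, A, Matrix.det_fin_two_of, cross]; ring
  have hM0 : M (B 0) = a - c := by
    simp only [M, Matrix.toLin_self, Fin.sum_univ_two]
    ext i; fin_cases i <;> simp [A, B]
  have hM1 : M (B 1) = b - c := by
    simp only [M, Matrix.toLin_self, Fin.sum_univ_two]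
    ext i; fin_cases i <;> simp [A, B]
  have himg : convexHull ℝ ({a, b, c} : Set (Eu 2)) =
      (fun x => c + x) '' (M '' convexHull ℝ ({B 0, B 1, 0} : Set (Eu 2))) := by
    rw [LinearMap.image_convexHull, Set.image_insert_eq, Set.image_insert_eq, Set.image_singleton,
      hM0, hM1, map_zero]
    have h2 := ((AffineEquiv.constVAdd ℝ (Eu 2) c).toAffineMap).image_convexHull {a - c, b - c, 0}
    change (fun x => c + x) '' _ = convexHull ℝ ((fun x => c + x) '' _) at h2
    rw [h2, Set.image_insert_eq, Set.image_insert_eq, Set.image_singleton]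
    simp
  rw [himg, Set.image_add_left, measure_preimage_add, Measure.addHaar_image_linearMap, hdet,
    ENNReal.toReal_mul, ENNReal.toReal_ofReal (abs_nonneg _), mul_comm]

/-- The cotangent formula: on a triangle, twice the area times `∇f · ∇g` is the sum over the edges
of the cotangent of the opposite angle times the differences of `f` and of `g`. -/
theorem cross_mul_inner_eq {a b c : Eu 2} (hab : a ≠ b) (hac : a ≠ c) (hbc : b ≠ c)
    (h : cross (a - c) (b - c) ≠ 0) (p r : Eu 2) :
    |cross (a - c) (b - c)| * ⟪p, r⟫_ℝ =
      Real.cot (EuclideanGeometry.angle a c b) * (⟪p, a - b⟫_ℝ * ⟪r, a - b⟫_ℝ)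
      + Real.cot (EuclideanGeometry.angle b a c) * (⟪p, b - c⟫_ℝ * ⟪r, b - c⟫_ℝ)
      + Real.cot (EuclideanGeometry.angle c b a) * (⟪p, c - a⟫_ℝ * ⟪r, c - a⟫_ℝ) := by
  rw [cot_angle_eq hac hbc, cot_angle_eq hab.symm hac.symm, cot_angle_eq hbc.symm hab]
  have e1 : cross (b - a) (c - a) = cross (a - c) (b - c) := by
    simp only [cross, PiLp.sub_apply]; ring
  have e2 : cross (c - b) (a - b) = cross (a - c) (b - c) := by
    simp only [cross, PiLp.sub_apply]; ring
  rw [e1, e2]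
  have h0 : |cross (a - c) (b - c)| ≠ 0 := abs_ne_zero.2 h
  rw [div_mul_eq_mul_div, div_mul_eq_mul_div, div_mul_eq_mul_div, ← add_div, ← add_div,
    eq_div_iff h0, mul_assoc, mul_comm ⟪p, r⟫_ℝ, ← mul_assoc, abs_mul_abs_self]
  simp only [cross, inner_eq_two, PiLp.sub_apply]
  ring

variable {d : ℕ} {L : ℝ}
namespace Triangulation
variable (𝒯 : Triangulation d L)

theorem integral_cube_eq_sum {f : Eu d → ℝ} (hf : Integrable f (volume.restrict (cube d L))) :
    ∫ x in cube d L, f x =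
      ∑ K : 𝒯.elements, ∫ x in convexHull ℝ (K.1 : Set (Eu d)), f x := by
  rw [𝒯.restrict_cube_eq_sum] at hf ⊢
  rw [Measure.sum_fintype, integral_finsetSum_measure fun K _ =>
    hf.mono_measure (Measure.le_sum _ K)]

theorem lintegral_cube_eq_sum (f : Eu d → ℝ≥0∞) : ∫⁻ x in cube d L, f x =
    ∑ K : 𝒯.elements, ∫⁻ x in convexHull ℝ (K.1 : Set (Eu d)), f x := by
  rw [𝒯.restrict_cube_eq_sum, lintegral_sum_measure, tsum_fintype]

theorem inner_grad_eq_sum (hL : 0 < L) (v w : 𝒯.Vh) :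
    ⟪grad (v : H10 d L), grad (w : H10 d L)⟫_ℝ =
      ∑ K : 𝒯.elements, (volume (convexHull ℝ (K.1 : Set (Eu d)))).toReal *
        ⟪gradOf (𝒯.interpAffine K (𝒯.rep v)), gradOf (𝒯.interpAffine K (𝒯.rep w))⟫_ℝ := by
  rw [L2.inner_def, 𝒯.integral_cube_eq_sum (L2.integrable_inner (𝕜 := ℝ) _ _)]
  refine Finset.sum_congr rfl fun K _ => ?_
  have h : ∀ᵐ x ∂(volume.restrict (convexHull ℝ (K.1 : Set (Eu d)))),
      ⟪(grad (v : H10 d L)) x, (grad (w : H10 d L)) x⟫_ℝ =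
        ⟪gradOf (𝒯.interpAffine K (𝒯.rep v)), gradOf (𝒯.interpAffine K (𝒯.rep w))⟫_ℝ := by
    filter_upwards [𝒯.ae_element_grad_eq hL v K, 𝒯.ae_element_grad_eq hL w K] with x h1 h2
    rw [h1, h2]
  rw [integral_congr_ae h, integral_const, smul_eq_mul]
  simp [Measure.real]

/-- The gradient of the affine interpolant in the direction of an edge. -/
theorem inner_gradOf_sub (K : 𝒯.elements) (c : Eu d → ℝ) {a b : Eu d} (ha : a ∈ K.1)
    (hb : b ∈ K.1) : ⟪gradOf (𝒯.interpAffine K c), a - b⟫_ℝ = c a - c b := by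
  rw [← affine_sub_eq_inner, 𝒯.interpAffine_apply_vertex K c ha,
    𝒯.interpAffine_apply_vertex K c hb]

/-- In one dimension no mesh condition is needed: both gradients are parallel to the edge. -/
theorem inner_grad_nonneg_one {𝒯 : Triangulation 1 L} (hL : 0 < L) {v w : 𝒯.Vh}
    (h : ∀ a ∈ 𝒯.nodes, ∀ b ∈ 𝒯.nodes,
      0 ≤ (𝒯.rep v a - 𝒯.rep v b) * (𝒯.rep w a - 𝒯.rep w b)) :
    0 ≤ ⟪grad (v : H10 1 L), grad (w : H10 1 L)⟫_ℝ := by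
  rw [𝒯.inner_grad_eq_sum hL]
  refine Finset.sum_nonneg fun K _ => mul_nonneg ENNReal.toReal_nonneg ?_
  obtain ⟨a, ha, b, hb, hab⟩ := Finset.one_lt_card.1 (by rw [K.2.2]; norm_num : 1 < K.1.card)
  have h1 := h a (mem_nodes K.2.1 ha) b (mem_nodes K.2.1 hb)
  rw [← 𝒯.inner_gradOf_sub K _ ha hb, ← 𝒯.inner_gradOf_sub K _ ha hb] at h1
  generalize gradOf (𝒯.interpAffine K (𝒯.rep v)) = p at *
  generalize gradOf (𝒯.interpAffine K (𝒯.rep w)) = r at *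
  simp only [PiLp.inner_apply, Finset.univ_unique, Fin.default_eq_zero, Finset.sum_singleton,
    RCLike.inner_apply, conj_trivial, PiLp.sub_apply] at h1 ⊢
  have h2 : 0 < (a 0 - b 0) ^ 2 := by
    have : a 0 ≠ b 0 := fun hc => hab (by ext i; rw [Subsingleton.elim i 0, hc])
    positivity [sub_ne_zero.2 this]
  refine nonneg_of_mul_nonneg_left (b := (a 0 - b 0) ^ 2) ?_ h2
  linarith

open Classical in
/-- Twice the sum over the edges of a triangle `K` of the cotangent of the opposite angle times
`t a b`, written as a sum over ordered triples. -/
def cotSum (K : Finset (Eu d)) (t : Eu d → Eu d → ℝ) : ℝ :=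
  ∑ a ∈ K, ∑ b ∈ K, ∑ c ∈ K, if a ≠ b ∧ c ≠ a ∧ c ≠ b then
    Real.cot (EuclideanGeometry.angle a c b) * t a b else 0

theorem cotSum_triple {a b c : Eu d} (hab : a ≠ b) (hac : a ≠ c) (hbc : b ≠ c)
    {t : Eu d → Eu d → ℝ} (ht : ∀ x y, t x y = t y x) [DecidableEq (Eu d)] :
    cotSum {a, b, c} t = 2 * (Real.cot (EuclideanGeometry.angle a c b) * t a b
      + Real.cot (EuclideanGeometry.angle b a c) * t b c
      + Real.cot (EuclideanGeometry.angle c b a) * t c a) := by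
  have hs : ∀ f : Eu d → ℝ, ∑ x ∈ ({a, b, c} : Finset (Eu d)), f x = f a + (f b + f c) := by
    intro f
    rw [Finset.sum_insert (by simp [hab, hac]), Finset.sum_insert (by simp [hbc]),
      Finset.sum_singleton]
  simp only [cotSum, hs, hab, hac, hbc, hab.symm, hac.symm, hbc.symm, ne_eq, not_true_eq_false,
    not_false_eq_true, and_true, and_false, if_true, if_false]
  rw [EuclideanGeometry.angle_comm b c a, EuclideanGeometry.angle_comm c a b,
    EuclideanGeometry.angle_comm a b c, ht b a, ht c b, ht a c]
  ring

theorem eq_of_three_mem {𝒯 : Triangulation 2 L} {K K' : 𝒯.elements} {a b c : Eu 2} (hab : a ≠ b)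
    (hac : a ≠ c) (hbc : b ≠ c) (h : a ∈ K.1 ∧ b ∈ K.1 ∧ c ∈ K.1)
    (h' : a ∈ K'.1 ∧ b ∈ K'.1 ∧ c ∈ K'.1) : K = K' := by
  classical
  have h3 : ({a, b, c} : Finset (Eu 2)).card = 3 :=
    Finset.card_eq_three.2 ⟨a, b, c, hab, hac, hbc, rfl⟩
  have e : ∀ K : 𝒯.elements, a ∈ K.1 ∧ b ∈ K.1 ∧ c ∈ K.1 → {a, b, c} = K.1 := fun K h =>
    Finset.eq_of_subset_of_card_le (by
      intro x hx
      simp only [Finset.mem_insert, Finset.mem_singleton] at hx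
      rcases hx with rfl | rfl | rfl
      exacts [h.1, h.2.1, h.2.2]) (by rw [K.2.2, h3])
  exact Subtype.ext ((e K h).symm.trans (e K' h'))

/-- The sums over the triangles of a Delaunay triangulation, regrouped by edges, are nonnegative. -/
theorem sum_cotSum_nonneg {𝒯 : Triangulation 2 L} (hDel : 𝒯.IsDelaunay) {t : Eu 2 → Eu 2 → ℝ}
    (ht : ∀ a ∈ 𝒯.nodes, ∀ b ∈ 𝒯.nodes, 0 ≤ t a b)
    (ht0 : ∀ a ∈ 𝒯.nodes, ∀ b ∈ 𝒯.nodes, a ∈ frontier (cube 2 L) → b ∈ frontier (cube 2 L) →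
      t a b = 0) : 0 ≤ ∑ K : 𝒯.elements, cotSum K.1 t := by
  classical
  let V := 𝒯.finite_nodes.toFinset
  have hV : ∀ K : 𝒯.elements, K.1 ⊆ V := fun K a ha => by
    simpa [V] using mem_nodes K.2.1 ha
  have e1 : ∀ K : 𝒯.elements, cotSum K.1 t = ∑ a ∈ V, ∑ b ∈ V, ∑ c ∈ V,
      if (a ∈ K.1 ∧ b ∈ K.1 ∧ c ∈ K.1) ∧ a ≠ b ∧ c ≠ a ∧ c ≠ b then
        Real.cot (EuclideanGeometry.angle a c b) * t a b else 0 := by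
    intro K
    rw [cotSum]
    rw [← Finset.sum_subset (hV K) (by intro a _ ha; simp [ha])]
    refine Finset.sum_congr rfl fun a ha => ?_
    rw [← Finset.sum_subset (hV K) (by intro b _ hb; simp [hb])]
    refine Finset.sum_congr rfl fun b hb => ?_
    rw [← Finset.sum_subset (hV K) (by intro c _ hc; simp [hc])]
    refine Finset.sum_congr rfl fun c hc => ?_
    simp [ha, hb, hc]
  simp only [e1]
  rw [Finset.sum_comm]
  refine Finset.sum_nonneg fun a ha => ?_
  rw [Finset.sum_comm]
  refine Finset.sum_nonneg fun b hb => ?_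
  rw [Finset.sum_comm]
  have ha' : a ∈ 𝒯.nodes := by simpa [V] using ha
  have hb' : b ∈ 𝒯.nodes := by simpa [V] using hb
  by_cases hab : a = b
  · simp [hab]
  have e2 : ∀ c ∈ V, (∑ K : 𝒯.elements,
      if (a ∈ K.1 ∧ b ∈ K.1 ∧ c ∈ K.1) ∧ a ≠ b ∧ c ≠ a ∧ c ≠ b then
        Real.cot (EuclideanGeometry.angle a c b) * t a b else 0) =
      if c ∈ 𝒯.apexes a b then Real.cot (EuclideanGeometry.angle a c b) * t a b else 0 := by
    intro c _
    split_ifs with hc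
    · obtain ⟨hca, hcb, K, hK, haK, hbK, hcK⟩ := hc
      rw [Finset.sum_eq_single ⟨K, hK⟩]
      · simp [haK, hbK, hcK, hab, hca, hcb]
      · intro K' _ hK'
        rw [if_neg]
        rintro ⟨h, -⟩
        exact hK' (eq_of_three_mem hab (Ne.symm hca) (Ne.symm hcb) h ⟨haK, hbK, hcK⟩)
      · simp
    · refine Finset.sum_eq_zero fun K _ => if_neg ?_
      rintro ⟨⟨h1, h2, h3⟩, -, h4, h5⟩
      exact hc ⟨h4, h5, K.1, K.2, h1, h2, h3⟩
  rw [Finset.sum_congr rfl e2, ← Finset.sum_filter, ← Finset.sum_mul]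
  have e3 : ∑ᶠ c ∈ 𝒯.apexes a b, Real.cot (EuclideanGeometry.angle a c b) =
      ∑ c ∈ V with c ∈ 𝒯.apexes a b, Real.cot (EuclideanGeometry.angle a c b) := by
    refine finsum_mem_eq_sum_of_inter_support_eq _ ?_
    ext c
    simp only [Set.mem_inter_iff, Finset.coe_filter, Set.mem_ofPred_eq]
    refine ⟨fun h => ⟨⟨?_, h.1⟩, h.2⟩, fun h => ⟨h.1.2, h.2⟩⟩
    obtain ⟨⟨-, -, K, hK, -, -, hcK⟩, -⟩ := h
    exact hV ⟨K, hK⟩ hcK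
  rw [← e3]
  by_cases hE : ∃ K ∈ 𝒯.elements, a ∈ K ∧ b ∈ K
  · by_cases hs : segment ℝ a b ⊆ frontier (cube 2 L)
    -- On an edge in the boundary the cotangents may have a negative sum, but `t` vanishes.
    · rw [ht0 a ha' b hb' (hs (left_mem_segment ℝ a b)) (hs (right_mem_segment ℝ a b)), mul_zero]
    · exact mul_nonneg (hDel a b hab hE hs) (ht a ha' b hb')
  · have : 𝒯.apexes a b = ∅ := by
      ext c
      simp only [Set.mem_empty_iff_false, iff_false]
      rintro ⟨-, -, K, hK, h1, h2, -⟩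
      exact hE ⟨K, hK, h1, h2⟩
    simp [this]

/-- Triangles are not degenerate: the gradients of the nodal functions of `a` and `b` are dual to
the edges `a - c` and `b - c`. -/
theorem cross_ne_zero {𝒯 : Triangulation 2 L} (K : 𝒯.elements) {a b c : Eu 2} (ha : a ∈ K.1)
    (hb : b ∈ K.1) (hc : c ∈ K.1) (hab : a ≠ b) (hac : a ≠ c) (hbc : b ≠ c) :
    cross (a - c) (b - c) ≠ 0 := by
  classical
  have h1 := 𝒯.inner_gradOf_sub K (fun x => if x = a then 1 else 0) ha hc
  have h2 := 𝒯.inner_gradOf_sub K (fun x => if x = a then 1 else 0) hb hc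
  have h3 := 𝒯.inner_gradOf_sub K (fun x => if x = b then 1 else 0) ha hc
  have h4 := 𝒯.inner_gradOf_sub K (fun x => if x = b then 1 else 0) hb hc
  simp only [if_true, hab, hab.symm, hac.symm, hbc.symm, if_false, sub_zero, inner_eq_two]
    at h1 h2 h3 h4
  generalize gradOf (𝒯.interpAffine K _) = p at h1 h2
  generalize gradOf (𝒯.interpAffine K _) = r at h3 h4
  rw [cross]
  generalize a - c = x at *
  generalize b - c = y at *
  intro h0
  have : (1 : ℝ) = 0 := by
    linear_combination (p 0 * r 1 - p 1 * r 0) * h0 - h1 * (r 0 * y 0 + r 1 * y 1) - h4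
      + h2 * (r 0 * x 0 + r 1 * x 1)
  exact one_ne_zero this

theorem inner_grad_nonneg_two {𝒯 : Triangulation 2 L} (hDel : 𝒯.IsDelaunay) (hL : 0 < L)
    {v w : 𝒯.Vh} (h : ∀ a ∈ 𝒯.nodes, ∀ b ∈ 𝒯.nodes,
      0 ≤ (𝒯.rep v a - 𝒯.rep v b) * (𝒯.rep w a - 𝒯.rep w b)) :
    0 ≤ ⟪grad (v : H10 2 L), grad (w : H10 2 L)⟫_ℝ := by
  classical
  obtain ⟨κ, hκ0, hκ⟩ := exists_volume_triangle
  -- The weights of the edges in the cotangent formula; they vanish between boundary nodes.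
  let t : Eu 2 → Eu 2 → ℝ := fun a b =>
    (𝒯.rep v a - 𝒯.rep v b) * (𝒯.rep w a - 𝒯.rep w b)
  have key : ∀ K : 𝒯.elements, (volume (convexHull ℝ (K.1 : Set (Eu 2)))).toReal *
        ⟪gradOf (𝒯.interpAffine K (𝒯.rep v)), gradOf (𝒯.interpAffine K (𝒯.rep w))⟫_ℝ =
      κ / 2 * cotSum K.1 t := by
    intro K
    obtain ⟨a, b, c, hab, hac, hbc, hK⟩ := Finset.card_eq_three.1 K.2.2
    have ha : a ∈ K.1 := by simp [hK]
    have hb : b ∈ K.1 := by simp [hK]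
    have hc : c ∈ K.1 := by simp [hK]
    have hvol := hκ a b c
    have hcoe : (K.1 : Set (Eu 2)) = {a, b, c} := by rw [hK]; simp
    rw [← hcoe] at hvol
    by_cases h0 : cross (a - c) (b - c) = 0
    · exact absurd h0 (cross_ne_zero K ha hb hc hab hac hbc)
    · rw [hvol, mul_assoc, cross_mul_inner_eq hab hac hbc h0, 𝒯.inner_gradOf_sub K _ ha hb,
        𝒯.inner_gradOf_sub K _ ha hb, 𝒯.inner_gradOf_sub K _ hb hc, 𝒯.inner_gradOf_sub K _ hb hc,
        𝒯.inner_gradOf_sub K _ hc ha, 𝒯.inner_gradOf_sub K _ hc ha, hK,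
        cotSum_triple hab hac hbc fun x y => by simp only [t]; ring]
      ring
  rw [𝒯.inner_grad_eq_sum hL, Finset.sum_congr rfl fun K _ => key K, ← Finset.mul_sum]
  refine mul_nonneg (by positivity) (sum_cotSum_nonneg hDel (fun a ha b hb => h a ha b hb) ?_)
  intro a _ b _ haf hbf
  simp only [t]
  rw [𝒯.rep_eq_zero_of_mem_frontier hL v haf, 𝒯.rep_eq_zero_of_mem_frontier hL v hbf]
  ring

/-- Nonnegativity of the Dirichlet form for finite element functions with comonotone nodal values:
the off-diagonal entries of the stiffness matrix of a Delaunay triangulation are nonpositive. -/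
theorem inner_grad_nonneg (hd : d = 1 ∨ d = 2) (hDel : 𝒯.IsDelaunay) (hL : 0 < L) {v w : 𝒯.Vh}
    (h : ∀ a ∈ 𝒯.nodes, ∀ b ∈ 𝒯.nodes,
      0 ≤ (𝒯.rep v a - 𝒯.rep v b) * (𝒯.rep w a - 𝒯.rep w b)) :
    0 ≤ ⟪grad (v : H10 d L), grad (w : H10 d L)⟫_ℝ := by
  rcases hd with rfl | rfl
  · exact inner_grad_nonneg_one hL h
  · exact inner_grad_nonneg_two hDel hL h

end Triangulation

end

/-! ### Averages over balls -/

section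

variable {d : ℕ} {L : ℝ}

/-- Jensen's inequality for the square of an average. -/
theorem enorm_setAverage_sq_le {S : Set (Eu d)} (hS0 : volume S ≠ 0) (hS : volume S ≠ ∞)
    {F : Eu d → ℝ} (hF : Continuous F) :
    ‖⨍ y in S, F y‖ₑ ^ 2 ≤ (volume S)⁻¹ * ∫⁻ y in S, ‖F y‖ₑ ^ 2 := by
  have h1 : ‖∫ y in S, F y‖ₑ ^ 2 ≤ volume S * ∫⁻ y in S, ‖F y‖ₑ ^ 2 := by
    calc ‖∫ y in S, F y‖ₑ ^ 2 ≤ (∫⁻ y in S, ‖F y‖ₑ) ^ 2 := by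
          gcongr; exact enorm_integral_le_lintegral_enorm _
      _ ≤ _ := by
          have := sq_lintegral_le (μ := volume.restrict S) (f := fun y => ‖F y‖ₑ) (by fun_prop)
          rwa [Measure.restrict_apply_univ] at this
  have h2 : ‖((volume S).toReal)⁻¹‖ₑ = (volume S)⁻¹ := by
    rw [Real.enorm_eq_ofReal (by positivity), ENNReal.ofReal_inv_of_pos
      (ENNReal.toReal_pos hS0 hS), ENNReal.ofReal_toReal hS]
  rw [setAverage_eq, smul_eq_mul, enorm_mul, Measure.real, h2, mul_pow]
  calc (volume S)⁻¹ ^ 2 * ‖∫ y in S, F y‖ₑ ^ 2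
      ≤ (volume S)⁻¹ ^ 2 * (volume S * ∫⁻ y in S, ‖F y‖ₑ ^ 2) := by gcongr
    _ = (volume S)⁻¹ * ∫⁻ y in S, ‖F y‖ₑ ^ 2 := by
        rw [sq, mul_assoc, ← mul_assoc _ (volume S), ENNReal.inv_mul_cancel hS0 hS, one_mul]

theorem setAverage_sub {S : Set (Eu d)} (hS : IsCompact S) {F H : Eu d → ℝ} (hF : Continuous F)
    (hH : Continuous H) : (⨍ y in S, F y) - ⨍ y in S, H y = ⨍ y in S, (F y - H y) := by
  rw [setAverage_eq, setAverage_eq, setAverage_eq, ← smul_sub,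
    integral_sub (hF.continuousOn.integrableOn_compact hS)
      (hH.continuousOn.integrableOn_compact hS)]

theorem norm_sub_le_of_mem_closure_cube (hL : 0 < L) {x y : Eu d} (hx : x ∈ closure (cube d L))
    (hy : y ∈ closure (cube d L)) : ‖x - y‖ ≤ √d * L := by
  rw [closure_cube hL] at hx hy
  refine norm_le_of_forall_abs_le hL.le fun j => ?_
  rw [PiLp.sub_apply, abs_le]
  exact ⟨by linarith [(hx j).1, (hy j).2], by linarith [(hx j).2, (hy j).1]⟩

/-- The dilation of `ℝᵈ` by the factor `s` about the centre of `D`. -/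
def dilate (L s : ℝ) (x : Eu d) : Eu d :=
  s • x + (1 - s) • (WithLp.toLp 2 fun _ => L / 2 : Eu d)

theorem dilate_sub (s : ℝ) (x y : Eu d) : dilate L s x - dilate L s y = s • (x - y) := by
  simp only [dilate]; module

theorem continuous_dilate (s : ℝ) : Continuous (dilate L s : Eu d → Eu d) := by
  unfold dilate; fun_prop

theorem dilate_add_notMem {h : ℝ} (hL : 0 < L) (hh : 0 < h) {x : Eu d}
    (hx : x ∈ frontier (cube d L)) {y : Eu d} (hy : ‖y‖ ≤ h) :
    dilate L (1 + 2 * h / L) x + y ∉ cube d L := by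
  intro hD
  obtain ⟨i, hi⟩ := exists_apply_eq_of_mem_frontier hL hx
  have h1 := hD i
  have h2 : (dilate L (1 + 2 * h / L) x + y) i = (1 + 2 * h / L) * x i - h + y i := by
    simp only [dilate, PiLp.add_apply, PiLp.smul_apply, smul_eq_mul]
    field_simp
    ring
  have h3 := abs_le.1 ((PiLp.norm_apply_le y i).trans hy)
  rw [h2] at h1
  rcases hi with h0 | h0
  · rw [h0] at h1
    linarith [h1.1]
  · rw [h0] at h1
    have : (1 + 2 * h / L) * L = L + 2 * h := by field_simp
    linarith [h1.2]

/-- The average of `φ` over the ball of radius `h` about the image of `x` under a dilation that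
pushes the boundary of `D` out by the distance `h`. -/
def dilatedAverage (L h : ℝ) (φ : Eu d → ℝ) (x : Eu d) : ℝ :=
  ⨍ y in Metric.closedBall (0 : Eu d) h, φ (dilate L (1 + 2 * h / L) x + y)

theorem dilatedAverage_eq_zero {h : ℝ} (hL : 0 < L) (hh : 0 < h) {φ : Eu d → ℝ}
    (hφ : tsupport φ ⊆ cube d L) {x : Eu d} (hx : x ∈ frontier (cube d L)) :
    dilatedAverage L h φ x = 0 := by
  rw [dilatedAverage, setAverage_eq, setIntegral_eq_zero_of_forall_eq_zero, smul_zero]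
  intro y hy
  exact image_eq_zero_of_notMem_tsupport fun k =>
    dilate_add_notMem hL hh hx (mem_closedBall_zero_iff.1 hy) (hφ k)

theorem volume_closedBall_ne_zero {h : ℝ} (hh : 0 < h) (x : Eu d) :
    volume (Metric.closedBall x h) ≠ 0 :=
  (Metric.measure_closedBall_pos volume x hh).ne'

theorem volume_closedBall_ne_top (h : ℝ) (x : Eu d) : volume (Metric.closedBall x h) ≠ ∞ :=
  measure_closedBall_lt_top.ne

/-- The local Dirichlet energy that controls the oscillation of the dilated averages near `x`. -/
def localEnergy (L h : ℝ) (φ : Eu d → ℝ) (x : Eu d) : ℝ≥0∞ :=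
  (volume (Metric.closedBall (0 : Eu d) h))⁻¹ * (ENNReal.ofReal ((1 + 2 * h / L) * h) ^ 2 *
    ∫⁻ y in Metric.closedBall (0 : Eu d) ((2 + 2 * h / L) * h),
      ‖gradient φ (dilate L (1 + 2 * h / L) x + y)‖ₑ ^ 2)

/-- The averages at `x₁` and `x₂` are over balls that differ by a translation by at most
`(1 + 2h/L) h`, and the segments between corresponding points stay in the ball of radius
`(2 + 2h/L) h` about the image of `x`. -/
theorem enorm_dilatedAverage_sub_sq_le {h : ℝ} (hL : 0 < L) (hh : 0 < h) {φ : Eu d → ℝ}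
    (hφ : ContDiff ℝ 1 φ) {x x₁ x₂ : Eu d} (h1 : ‖x₁ - x‖ ≤ h) (h2 : ‖x₂ - x‖ ≤ h)
    (h12 : ‖x₁ - x₂‖ ≤ h) :
    ‖dilatedAverage L h φ x₁ - dilatedAverage L h φ x₂‖ₑ ^ 2 ≤ localEnergy L h φ x := by
  set s := 1 + 2 * h / L with hs
  have hs0 : 0 ≤ s := by positivity
  have hc := hφ.continuous
  rw [dilatedAverage, dilatedAverage, setAverage_sub (isCompact_closedBall _ _) (by fun_prop)
    (by fun_prop), ← hs]
  refine (enorm_setAverage_sq_le (volume_closedBall_ne_zero hh _)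
    (volume_closedBall_ne_top h _) (by fun_prop)).trans ?_
  rw [localEnergy, ← hs]
  refine mul_le_mul' le_rfl ?_
  have key := lintegral_displacement_le hφ (S := Metric.closedBall (0 : Eu d) h)
    (S' := Metric.closedBall (dilate L s x) ((2 + 2 * h / L) * h)) measurableSet_closedBall
    measurableSet_closedBall le_rfl (dilate L s x₁) (dilate L s x₂) (fun y hy t ht => ?_)
    (δ := s * h) (fun y _ => ?_)
  · have e : ∫⁻ y in Metric.closedBall (0 : Eu d) ((2 + 2 * h / L) * h),
        ‖gradient φ (dilate L s x + y)‖ₑ ^ 2 =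
        ∫⁻ z in Metric.closedBall (dilate L s x) ((2 + 2 * h / L) * h), ‖gradient φ z‖ₑ ^ 2 := by
      rw [← lintegral_indicator measurableSet_closedBall,
        ← lintegral_indicator measurableSet_closedBall,
        ← lintegral_add_left_eq_self (μ := volume)
          ((Metric.closedBall (dilate L s x) ((2 + 2 * h / L) * h)).indicator
            fun z => ‖gradient φ z‖ₑ ^ 2) (dilate L s x)]
      refine lintegral_congr fun y => ?_
      simp only [Set.indicator, mem_closedBall_iff_norm, sub_zero, add_sub_cancel_left]
    rw [e]
    refine le_trans (le_of_eq ?_) key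
    refine lintegral_congr fun y => ?_
    rw [one_smul, add_comm y (dilate L s x₁), add_comm y (dilate L s x₂)]
  · rw [mem_closedBall_zero_iff] at hy
    rw [mem_closedBall_iff_norm]
    have e : y + dilate L s x₂ + t • ((1 : ℝ) • y + dilate L s x₁ - (y + dilate L s x₂)) -
        dilate L s x = y + (t • (s • (x₁ - x)) + (1 - t) • (s • (x₂ - x))) := by
      rw [← dilate_sub (L := L) s x₁ x, ← dilate_sub (L := L) s x₂ x]; module
    have b1 : ‖s • (x₁ - x)‖ ≤ s * h := by
      rw [norm_smul, Real.norm_of_nonneg hs0]; gcongr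
    have b2 : ‖s • (x₂ - x)‖ ≤ s * h := by
      rw [norm_smul, Real.norm_of_nonneg hs0]; gcongr
    have b3 : ‖t • (s • (x₁ - x)) + (1 - t) • (s • (x₂ - x))‖ ≤ s * h := by
      have := (convex_closedBall (0 : Eu d) (s * h)) (mem_closedBall_zero_iff.2 b1)
        (mem_closedBall_zero_iff.2 b2) ht.1 (sub_nonneg.2 ht.2) (by ring)
      exact mem_closedBall_zero_iff.1 this
    rw [e]
    calc _ ≤ ‖y‖ + ‖t • (s • (x₁ - x)) + (1 - t) • (s • (x₂ - x))‖ := norm_add_le _ _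
      _ ≤ h + s * h := add_le_add hy b3
      _ = (2 + 2 * h / L) * h := by rw [hs]; ring
  · have e : (1 : ℝ) • y + dilate L s x₁ - (y + dilate L s x₂) = s • (x₁ - x₂) := by
      rw [← dilate_sub (L := L)]; module
    rw [e, norm_smul, Real.norm_of_nonneg hs0]
    gcongr

theorem volume_closedBall_mul {h k : ℝ} (hh : 0 ≤ h) (hk : 0 ≤ k) (x y : Eu d) :
    volume (Metric.closedBall x (k * h)) =
      ENNReal.ofReal (k ^ d) * volume (Metric.closedBall y h) := by
  have := Measure.addHaar_closedBall_mul (volume : Measure (Eu d)) x hk hh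
  rw [Measure.addHaar_closedBall_center volume y]
  simpa using this

/-- By Fubini the local energies integrate to `O(h²)` times the Dirichlet energy. -/
theorem lintegral_localEnergy_le {h : ℝ} (hL : 0 < L) (hh : 0 < h) {φ : Eu d → ℝ}
    (hφ : ContDiff ℝ 1 φ) :
    ∫⁻ x in cube d L, localEnergy L h φ x ≤
      ENNReal.ofReal (((1 + 2 * h / L) * h) ^ 2 * (2 + 2 * h / L) ^ d) *
        ∫⁻ z, ‖gradient φ z‖ₑ ^ 2 := by
  have hg := continuous_gradient hφ
  have hd := continuous_dilate (d := d) (L := L) (1 + 2 * h / L)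
  set s := 1 + 2 * h / L with hs
  have hs1 : 1 ≤ s := by rw [hs]; linarith [show 0 < 2 * h / L by positivity]
  have hV0 := volume_closedBall_ne_zero hh (0 : Eu d)
  have hVt := volume_closedBall_ne_top h (0 : Eu d)
  simp only [localEnergy, ← hs]
  rw [lintegral_const_mul' _ _ (ENNReal.inv_ne_top.2 hV0), lintegral_const_mul' _ _ (by simp),
    lintegral_lintegral_swap]
  · calc _ ≤ (volume (Metric.closedBall (0 : Eu d) h))⁻¹ * (ENNReal.ofReal (s * h) ^ 2 *
          ∫⁻ y in Metric.closedBall (0 : Eu d) ((2 + 2 * h / L) * h),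
            ∫⁻ z, ‖gradient φ z‖ₑ ^ 2) := by
          refine mul_le_mul' le_rfl (mul_le_mul' le_rfl (lintegral_mono fun y => ?_))
          have := setLIntegral_dilation_le (fun z => ‖gradient φ z‖ₑ ^ 2)
            (isOpen_cube d L).measurableSet MeasurableSet.univ hs1
            ((1 - s) • (WithLp.toLp 2 fun _ => L / 2 : Eu d) + y) (fun _ _ => Set.mem_univ _)
          rw [Measure.restrict_univ] at this
          simpa only [dilate, add_assoc] using this
      _ = _ := by
          rw [setLIntegral_const, volume_closedBall_mul hh.le (by positivity) (0 : Eu d) (0 : Eu d),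
            ENNReal.ofReal_mul (p := (s * h) ^ 2) (by positivity),
            ENNReal.ofReal_pow (p := s * h) (by positivity)]
          have e : ∀ V a b G : ℝ≥0∞, V⁻¹ * (a * (G * (b * V))) = V⁻¹ * V * (a * b * G) :=
            fun V a b G => by ring
          rw [e, ENNReal.inv_mul_cancel hV0 hVt, one_mul]
  · have : Continuous fun p : Eu d × Eu d => gradient φ (dilate L s p.1 + p.2) := by fun_prop
    exact (this.measurable.enorm.pow_const 2).aemeasurable

theorem lintegral_dilatedAverage_sub_le {h : ℝ} (hL : 0 < L) (hh : 0 < h) {φ : Eu d → ℝ}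
    (hφ : ContDiff ℝ 1 φ) :
    ∫⁻ x in cube d L, ‖dilatedAverage L h φ x - φ x‖ₑ ^ 2 ≤
      ENNReal.ofReal ((2 * √d + 1) * h) ^ 2 * ∫⁻ z, ‖gradient φ z‖ₑ ^ 2 := by
  have hc := hφ.continuous
  have hd := continuous_dilate (d := d) (L := L) (1 + 2 * h / L)
  have hV0 := volume_closedBall_ne_zero hh (0 : Eu d)
  have hVt := volume_closedBall_ne_top h (0 : Eu d)
  set s := 1 + 2 * h / L with hs
  have hs1 : 1 ≤ s := by rw [hs]; linarith [show 0 < 2 * h / L by positivity]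
  have h1 : ∀ x, ‖dilatedAverage L h φ x - φ x‖ₑ ^ 2 ≤ (volume (Metric.closedBall (0 : Eu d) h))⁻¹ *
      ∫⁻ y in Metric.closedBall (0 : Eu d) h, ‖φ (dilate L s x + y) - φ x‖ₑ ^ 2 := by
    intro x
    have e : φ x = ⨍ _y in Metric.closedBall (0 : Eu d) h, φ x := by
      rw [setAverage_const hV0 hVt]
    rw [dilatedAverage, ← hs]
    conv_lhs => rw [e]
    rw [setAverage_sub (isCompact_closedBall _ _) (by fun_prop) (by fun_prop)]
    exact enorm_setAverage_sq_le hV0 hVt (by fun_prop)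
  refine (lintegral_mono h1).trans ?_
  rw [lintegral_const_mul' _ _ (ENNReal.inv_ne_top.2 hV0), lintegral_lintegral_swap]
  · calc _ ≤ (volume (Metric.closedBall (0 : Eu d) h))⁻¹ *
          ∫⁻ y in Metric.closedBall (0 : Eu d) h, ENNReal.ofReal ((2 * √d + 1) * h) ^ 2 *
            ∫⁻ z, ‖gradient φ z‖ₑ ^ 2 := by
          refine mul_le_mul' le_rfl (setLIntegral_mono' measurableSet_closedBall fun y hy => ?_)
          rw [mem_closedBall_zero_iff] at hy
          let m : Eu d := WithLp.toLp 2 fun _ => L / 2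
          have hm : m ∈ closure (cube d L) := by
            rw [closure_cube hL]
            exact fun i => ⟨by simp only [m]; linarith, by simp only [m]; linarith⟩
          have := lintegral_displacement_le hφ (isOpen_cube d L).measurableSet MeasurableSet.univ
            hs1 ((1 - s) • m + y) 0 (fun _ _ _ _ => Set.mem_univ _) (δ := (2 * √d + 1) * h)
            (fun x hx => ?_)
          · rw [Measure.restrict_univ] at this
            simpa only [dilate, add_assoc, add_zero] using this
          · have e : s • x + ((1 - s) • m + y) - (x + 0) = (2 * h / L) • (x - m) + y := by
              rw [hs]; module
            have b := norm_sub_le_of_mem_closure_cube hL (subset_closure hx) hm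
            rw [e]
            calc _ ≤ ‖(2 * h / L) • (x - m)‖ + ‖y‖ := norm_add_le _ _
              _ ≤ 2 * h / L * (√d * L) + h := by
                  rw [norm_smul, Real.norm_of_nonneg (by positivity)]
                  gcongr
              _ = (2 * √d + 1) * h := by field_simp
      _ = _ := by
          rw [setLIntegral_const, mul_comm _ (volume _), ← mul_assoc,
            ENNReal.inv_mul_cancel hV0 hVt, one_mul]
  · have : Continuous fun p : Eu d × Eu d => φ (dilate L s p.1 + p.2) - φ p.1 := by fun_prop
    exact (this.measurable.enorm.pow_const 2).aemeasurable

end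

/-! ### Stability of the `L²` projection in `H¹` -/

section

variable {d : ℕ} {L : ℝ}

theorem enorm_sq_eq_ofReal (t : ℝ) : ‖t‖ₑ ^ 2 = ENNReal.ofReal (t ^ 2) := by
  rw [← ofReal_norm, ← ENNReal.ofReal_pow (norm_nonneg _), Real.norm_eq_abs, sq_abs]

theorem enorm_sub_sq_le_two_mul (u v : ℝ) : ‖u - v‖ₑ ^ 2 ≤ 2 * ‖u‖ₑ ^ 2 + 2 * ‖v‖ₑ ^ 2 := by
  have h : (u - v) ^ 2 ≤ 2 * u ^ 2 + 2 * v ^ 2 := by nlinarith [sq_nonneg (u + v)]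
  have h2 := ENNReal.ofReal_le_ofReal h
  rw [ENNReal.ofReal_add (by positivity) (by positivity), ENNReal.ofReal_mul (by norm_num),
    ENNReal.ofReal_mul (by norm_num)] at h2
  simpa only [enorm_sq_eq_ofReal, ENNReal.ofReal_ofNat] using h2

namespace Triangulation
variable (𝒯 : Triangulation d L)

theorem nonempty_elements (hL : 0 < L) : Nonempty 𝒯.elements := by
  obtain ⟨K, -⟩ := 𝒯.exists_mem_element (x := 0) (by
    rw [closure_cube hL]; exact fun i => ⟨le_rfl, hL.le⟩)
  exact ⟨K⟩

/-- The mesh size `h` of a quasi-uniform triangulation. -/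
theorem exists_mesh_size (hd : 0 < d) (hL : 0 < L) {σ : ℝ} (hQ : 𝒯.IsQuasiUniform σ) :
    ∃ h > 0, h ≤ √d * L ∧ ∀ K : 𝒯.elements,
      (∀ x ∈ convexHull ℝ (K.1 : Set (Eu d)), ∀ y ∈ convexHull ℝ (K.1 : Set (Eu d)), ‖x - y‖ ≤ h) ∧
      ∃ x, Metric.closedBall x (h / σ) ⊆ convexHull ℝ (K.1 : Set (Eu d)) := by
  have := 𝒯.nonempty_elements hL
  obtain ⟨K₀, hK₀⟩ := Finite.exists_max fun K : 𝒯.elements =>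
    Metric.diam (convexHull ℝ (K.1 : Set (Eu d)))
  have hb : ∀ K : 𝒯.elements, Bornology.IsBounded (convexHull ℝ (K.1 : Set (Eu d))) := fun K =>
    (K.1.finite_toSet.isCompact_convexHull ℝ).isBounded
  refine ⟨Metric.diam (convexHull ℝ (K₀.1 : Set (Eu d))), ?_, ?_, fun K => ⟨fun x hx y hy => ?_,
    hQ K.1 K.2 K₀.1 K₀.2⟩⟩
  · obtain ⟨a, ha, b, hb', hab⟩ := Finset.one_lt_card.1 (by rw [K₀.2.2]; omega : 1 < K₀.1.card)
    refine (dist_pos.2 hab).trans_le (Metric.dist_le_diam_of_mem (hb K₀) ?_ ?_)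
    · exact subset_convexHull ℝ _ ha
    · exact subset_convexHull ℝ _ hb'
  · refine Metric.diam_le_of_forall_dist_le (by positivity) fun x hx y hy => ?_
    rw [dist_eq_norm]
    exact norm_sub_le_of_mem_closure_cube hL (𝒯.convexHull_subset_closure K₀ hx)
      (𝒯.convexHull_subset_closure K₀ hy)
  · rw [← dist_eq_norm]
    exact (Metric.dist_le_diam_of_mem (hb K) hx hy).trans (hK₀ K)

theorem abs_interpAffine_sub_le (K : 𝒯.elements) {c : Eu d → ℝ} {k B : ℝ}
    (h : ∀ a ∈ K.1, |c a - k| ≤ B) {x : Eu d} (hx : x ∈ convexHull ℝ (K.1 : Set (Eu d))) :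
    |𝒯.interpAffine K c x - k| ≤ B := by
  have e : 𝒯.interpAffine K c x - k = ∑ a ∈ K.1, (c a - k) * 𝒯.bary K a x := by
    rw [interpAffine_apply]
    simp only [sub_mul, Finset.sum_sub_distrib, ← Finset.mul_sum, 𝒯.sum_bary, mul_one]
  rw [e]
  calc |∑ a ∈ K.1, (c a - k) * 𝒯.bary K a x| ≤ ∑ a ∈ K.1, |(c a - k) * 𝒯.bary K a x| :=
        Finset.abs_sum_le_sum_abs _ _
    _ ≤ ∑ a ∈ K.1, B * 𝒯.bary K a x := by
        refine Finset.sum_le_sum fun a ha => ?_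
        rw [abs_mul, abs_of_nonneg (𝒯.bary_nonneg K hx a)]
        exact mul_le_mul_of_nonneg_right (h a ha) (𝒯.bary_nonneg K hx a)
    _ = B := by rw [← Finset.mul_sum, 𝒯.sum_bary, mul_one]

/-- On an element that contains a ball of radius `ρ`, the gradient of an affine function is bounded
by its oscillation at the vertices. -/
theorem norm_gradOf_le (K : 𝒯.elements) {c : Eu d → ℝ} {B ρ : ℝ} (hρ : 0 < ρ)
    (h : ∀ a ∈ K.1, ∀ b ∈ K.1, |c a - c b| ≤ B) {x : Eu d}
    (hx : Metric.closedBall x ρ ⊆ convexHull ℝ (K.1 : Set (Eu d))) :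
    ρ * ‖gradOf (𝒯.interpAffine K c)‖ ≤ B := by
  set p := gradOf (𝒯.interpAffine K c) with hp
  have h1 : ∀ y ∈ convexHull ℝ (K.1 : Set (Eu d)), ∀ z ∈ convexHull ℝ (K.1 : Set (Eu d)),
      |𝒯.interpAffine K c y - 𝒯.interpAffine K c z| ≤ B := fun y hy z hz => by
    refine 𝒯.abs_interpAffine_sub_le K (fun a ha => ?_) hy
    rw [abs_sub_comm]
    exact 𝒯.abs_interpAffine_sub_le K (fun b hb => h b hb a ha) hz
  by_cases hp0 : p = 0
  · rw [hp0, norm_zero, mul_zero]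
    exact (abs_nonneg _).trans (h1 x (hx (Metric.mem_closedBall_self hρ.le)) x
      (hx (Metric.mem_closedBall_self hρ.le)))
  · have hn : 0 < ‖p‖ := norm_pos_iff.2 hp0
    have h2 := h1 (x + (ρ / ‖p‖) • p) (hx ?_) x (hx (Metric.mem_closedBall_self hρ.le))
    · rw [affine_sub_eq_inner, ← hp, add_sub_cancel_left, real_inner_smul_right,
        real_inner_self_eq_norm_sq] at h2
      refine le_trans (le_of_eq ?_) ((le_abs_self _).trans h2)
      field_simp
    · rw [mem_closedBall_iff_norm, add_sub_cancel_left, norm_smul,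
        Real.norm_of_nonneg (by positivity)]
      rw [div_mul_cancel₀ _ hn.ne']

/-- The inverse estimate on an element: the values of an affine function at points at the distance
`ρ / 2` in the direction of its gradient differ by `ρ / 2` times the norm of the gradient. -/
theorem enorm_gradOf_sq_mul_volume_le (K : 𝒯.elements) (A : Eu d →ᵃ[ℝ] ℝ) {h σ : ℝ} (hh : 0 < h)
    (hσ : 0 < σ)
    (hdiam : ∀ x ∈ convexHull ℝ (K.1 : Set (Eu d)), ∀ y ∈ convexHull ℝ (K.1 : Set (Eu d)),
      ‖x - y‖ ≤ h) {x : Eu d}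
    (hx : Metric.closedBall x (h / σ) ⊆ convexHull ℝ (K.1 : Set (Eu d))) :
    ∫⁻ _y in convexHull ℝ (K.1 : Set (Eu d)), ‖gradOf A‖ₑ ^ 2 ≤
      ENNReal.ofReal (16 * (2 * σ) ^ d * σ ^ 2 / h ^ 2) *
        ∫⁻ y in convexHull ℝ (K.1 : Set (Eu d)), ‖A y‖ₑ ^ 2 := by
  set p := gradOf A with hp
  by_cases hp0 : p = 0
  · simp [hp0]
  have hn : 0 < ‖p‖ := norm_pos_iff.2 hp0
  set ρ := h / σ with hρ
  have hρ0 : 0 < ρ := by positivity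
  have hA : Measurable A := A.continuous_of_finiteDimensional.measurable
  let e : Eu d := (ρ / 2 / ‖p‖) • p
  have he : ‖e‖ = ρ / 2 := by
    rw [norm_smul, Real.norm_of_nonneg (by positivity), div_mul_cancel₀ _ hn.ne']
  have hAe : ∀ y, A (y + e) - A y = ρ / 2 * ‖p‖ := fun y => by
    rw [affine_sub_eq_inner, ← hp, add_sub_cancel_left, real_inner_smul_right,
      real_inner_self_eq_norm_sq]
    field_simp
  set I := ∫⁻ y in convexHull ℝ (K.1 : Set (Eu d)), ‖A y‖ₑ ^ 2 with hI
  have hB : Metric.closedBall x (ρ / 2) ⊆ convexHull ℝ (K.1 : Set (Eu d)) :=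
    (Metric.closedBall_subset_closedBall (by linarith)).trans hx
  have hBe : ∀ y ∈ Metric.closedBall x (ρ / 2), y + e ∈ convexHull ℝ (K.1 : Set (Eu d)) :=
    fun y hy => hx (by
      rw [mem_closedBall_iff_norm] at hy ⊢
      calc ‖y + e - x‖ = ‖(y - x) + e‖ := by congr 1; module
        _ ≤ ‖y - x‖ + ‖e‖ := norm_add_le _ _
        _ ≤ ρ := by rw [he]; linarith)
  have k1 : ∫⁻ y in Metric.closedBall x (ρ / 2), ‖A y‖ₑ ^ 2 ≤ I :=
    lintegral_mono_set hB
  have k2 : ∫⁻ y in Metric.closedBall x (ρ / 2), ‖A (y + e)‖ₑ ^ 2 ≤ I := by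
    have := setLIntegral_dilation_le (fun z => ‖A z‖ₑ ^ 2)
      (measurableSet_closedBall (x := x) (ε := ρ / 2)) (𝒯.measurableSet_element K) le_rfl e
      fun y hy => by rw [one_smul]; exact hBe y hy
    simpa using this
  have k3 : ENNReal.ofReal ((ρ / 2 * ‖p‖) ^ 2) * volume (Metric.closedBall x (ρ / 2)) ≤ 4 * I := by
    calc _ = ∫⁻ y in Metric.closedBall x (ρ / 2), ‖A (y + e) - A y‖ₑ ^ 2 := by
          rw [← setLIntegral_const]
          refine lintegral_congr fun y => ?_
          rw [hAe, ← ofReal_norm, Real.norm_of_nonneg (by positivity),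
            ENNReal.ofReal_pow (by positivity)]
      _ ≤ ∫⁻ y in Metric.closedBall x (ρ / 2), (2 * ‖A (y + e)‖ₑ ^ 2 + 2 * ‖A y‖ₑ ^ 2) := by
          refine lintegral_mono fun y => ?_
          exact enorm_sub_sq_le_two_mul _ _
      _ = 2 * (∫⁻ y in Metric.closedBall x (ρ / 2), ‖A (y + e)‖ₑ ^ 2) +
          2 * ∫⁻ y in Metric.closedBall x (ρ / 2), ‖A y‖ₑ ^ 2 := by
          rw [lintegral_add_left (by fun_prop), lintegral_const_mul' _ _ (by simp),
            lintegral_const_mul' _ _ (by simp)]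
      _ ≤ 2 * I + 2 * I := by gcongr
      _ = 4 * I := by ring
  have k4 : volume (convexHull ℝ (K.1 : Set (Eu d))) ≤
      ENNReal.ofReal ((2 * σ) ^ d) * volume (Metric.closedBall x (ρ / 2)) := by
    rw [← volume_closedBall_mul (by positivity) (by positivity) x]
    refine measure_mono fun y hy => ?_
    rw [mem_closedBall_iff_norm]
    refine (hdiam y hy x (hx (Metric.mem_closedBall_self hρ0.le))).trans (le_of_eq ?_)
    rw [hρ]; field_simp
  have hpe : ‖p‖ₑ ^ 2 = ENNReal.ofReal (4 / ρ ^ 2) * ENNReal.ofReal ((ρ / 2 * ‖p‖) ^ 2) := by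
    rw [← ENNReal.ofReal_mul (by positivity), ← ofReal_norm, ← ENNReal.ofReal_pow (norm_nonneg _)]
    congr 1
    field_simp
    norm_num
  calc ∫⁻ _y in convexHull ℝ (K.1 : Set (Eu d)), ‖p‖ₑ ^ 2
      = ‖p‖ₑ ^ 2 * volume (convexHull ℝ (K.1 : Set (Eu d))) := setLIntegral_const _ _
    _ ≤ ‖p‖ₑ ^ 2 * (ENNReal.ofReal ((2 * σ) ^ d) * volume (Metric.closedBall x (ρ / 2))) := by
        gcongr
    _ = ENNReal.ofReal ((2 * σ) ^ d) * ENNReal.ofReal (4 / ρ ^ 2) *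
          (ENNReal.ofReal ((ρ / 2 * ‖p‖) ^ 2) * volume (Metric.closedBall x (ρ / 2))) := by
        rw [hpe]; ring
    _ ≤ ENNReal.ofReal ((2 * σ) ^ d) * ENNReal.ofReal (4 / ρ ^ 2) * (4 * I) := by gcongr
    _ = _ := by
        have : (16 * (2 * σ) ^ d * σ ^ 2 / h ^ 2) = (2 * σ) ^ d * (4 / ρ ^ 2) * 4 := by
          rw [hρ]; field_simp; norm_num
        rw [this, ENNReal.ofReal_mul (by positivity), ENNReal.ofReal_mul (by positivity),
          ENNReal.ofReal_ofNat]
        ring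

theorem enorm_grad_sq_eq (hL : 0 < L) (v : 𝒯.Vh) : ‖grad (v : H10 d L)‖ₑ ^ 2 =
    ∑ K : 𝒯.elements, ∫⁻ _y in convexHull ℝ (K.1 : Set (Eu d)),
      ‖gradOf (𝒯.interpAffine K (𝒯.rep v))‖ₑ ^ 2 := by
  rw [enorm_sq_eq_lintegral, 𝒯.lintegral_cube_eq_sum]
  exact Finset.sum_congr rfl fun K _ => lintegral_congr_ae
    ((𝒯.ae_element_grad_eq hL v K).mono fun x hx => by simp only [hx])

/-- The inverse estimate `‖∇v‖ ≤ C h⁻¹ ‖v‖` in `V_h`. -/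
theorem norm_grad_le_of_mesh (hL : 0 < L) {h σ : ℝ} (hh : 0 < h) (hσ : 0 < σ)
    (hmesh : ∀ K : 𝒯.elements,
      (∀ x ∈ convexHull ℝ (K.1 : Set (Eu d)), ∀ y ∈ convexHull ℝ (K.1 : Set (Eu d)), ‖x - y‖ ≤ h) ∧
      ∃ x, Metric.closedBall x (h / σ) ⊆ convexHull ℝ (K.1 : Set (Eu d))) (v : 𝒯.Vh) :
    h * ‖grad (v : H10 d L)‖ ≤ √(16 * (2 * σ) ^ d * σ ^ 2) * ‖val (v : H10 d L)‖ := by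
  have h1 : ‖grad (v : H10 d L)‖ₑ ^ 2 ≤
      ENNReal.ofReal (16 * (2 * σ) ^ d * σ ^ 2 / h ^ 2) * ‖val (v : H10 d L)‖ₑ ^ 2 := by
    rw [𝒯.enorm_grad_sq_eq hL, enorm_sq_eq_lintegral, 𝒯.lintegral_cube_eq_sum, Finset.mul_sum]
    refine Finset.sum_le_sum fun K _ => ?_
    obtain ⟨hdiam, x, hx⟩ := hmesh K
    refine (𝒯.enorm_gradOf_sq_mul_volume_le K _ hh hσ hdiam hx).trans (le_of_eq ?_)
    congr 1
    exact lintegral_congr_ae ((𝒯.ae_element_val_eq hL v K).mono fun x hx => by simp only [hx])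
  rw [← ofReal_norm, ← ofReal_norm, ← ENNReal.ofReal_pow (norm_nonneg _),
    ← ENNReal.ofReal_pow (norm_nonneg _), ← ENNReal.ofReal_mul (by positivity),
    ENNReal.ofReal_le_ofReal_iff (by positivity)] at h1
  refine le_of_sq_le_sq ?_ (by positivity)
  rw [mul_pow, mul_pow, Real.sq_sqrt (by positivity)]
  rw [div_mul_eq_mul_div, le_div_iff₀ (by positivity)] at h1
  linarith

end Triangulation

theorem measurable_localEnergy {h : ℝ} {φ : Eu d → ℝ} (hφ : ContDiff ℝ 1 φ) :
    Measurable (localEnergy L h φ) := by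
  have hg := continuous_gradient hφ
  have hd := continuous_dilate (d := d) (L := L) (1 + 2 * h / L)
  have h1 : Measurable fun p : Eu d × Eu d =>
      ‖gradient φ (dilate L (1 + 2 * h / L) p.1 + p.2)‖ₑ ^ 2 := by
    have : Continuous fun p : Eu d × Eu d => gradient φ (dilate L (1 + 2 * h / L) p.1 + p.2) := by
      fun_prop
    exact this.measurable.enorm.pow_const 2
  unfold localEnergy
  exact (h1.lintegral_prod_right'.const_mul _).const_mul _

theorem abs_le_sqrt_toReal {t : ℝ} {E : ℝ≥0∞} (hE : E ≠ ∞) (h : ‖t‖ₑ ^ 2 ≤ E) :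
    |t| ≤ √E.toReal := by
  rw [enorm_sq_eq_ofReal, ENNReal.ofReal_le_iff_le_toReal hE] at h
  exact Real.abs_le_sqrt h

theorem enorm_sq_le_of_abs_le_sqrt {t : ℝ} {E : ℝ≥0∞} (h : E ≠ ∞ → |t| ≤ √E.toReal) :
    ‖t‖ₑ ^ 2 ≤ E := by
  by_cases hE : E = ∞
  · simp [hE]
  · rw [enorm_sq_eq_ofReal, ENNReal.ofReal_le_iff_le_toReal hE, ← sq_abs]
    calc |t| ^ 2 ≤ √E.toReal ^ 2 := by gcongr; exact h hE
      _ = E.toReal := Real.sq_sqrt ENNReal.toReal_nonneg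

theorem norm_le_of_enorm_sq_le {F F' : Type*} [NormedAddCommGroup F] [NormedAddCommGroup F']
    {x : F} {y : F'} {k : ℝ} (hk : 0 ≤ k) (h : ‖x‖ₑ ^ 2 ≤ ENNReal.ofReal k * ‖y‖ₑ ^ 2) :
    ‖x‖ ≤ √k * ‖y‖ := by
  rw [← ofReal_norm, ← ofReal_norm, ← ENNReal.ofReal_pow (norm_nonneg _),
    ← ENNReal.ofReal_pow (norm_nonneg _), ← ENNReal.ofReal_mul hk,
    ENNReal.ofReal_le_ofReal_iff (by positivity)] at h
  refine le_of_sq_le_sq ?_ (by positivity)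
  rwa [mul_pow, Real.sq_sqrt hk]

namespace Triangulation
variable (𝒯 : Triangulation d L)

/-- Quasi-interpolation of a test function: the nodal interpolant `z` of its dilated averages
satisfies `‖φ - z‖ ≤ C h ‖∇φ‖` and `‖∇z‖ ≤ C ‖∇φ‖`. -/
theorem exists_quasiInterpolant (hL : 0 < L) {h σ : ℝ} (hh : 0 < h) (hhL : h ≤ √d * L)
    (hσ : 0 < σ) (hmesh : ∀ K : 𝒯.elements,
      (∀ x ∈ convexHull ℝ (K.1 : Set (Eu d)), ∀ y ∈ convexHull ℝ (K.1 : Set (Eu d)), ‖x - y‖ ≤ h) ∧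
      ∃ x, Metric.closedBall x (h / σ) ⊆ convexHull ℝ (K.1 : Set (Eu d)))
    {p : PairSpace d L} (hp : p ∈ testPairs d L) :
    ∃ z : 𝒯.Vh,
      ‖p.fst - val (z : H10 d L)‖ ≤
        √(2 * (1 + 2 * √d) ^ 2 * (1 + (2 + 2 * √d) ^ d)) * h * ‖p.snd‖ ∧
      ‖grad (z : H10 d L)‖ ≤ √(σ ^ 2 * (1 + 2 * √d) ^ 2 * (2 + 2 * √d) ^ d) * ‖p.snd‖ := by
  obtain ⟨φ, h1, h2, h3, h4, h5⟩ := hp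
  have hφ : ContDiff ℝ 1 φ := h1.of_le (by simp)
  obtain ⟨z, hz, hzv⟩ := 𝒯.exists_rep_eq hL (c := dilatedAverage L h φ)
    fun a _ ha => dilatedAverage_eq_zero hL hh h3 ha
  set S := 1 + 2 * √(d : ℝ) with hS
  have hsS : 1 + 2 * h / L ≤ S := by
    have : h / L ≤ √d := (div_le_iff₀ hL).2 hhL
    rw [hS, mul_div_assoc]; linarith
  have hG := lintegral_gradient_sq h3 h5
  have hE : ∫⁻ x in cube d L, localEnergy L h φ x ≤
      ENNReal.ofReal ((S * h) ^ 2 * (2 + 2 * √d) ^ d) * ‖p.snd‖ₑ ^ 2 := by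
    rw [← hG]
    refine (lintegral_localEnergy_le hL hh hφ).trans ?_
    gcongr
    linarith
  have hosc : ∀ K : 𝒯.elements, ∀ x ∈ convexHull ℝ (K.1 : Set (Eu d)),
      ∀ x₁ ∈ convexHull ℝ (K.1 : Set (Eu d)), ∀ x₂ ∈ convexHull ℝ (K.1 : Set (Eu d)),
      localEnergy L h φ x ≠ ∞ → |dilatedAverage L h φ x₁ - dilatedAverage L h φ x₂| ≤
        √(localEnergy L h φ x).toReal := fun K x hx x₁ hx₁ x₂ hx₂ hfin =>
    abs_le_sqrt_toReal hfin (enorm_dilatedAverage_sub_sq_le hL hh hφ ((hmesh K).1 _ hx₁ _ hx)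
      ((hmesh K).1 _ hx₂ _ hx) ((hmesh K).1 _ hx₁ _ hx₂))
  refine ⟨z, ?_, ?_⟩
  -- The interpolation error at `x` is at most the oscillation of the averages on its element.
  · have key : ‖p.fst - val (z : H10 d L)‖ₑ ^ 2 ≤
        ENNReal.ofReal (2 * S ^ 2 * (1 + (2 + 2 * √d) ^ d) * h ^ 2) * ‖p.snd‖ₑ ^ 2 := by
      calc ‖p.fst - val (z : H10 d L)‖ₑ ^ 2
          ≤ ∫⁻ x in cube d L, (2 * ‖dilatedAverage L h φ x - φ x‖ₑ ^ 2 +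
              2 * localEnergy L h φ x) := by
            rw [enorm_sq_eq_lintegral]
            refine lintegral_mono_ae ?_
            filter_upwards [Lp.coeFn_sub p.fst (val (z : H10 d L)), h4, hzv, 𝒯.ae_mem_interior]
              with x e1 e2 e3 ⟨K, hxK⟩
            have hxK' := interior_subset hxK
            rw [e1, Pi.sub_apply, e2, e3]
            have e4 : ‖𝒯.interp (dilatedAverage L h φ) x - dilatedAverage L h φ x‖ₑ ^ 2 ≤
                localEnergy L h φ x := by
              refine enorm_sq_le_of_abs_le_sqrt fun hfin => ?_
              rw [𝒯.interp_eq K hxK']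
              exact 𝒯.abs_interpAffine_sub_le K (fun a ha =>
                hosc K x hxK' a (subset_convexHull ℝ _ ha) x hxK' hfin) hxK'
            calc ‖φ x - 𝒯.interp (dilatedAverage L h φ) x‖ₑ ^ 2
                = ‖(dilatedAverage L h φ x - φ x) -
                    (dilatedAverage L h φ x - 𝒯.interp (dilatedAverage L h φ) x)‖ₑ ^ 2 := by
                  rw [← enorm_neg]; congr 2; ring
              _ ≤ _ := enorm_sub_sq_le_two_mul _ _
              _ ≤ _ := by
                  rw [← enorm_neg (dilatedAverage L h φ x - 𝒯.interp _ x), neg_sub]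
                  gcongr
        _ = 2 * (∫⁻ x in cube d L, ‖dilatedAverage L h φ x - φ x‖ₑ ^ 2) +
              2 * ∫⁻ x in cube d L, localEnergy L h φ x := by
            rw [lintegral_add_right _ ((measurable_localEnergy hφ).const_mul 2),
              lintegral_const_mul' _ _ (by simp), lintegral_const_mul' _ _ (by simp)]
        _ ≤ 2 * (ENNReal.ofReal ((2 * √d + 1) * h) ^ 2 * ‖p.snd‖ₑ ^ 2) +
              2 * (ENNReal.ofReal ((S * h) ^ 2 * (2 + 2 * √d) ^ d) * ‖p.snd‖ₑ ^ 2) := by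
            gcongr
            rw [← hG]
            exact lintegral_dilatedAverage_sub_le hL hh hφ
        _ = _ := by
            have : 2 * S ^ 2 * (1 + (2 + 2 * √d) ^ d) * h ^ 2 =
                2 * (((2 * √d + 1) * h) ^ 2 + (S * h) ^ 2 * (2 + 2 * √d) ^ d) := by
              rw [hS]; ring
            rw [this, ENNReal.ofReal_mul (p := 2) (by norm_num),
              ENNReal.ofReal_add (p := ((2 * √d + 1) * h) ^ 2) (by positivity) (by positivity),
              ENNReal.ofReal_pow (p := (2 * √d + 1) * h) (by positivity), ENNReal.ofReal_ofNat]
            ring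
    have := norm_le_of_enorm_sq_le (by positivity) key
    rwa [Real.sqrt_mul (by positivity), Real.sqrt_sq hh.le] at this
  · refine norm_le_of_enorm_sq_le (by positivity) ?_
    calc ‖grad (z : H10 d L)‖ₑ ^ 2
        ≤ ∫⁻ x in cube d L, ENNReal.ofReal ((σ / h) ^ 2) * localEnergy L h φ x := by
          rw [enorm_sq_eq_lintegral]
          refine lintegral_mono_ae ?_
          filter_upwards [(𝒯.val_grad_eq hL z).2, 𝒯.ae_mem_interior] with x e1 ⟨K, hxK⟩
          have hxK' := interior_subset hxK
          rw [e1, 𝒯.gradient_interp K hxK]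
          set g := gradOf (𝒯.interpAffine K (𝒯.rep z))
          obtain ⟨-, x₀, hx₀⟩ := hmesh K
          -- The inscribed ball of radius `h / σ` turns the oscillation into a gradient bound.
          have e2 : ‖h / σ * ‖g‖‖ₑ ^ 2 ≤ localEnergy L h φ x := by
            refine enorm_sq_le_of_abs_le_sqrt fun hfin => ?_
            rw [abs_of_nonneg (by positivity)]
            refine 𝒯.norm_gradOf_le K (by positivity) (fun a ha b hb => ?_) hx₀
            rw [hz a (mem_nodes K.2.1 ha), hz b (mem_nodes K.2.1 hb)]
            exact hosc K x hxK' a (subset_convexHull ℝ _ ha) b (subset_convexHull ℝ _ hb) hfin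
          calc ‖g‖ₑ ^ 2 = ENNReal.ofReal ((σ / h) ^ 2) * ‖h / σ * ‖g‖‖ₑ ^ 2 := by
                rw [enorm_sq_eq_ofReal, ← ENNReal.ofReal_mul (by positivity), ← ofReal_norm,
                  ← ENNReal.ofReal_pow (norm_nonneg _)]
                congr 1
                field_simp
            _ ≤ _ := by gcongr
      _ ≤ ENNReal.ofReal ((σ / h) ^ 2) *
            (ENNReal.ofReal ((S * h) ^ 2 * (2 + 2 * √d) ^ d) * ‖p.snd‖ₑ ^ 2) := by
          rw [lintegral_const_mul' _ _ (by simp)]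
          gcongr
      _ = _ := by
          rw [← mul_assoc, ← ENNReal.ofReal_mul (by positivity)]
          congr 2
          field_simp

end Triangulation

/-- The constant in the `H¹`-stability of the `L²`-projection. -/
def stabConst (d : ℕ) (σ : ℝ) : ℝ :=
  √(2 * (1 + 2 * √d) ^ 2 * (1 + (2 + 2 * √d) ^ d)) * √(16 * (2 * σ) ^ d * σ ^ 2) +
    √(σ ^ 2 * (1 + 2 * √d) ^ 2 * (2 + 2 * √d) ^ d)

theorem stabConst_nonneg (d : ℕ) (σ : ℝ) : 0 ≤ stabConst d σ := by
  unfold stabConst; positivity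

namespace Triangulation
variable (𝒯 : Triangulation d L)

/-- The `H¹`-stability of the `L²`-projection on quasi-uniform triangulations, in dual form:
`(v, Δ_h w) = -(∇P_h v, ∇w)`. -/
theorem abs_inner_laplacian_le (hd : 0 < d) (hL : 0 < L) {σ : ℝ} (hσ : 0 < σ)
    (hQ : 𝒯.IsQuasiUniform σ) (v : H10 d L) (w : 𝒯.Vh) :
    |⟪val v, val (𝒯.laplacian w : H10 d L)⟫_ℝ| ≤
      stabConst d σ * ‖grad v‖ * ‖grad (w : H10 d L)‖ := by
  obtain ⟨h, hh, hhL, hmesh⟩ := 𝒯.exists_mesh_size hd hL hQ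
  have hcl : IsClosed {p : PairSpace d L | |⟪p.fst, val (𝒯.laplacian w : H10 d L)⟫_ℝ| ≤
      stabConst d σ * ‖p.snd‖ * ‖grad (w : H10 d L)‖} :=
    isClosed_le (continuous_fst.inner continuous_const).abs
      ((continuous_const.mul continuous_snd.norm).mul continuous_const)
  -- Both sides are continuous in `(v, ∇v)`, hence test functions `v` suffice.
  refine H10.induction_closed hcl (fun p hp => ?_) v
  obtain ⟨z, hz1, hz2⟩ := 𝒯.exists_quasiInterpolant hL hh hhL hσ hmesh hp
  set Δ := 𝒯.laplacian w with hΔ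
  -- The inverse estimate bounds the discrete Laplacian by `h⁻¹` times the gradient.
  have k1 : h * ‖val (Δ : H10 d L)‖ ≤ √(16 * (2 * σ) ^ d * σ ^ 2) * ‖grad (w : H10 d L)‖ := by
    have e := 𝒯.laplacian_spec w Δ
    rw [← hΔ, real_inner_self_eq_norm_sq] at e
    have i1 := 𝒯.norm_grad_le_of_mesh hL hh hσ hmesh Δ
    have i2 : ‖val (Δ : H10 d L)‖ ^ 2 ≤ ‖grad (w : H10 d L)‖ * ‖grad (Δ : H10 d L)‖ := by
      rw [e]
      exact (neg_le_abs _).trans (abs_real_inner_le_norm _ _)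
    rcases (norm_nonneg (val (Δ : H10 d L))).eq_or_lt with h0 | h0
    · rw [← h0, mul_zero]; positivity
    · refine le_of_mul_le_mul_right ?_ h0
      nlinarith [mul_le_mul_of_nonneg_left i1 (norm_nonneg (grad (w : H10 d L))),
        mul_le_mul_of_nonneg_left i2 hh.le]
  have k2 : ⟪p.fst, val (Δ : H10 d L)⟫_ℝ = ⟪p.fst - val (z : H10 d L), val (Δ : H10 d L)⟫_ℝ -
      ⟪grad (w : H10 d L), grad (z : H10 d L)⟫_ℝ := by
    have := 𝒯.laplacian_spec w z
    rw [inner_sub_left, real_inner_comm (val (Δ : H10 d L)) (val (z : H10 d L)), hΔ, this]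
    ring
  change |⟪p.fst, val (Δ : H10 d L)⟫_ℝ| ≤ _
  rw [k2]
  set C₁ := √(2 * (1 + 2 * √d) ^ 2 * (1 + (2 + 2 * √d) ^ d))
  set C₂ := √(σ ^ 2 * (1 + 2 * √d) ^ 2 * (2 + 2 * √d) ^ d)
  have b1 : |⟪p.fst - val (z : H10 d L), val (Δ : H10 d L)⟫_ℝ| ≤
      C₁ * ‖p.snd‖ * (√(16 * (2 * σ) ^ d * σ ^ 2) * ‖grad (w : H10 d L)‖) := by
    calc _ ≤ ‖p.fst - val (z : H10 d L)‖ * ‖val (Δ : H10 d L)‖ := abs_real_inner_le_norm _ _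
      _ ≤ C₁ * h * ‖p.snd‖ * ‖val (Δ : H10 d L)‖ := by gcongr
      _ = C₁ * ‖p.snd‖ * (h * ‖val (Δ : H10 d L)‖) := by ring
      _ ≤ _ := by gcongr
  have b2 : |⟪grad (w : H10 d L), grad (z : H10 d L)⟫_ℝ| ≤
      ‖grad (w : H10 d L)‖ * (C₂ * ‖p.snd‖) :=
    (abs_real_inner_le_norm _ _).trans (by gcongr)
  calc _ ≤ _ := abs_sub _ _
    _ ≤ _ := add_le_add b1 b2
    _ = _ := by rw [stabConst]; ring

end Triangulation

end

/-! ### The nonlinearity and the pathwise energy inequality -/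

section

/-- The part of the nonlinearity `t - t ^ q` in `[-1, 1]`; it is bounded. -/
def boundedPart (q : ℕ) (t : ℝ) : ℝ := if |t| ≤ 1 then t - t ^ q else 0

/-- The part of `t ^ q - t` outside `[-1, 1]`; it is nondecreasing. -/
def monotonePart (q : ℕ) (t : ℝ) : ℝ := if |t| ≤ 1 then 0 else t ^ q - t

theorem boundedPart_sub_monotonePart (q : ℕ) (t : ℝ) :
    boundedPart q t - monotonePart q t = t - t ^ q := by
  unfold boundedPart monotonePart
  split_ifs <;> ring

theorem abs_boundedPart_le {q : ℕ} (hq : Odd q) (t : ℝ) : |boundedPart q t| ≤ 1 := by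
  unfold boundedPart
  split_ifs with h
  · obtain ⟨k, rfl⟩ := hq
    have h1 : t ^ (2 * k) ≤ 1 := by
      rw [← (even_two_mul k).pow_abs]; exact pow_le_one₀ (abs_nonneg t) h
    have h0 : 0 ≤ t ^ (2 * k) := (even_two_mul k).pow_nonneg t
    rw [show t - t ^ (2 * k + 1) = t * (1 - t ^ (2 * k)) by ring, abs_mul,
      abs_of_nonneg (sub_nonneg.2 h1)]
    calc |t| * (1 - t ^ (2 * k)) ≤ 1 * 1 := by gcongr; linarith
      _ = 1 := one_mul 1
  · simp

theorem monotone_monotonePart {q : ℕ} (hq : Odd q) : Monotone (monotonePart q) := by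
  obtain ⟨k, rfl⟩ := hq
  have e : ∀ t, monotonePart (2 * k + 1) t = if |t| ≤ 1 then 0 else t * (|t| ^ (2 * k) - 1) := by
    intro t
    rw [monotonePart, (even_two_mul k).pow_abs]
    split_ifs <;> ring
  have hpos : ∀ t : ℝ, 1 < |t| → 0 ≤ |t| ^ (2 * k) - 1 := fun t ht =>
    sub_nonneg.2 (one_le_pow₀ ht.le)
  have hmono : ∀ s t : ℝ, 1 < s → s ≤ t → s * (s ^ (2 * k) - 1) ≤ t * (t ^ (2 * k) - 1) :=
    fun s t hs hst => by
      have := sub_nonneg.2 (one_le_pow₀ hs.le : 1 ≤ s ^ (2 * k))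
      gcongr
      linarith
  intro x y hxy
  rw [e, e]
  split_ifs with hx hy hy
  · exact le_rfl
  · rw [not_le] at hy
    refine mul_nonneg ?_ (hpos y hy)
    rcases lt_abs.1 hy with h | h
    · linarith
    · linarith [(abs_le.1 hx).1]
  · rw [not_le] at hx
    refine mul_nonpos_of_nonpos_of_nonneg ?_ (hpos x hx)
    rcases lt_abs.1 hx with h | h
    · linarith [(abs_le.1 hy).2]
    · linarith
  · rw [not_le] at hx hy
    rcases lt_abs.1 hx with h | h
    · rw [abs_of_pos (by linarith), abs_of_pos (by linarith)]
      exact hmono x y h hxy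
    · rcases lt_abs.1 hy with h' | h'
      · exact (mul_nonpos_of_nonpos_of_nonneg (by linarith) (hpos x hx)).trans
          (mul_nonneg (by linarith) (hpos y hy))
      · rw [abs_of_neg (by linarith), abs_of_neg (by linarith)]
        have := hmono (-y) (-x) h' (by linarith)
        linarith

/-- The volume of `D`. -/
def cubeVolume (d : ℕ) (L : ℝ) : ℝ := volume.real (cube d L)

variable {d : ℕ} {L : ℝ}
namespace Triangulation
variable (𝒯 : Triangulation d L)

/-- Elements of `V_h` with the same `L²` products with `V_h` are equal. -/
theorem eq_of_inner_val_eq {v w : 𝒯.Vh}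
    (h : ∀ z : 𝒯.Vh, ⟪val (v : H10 d L), val (z : H10 d L)⟫_ℝ =
      ⟪val (w : H10 d L), val (z : H10 d L)⟫_ℝ) : v = w := by
  have e : val ((v - w : 𝒯.Vh) : H10 d L) = val (v : H10 d L) - val (w : H10 d L) := rfl
  have h0 : ⟪val ((v - w : 𝒯.Vh) : H10 d L), val ((v - w : 𝒯.Vh) : H10 d L)⟫_ℝ = 0 := by
    nth_rw 1 [e]
    rw [inner_sub_left, h, sub_self]
  exact sub_eq_zero.1 (Subtype.ext (eq_zero_of_val_eq_zero _ (inner_self_eq_zero.1 h0)))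

/-- The discrete Laplacian as a linear map. -/
def laplacianLinear : 𝒯.Vh →ₗ[ℝ] 𝒯.Vh where
  toFun := 𝒯.laplacian
  map_add' v w := by
    refine 𝒯.eq_of_inner_val_eq fun z => ?_
    rw [Submodule.coe_add, val_add, inner_add_left]
    simp only [laplacian_spec]
    rw [Submodule.coe_add, grad_add, inner_add_left, neg_add]
  map_smul' c v := by
    refine 𝒯.eq_of_inner_val_eq fun z => ?_
    rw [RingHom.id_apply, Submodule.coe_smul, val_smul, real_inner_smul_left]
    simp only [laplacian_spec]
    rw [Submodule.coe_smul, grad_smul, real_inner_smul_left, mul_neg]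

theorem laplacian_sub (v w : 𝒯.Vh) : 𝒯.laplacian (v - w) = 𝒯.laplacian v - 𝒯.laplacian w :=
  map_sub 𝒯.laplacianLinear v w

theorem continuous_laplacian : Continuous 𝒯.laplacian :=
  𝒯.laplacianLinear.continuous_of_finiteDimensional

/-- The interpolated nonlinearity, tested with `-Δ_h u`, is bounded by `|D| / 2 + ‖Δ_h u‖² / 2`:
the nodal values of its bounded part are in `[-1, 1]`, and its monotone part has the good sign
because the stiffness matrix of a Delaunay mesh is an M-matrix. -/
theorem integral_interp_laplacian_le (hd : d = 1 ∨ d = 2) (hL : 0 < L) (hDel : 𝒯.IsDelaunay)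
    {q : ℕ} (hq : 3 ≤ q) (hq_odd : Odd q) (u : 𝒯.Vh) :
    ∫ x in cube d L, 𝒯.interp (fun y => 𝒯.rep u y - 𝒯.rep u y ^ q) x *
        val ((-𝒯.laplacian u : 𝒯.Vh) : H10 d L) x ≤
      cubeVolume d L / 2 + ‖val (𝒯.laplacian u : H10 d L)‖ ^ 2 / 2 := by
  obtain ⟨b, -, hb⟩ := 𝒯.exists_rep_eq hL (c := fun y => boundedPart q (𝒯.rep u y))
    fun a _ ha => by simp [𝒯.rep_eq_zero_of_mem_frontier hL u ha, boundedPart,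
      (show q ≠ 0 by omega)]
  obtain ⟨m, hm, hm'⟩ := 𝒯.exists_rep_eq hL (c := fun y => monotonePart q (𝒯.rep u y))
    fun a _ ha => by simp [𝒯.rep_eq_zero_of_mem_frontier hL u ha, monotonePart]
  have hint : ∫ x in cube d L, 𝒯.interp (fun y => 𝒯.rep u y - 𝒯.rep u y ^ q) x *
        val ((-𝒯.laplacian u : 𝒯.Vh) : H10 d L) x =
      ⟪val ((b - m : 𝒯.Vh) : H10 d L), val ((-𝒯.laplacian u : 𝒯.Vh) : H10 d L)⟫_ℝ := by
    rw [L2.inner_def]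
    refine integral_congr_ae ?_
    have e : val ((b - m : 𝒯.Vh) : H10 d L) = val (b : H10 d L) - val (m : H10 d L) := rfl
    filter_upwards [hb, hm', Lp.coeFn_sub (val (b : H10 d L)) (val (m : H10 d L))] with x h1 h2 h3
    rw [e, h3, Pi.sub_apply, h1, h2]
    have : 𝒯.interp (fun y => 𝒯.rep u y - 𝒯.rep u y ^ q) x =
        𝒯.interp (fun y => boundedPart q (𝒯.rep u y)) x -
          𝒯.interp (fun y => monotonePart q (𝒯.rep u y)) x := by
      simp only [interp, ← boundedPart_sub_monotonePart, sub_mul, Finset.sum_sub_distrib]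
    rw [this]
    simp [mul_comm]
  -- `(m, Δ_h u) = -(∇u, ∇m)`, and the nodal values of `m` are monotone functions of those of `u`.
  have hmono : 0 ≤ ⟪grad (u : H10 d L), grad (m : H10 d L)⟫_ℝ := by
    refine 𝒯.inner_grad_nonneg hd hDel hL fun a ha a' ha' => ?_
    rw [hm a ha, hm a' ha']
    rcases le_total (𝒯.rep u a) (𝒯.rep u a') with h | h
    · exact mul_nonneg_of_nonpos_of_nonpos (sub_nonpos.2 h)
        (sub_nonpos.2 (monotone_monotonePart hq_odd h))
    · exact mul_nonneg (sub_nonneg.2 h) (sub_nonneg.2 (monotone_monotonePart hq_odd h))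
  have hbd : ‖val (b : H10 d L)‖ ^ 2 ≤ cubeVolume d L := by
    have hfin := (isFiniteMeasure_cube (d := d) hL).measure_univ_lt_top
    rw [Measure.restrict_apply_univ] at hfin
    have h1 : ‖val (b : H10 d L)‖ₑ ^ 2 ≤ volume (cube d L) := by
      rw [enorm_sq_eq_lintegral, ← Measure.restrict_apply_univ, ← lintegral_one]
      refine lintegral_mono_ae ?_
      filter_upwards [hb, ae_restrict_mem (isOpen_cube d L).measurableSet] with x hx hxm
      rw [hx, enorm_sq_eq_ofReal, ENNReal.ofReal_le_one, sq_le_one_iff_abs_le_one]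
      exact 𝒯.abs_interp_le (fun a _ => abs_boundedPart_le hq_odd _) (subset_closure hxm)
    have := ENNReal.toReal_mono hfin.ne h1
    simpa [cubeVolume, measureReal_def] using this
  have e1 : val ((b - m : 𝒯.Vh) : H10 d L) = val (b : H10 d L) - val (m : H10 d L) := rfl
  have e2 : val ((-𝒯.laplacian u : 𝒯.Vh) : H10 d L) = -val (𝒯.laplacian u : H10 d L) := rfl
  have e3 : ⟪val (m : H10 d L), val (𝒯.laplacian u : H10 d L)⟫_ℝ =
      -⟪grad (u : H10 d L), grad (m : H10 d L)⟫_ℝ := by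
    rw [real_inner_comm, 𝒯.laplacian_spec]
  rw [hint, e1, e2, inner_sub_left, inner_neg_right, inner_neg_right, e3]
  have := neg_le_of_abs_le (abs_real_inner_le_norm (val (b : H10 d L))
    (val (𝒯.laplacian u : H10 d L)))
  nlinarith [sq_nonneg (‖val (b : H10 d L)‖ - ‖val (𝒯.laplacian u : H10 d L)‖)]

/-- The pathwise energy inequality of one step of the scheme, obtained by testing with
`-Δ_h u¹`. In the noise terms `Δ_h u¹` is split into `Δ_h u⁰`, which is independent of the
increment `x`, and `Δ_h (u¹ - u⁰)`, which is absorbed by the stability of the `L²` projection. -/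
theorem energy_step (hd : d = 1 ∨ d = 2) (hL : 0 < L) (hDel : 𝒯.IsDelaunay)
    {σ : ℝ} (hσ : 0 < σ) (hQ : 𝒯.IsQuasiUniform σ)
    {q : ℕ} (hq : 3 ≤ q) (hq_odd : Odd q) {τ x : ℝ} (hτ : 0 ≤ τ) (g k : H10 d L) (u₀ u₁ : 𝒯.Vh)
    (h : ∀ v : 𝒯.Vh, ⟪val (u₁ - u₀ : H10 d L), val (v : H10 d L)⟫_ℝ
      + τ * ⟪grad (u₁ : H10 d L), grad (v : H10 d L)⟫_ℝ
      = τ * (∫ x in cube d L, 𝒯.interp (fun y => 𝒯.rep u₁ y - 𝒯.rep u₁ y ^ q) x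
          * val (v : H10 d L) x)
        + ⟪val g, val (v : H10 d L)⟫_ℝ * x
        + 1 / 2 * ⟪val k, val (v : H10 d L)⟫_ℝ * (x ^ 2 - τ)) :
    ‖grad (u₁ : H10 d L)‖ ^ 2 + 1 / 2 * ‖grad (u₁ - u₀ : H10 d L)‖ ^ 2
        + τ * ‖val (𝒯.laplacian u₁ : H10 d L)‖ ^ 2 ≤
      ‖grad (u₀ : H10 d L)‖ ^ 2 + τ * cubeVolume d L
        - 2 * ⟪val g, val (𝒯.laplacian u₀ : H10 d L)⟫_ℝ * x
        - ⟪val k, val (𝒯.laplacian u₀ : H10 d L)⟫_ℝ * (x ^ 2 - τ)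
        + 4 * stabConst d σ ^ 2 * ‖grad g‖ ^ 2 * x ^ 2
        + stabConst d σ ^ 2 * ‖grad k‖ ^ 2 * (x ^ 2 - τ) ^ 2 := by
  have hd0 : 0 < d := by rcases hd with rfl | rfl <;> norm_num
  have hnl := 𝒯.integral_interp_laplacian_le hd hL hDel hq hq_odd u₁
  have h := h (-𝒯.laplacian u₁)
  have n1 : ∀ f : L2 d L, ⟪f, val ((-𝒯.laplacian u₁ : 𝒯.Vh) : H10 d L)⟫_ℝ =
      -⟪f, val (𝒯.laplacian u₁ : H10 d L)⟫_ℝ := fun f => inner_neg_right _ _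
  have n2 : ⟪grad (u₁ : H10 d L), grad ((-𝒯.laplacian u₁ : 𝒯.Vh) : H10 d L)⟫_ℝ =
      ‖val (𝒯.laplacian u₁ : H10 d L)‖ ^ 2 := by
    rw [← real_inner_self_eq_norm_sq, 𝒯.laplacian_spec]
    exact inner_neg_right _ _
  have n3 : ⟪val (u₁ - u₀ : H10 d L), val (𝒯.laplacian u₁ : H10 d L)⟫_ℝ =
      -⟪grad (u₁ : H10 d L), grad (u₁ - u₀ : H10 d L)⟫_ℝ := by
    rw [real_inner_comm]; exact 𝒯.laplacian_spec u₁ (u₁ - u₀)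
  -- The polarization identity produces the numerical dissipation `‖∇(u¹ - u⁰)‖² / 2`.
  have n4 : ⟪grad (u₁ : H10 d L), grad (u₁ - u₀ : H10 d L)⟫_ℝ =
      (‖grad (u₁ : H10 d L)‖ ^ 2 - ‖grad (u₀ : H10 d L)‖ ^ 2
        + ‖grad (u₁ - u₀ : H10 d L)‖ ^ 2) / 2 := by
    have e : grad (u₁ - u₀ : H10 d L) = grad (u₁ : H10 d L) - grad (u₀ : H10 d L) := rfl
    rw [e, norm_sub_sq_real, inner_sub_right, real_inner_self_eq_norm_sq]
    ring
  have n5 : ∀ f : L2 d L, ⟪f, val (𝒯.laplacian u₁ : H10 d L)⟫_ℝ =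
      ⟪f, val (𝒯.laplacian u₀ : H10 d L)⟫_ℝ +
        ⟪f, val (𝒯.laplacian (u₁ - u₀) : H10 d L)⟫_ℝ := by
    intro f
    have e : val (𝒯.laplacian (u₁ - u₀) : H10 d L) =
        val (𝒯.laplacian u₁ : H10 d L) - val (𝒯.laplacian u₀ : H10 d L) := by
      rw [𝒯.laplacian_sub]; rfl
    rw [e, inner_sub_right]; ring
  have hg := 𝒯.abs_inner_laplacian_le hd0 hL hσ hQ g (u₁ - u₀)
  have hk := 𝒯.abs_inner_laplacian_le hd0 hL hσ hQ k (u₁ - u₀)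
  rw [AddSubgroupClass.coe_sub] at hg hk
  rw [n1, n1, n1, n2, n3, n4, n5 (val g), n5 (val k)] at h
  have hnl' := mul_le_mul_of_nonneg_left hnl hτ
  set c := stabConst d σ
  set D := ‖grad (u₁ - u₀ : H10 d L)‖
  set X' := ⟪val g, val (𝒯.laplacian (u₁ - u₀) : H10 d L)⟫_ℝ
  set Z' := ⟪val k, val (𝒯.laplacian (u₁ - u₀) : H10 d L)⟫_ℝ
  set y := x ^ 2 - τ
  -- Each of the two correlated noise terms takes a quarter of `‖∇(u¹ - u⁰)‖²`.
  have a1 : -(2 * X' * x) ≤ 4 * c ^ 2 * ‖grad g‖ ^ 2 * x ^ 2 + D ^ 2 / 4 := by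
    have : -(X' * x) ≤ c * ‖grad g‖ * D * |x| := by
      refine (neg_le_abs _).trans ?_
      rw [abs_mul]; gcongr
    rw [← sq_abs x]
    linarith [sq_nonneg (2 * c * ‖grad g‖ * |x| - D / 2)]
  have a2 : -(Z' * y) ≤ c ^ 2 * ‖grad k‖ ^ 2 * y ^ 2 + D ^ 2 / 4 := by
    have : -(Z' * y) ≤ c * ‖grad k‖ * D * |y| := by
      refine (neg_le_abs _).trans ?_
      rw [abs_mul]; gcongr
    rw [← sq_abs y]
    linarith [sq_nonneg (c * ‖grad k‖ * |y| - D / 2)]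
  linarith

end Triangulation

end

/-! ### Gaussian increments, growth of the noise, and the Gronwall inequality -/

section

theorem integrable_pow_gaussianReal (v : ℝ≥0) (k : ℕ) :
    Integrable (fun x : ℝ => x ^ k) (gaussianReal 0 v) :=
  (memLp_id_gaussianReal (k : ℝ≥0)).integrable_norm_pow'.mono (by fun_prop)
    (Filter.Eventually.of_forall fun x => by simp)

theorem integral_sq_gaussianReal (v : ℝ≥0) : ∫ x, x ^ 2 ∂gaussianReal 0 v = v := by
  rw [← variance_of_integral_eq_zero (X := fun x => x) measurable_id'.aemeasurable
    integral_id_gaussianReal, variance_fun_id_gaussianReal]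

/-- The variance of `ξ²` for a standard normal `ξ`. -/
def gaussianSqVariance : ℝ := ∫ x, (x ^ 2 - 1) ^ 2 ∂gaussianReal 0 1

theorem gaussianSqVariance_nonneg : 0 ≤ gaussianSqVariance :=
  integral_nonneg fun _ => sq_nonneg _

theorem integral_sq_sub_sq_gaussianReal (v : ℝ≥0) :
    ∫ x, (x ^ 2 - v) ^ 2 ∂gaussianReal 0 v = gaussianSqVariance * v ^ 2 := by
  -- Scaling from the standard normal distribution.
  have h : gaussianReal 0 v = (gaussianReal 0 1).map (√(v : ℝ) * ·) := by
    rw [gaussianReal_map_const_mul, mul_zero, mul_one]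
    congr 1
    exact NNReal.eq (Real.sq_sqrt v.2).symm
  rw [h, integral_map (by fun_prop) (by fun_prop), gaussianSqVariance, ← integral_mul_const]
  congr 1
  funext x
  have := Real.sq_sqrt v.coe_nonneg
  rw [mul_pow, this]
  ring

section Increment

variable {Ω : Type*} {𝓖 m : MeasurableSpace Ω} {P : Measure Ω}
  {ξ : Ω → ℝ} {τ : ℝ≥0}

/-- Products of `𝓖`-measurable variables with functions of a variable independent of `𝓖`. -/
theorem integrable_and_integral_mul_of_indep
    (hind : Indep (MeasurableSpace.comap ξ inferInstance) 𝓖 P)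
    {X : Ω → ℝ} (hX : StronglyMeasurable[𝓖] X) (hXi : Integrable X P)
    {f : ℝ → ℝ} (hf : Measurable f) (hfi : Integrable (fun ω => f (ξ ω)) P) :
    Integrable (fun ω => X ω * f (ξ ω)) P ∧
      ∫ ω, X ω * f (ξ ω) ∂P = (∫ ω, X ω ∂P) * ∫ ω, f (ξ ω) ∂P := by
  have h : IndepFun X (fun ω => f (ξ ω)) P := by
    rw [IndepFun_iff_Indep]
    refine indep_of_indep_of_le_left (indep_of_indep_of_le_right hind.symm ?_)
      hX.measurable.comap_le
    rw [show (fun ω => f (ξ ω)) = f ∘ ξ from rfl, ← MeasurableSpace.comap_comp]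
    exact MeasurableSpace.comap_mono hf.comap_le
  exact ⟨h.integrable_mul hXi hfi,
    h.integral_fun_mul_eq_mul_integral hXi.aestronglyMeasurable hfi.aestronglyMeasurable⟩

/-- The expectation of the right-hand side of the pathwise energy inequality: the two martingale
terms vanish, and the quadratic terms are of order `τ`. -/
theorem integrable_and_integral_energy_bound [IsProbabilityMeasure P]
    (hind : Indep (MeasurableSpace.comap ξ inferInstance) 𝓖 P)
    (hξ : HasLaw ξ (gaussianReal 0 τ) P) {X Y Z : Ω → ℝ}
    (hX : StronglyMeasurable[𝓖] X) (hXi : Integrable X P)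
    (hY : StronglyMeasurable[𝓖] Y) (hYi : Integrable Y P)
    (hZ : StronglyMeasurable[𝓖] Z) (hZi : Integrable Z P) (a α β : ℝ) :
    Integrable (fun ω => Y ω + a - 2 * X ω * ξ ω - Z ω * (ξ ω ^ 2 - τ)
      + (Y ω + 1) * (α * ξ ω ^ 2 + β * (ξ ω ^ 2 - τ) ^ 2)) P ∧
    ∫ ω, (Y ω + a - 2 * X ω * ξ ω - Z ω * (ξ ω ^ 2 - τ)
      + (Y ω + 1) * (α * ξ ω ^ 2 + β * (ξ ω ^ 2 - τ) ^ 2)) ∂P =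
      (∫ ω, Y ω ∂P) + a
        + ((∫ ω, Y ω ∂P) + 1) * (α * τ + β * (gaussianSqVariance * τ ^ 2)) := by
  have tr : ∀ f : ℝ → ℝ, Integrable f (gaussianReal 0 τ) → Integrable (fun ω => f (ξ ω)) P ∧
      ∫ ω, f (ξ ω) ∂P = ∫ x, f x ∂gaussianReal 0 τ := fun f hf =>
    ⟨(hξ.map_eq ▸ hf : Integrable f (P.map ξ)).comp_aemeasurable hξ.aemeasurable,
      hξ.integral_comp hf.aestronglyMeasurable⟩
  have i1 : Integrable (fun x : ℝ => x) (gaussianReal 0 τ) := by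
    simpa using integrable_pow_gaussianReal τ 1
  have i2 := integrable_pow_gaussianReal τ 2
  have i3 : Integrable (fun x : ℝ => x ^ 2 - τ) (gaussianReal 0 τ) := i2.sub (integrable_const _)
  have i4 : Integrable (fun x : ℝ => (x ^ 2 - τ) ^ 2) (gaussianReal 0 τ) := by
    have := ((integrable_pow_gaussianReal τ 4).sub (i2.const_mul (2 * (τ : ℝ)))).add
      (integrable_const ((τ : ℝ) ^ 2))
    refine this.congr (Filter.Eventually.of_forall fun x => ?_)
    simp only [Pi.add_apply, Pi.sub_apply]
    ring
  have i5 : Integrable (fun x : ℝ => α * x ^ 2 + β * (x ^ 2 - τ) ^ 2) (gaussianReal 0 τ) :=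
    (i2.const_mul α).add (i4.const_mul β)
  have v3 : ∫ x, (x ^ 2 - τ : ℝ) ∂gaussianReal 0 τ = 0 := by
    rw [integral_sub i2 (integrable_const _), integral_sq_gaussianReal]; simp
  have v5 : ∫ x, (α * x ^ 2 + β * (x ^ 2 - τ) ^ 2) ∂gaussianReal 0 τ =
      α * τ + β * (gaussianSqVariance * τ ^ 2) := by
    rw [integral_add (i2.const_mul α) (i4.const_mul β), integral_const_mul, integral_const_mul,
      integral_sq_gaussianReal, integral_sq_sub_sq_gaussianReal]
  have p1 := integrable_and_integral_mul_of_indep hind (hX.const_mul 2) (hXi.const_mul 2)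
    measurable_id (tr _ i1).1
  have p2 := integrable_and_integral_mul_of_indep (f := fun x => x ^ 2 - τ) hind hZ hZi
    (by fun_prop) (tr _ i3).1
  have p3 := integrable_and_integral_mul_of_indep
    (f := fun x => α * x ^ 2 + β * (x ^ 2 - τ) ^ 2) hind
    (hY.add (stronglyMeasurable_const (b := (1 : ℝ)))) (hYi.add (integrable_const 1))
    (by fun_prop) (tr _ i5).1
  simp only [id_eq, Pi.add_apply] at p1 p2 p3
  have ia : Integrable (fun ω => Y ω + a) P := hYi.add (integrable_const a)
  have ib : Integrable (fun ω => Y ω + a - 2 * X ω * ξ ω) P := ia.sub p1.1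
  have ic : Integrable (fun ω => Y ω + a - 2 * X ω * ξ ω - Z ω * (ξ ω ^ 2 - τ)) P := ib.sub p2.1
  refine ⟨ic.add p3.1, ?_⟩
  rw [integral_add ic p3.1, integral_sub ib p2.1,
    integral_sub ia p1.1, p1.2, p2.2, p3.2, (tr _ i1).2, (tr _ i3).2, (tr _ i5).2, v3, v5,
    integral_id_gaussianReal, integral_add hYi (integrable_const a),
    integral_add hYi (integrable_const 1)]
  simp

theorem IsWiener.hasLaw_increment {𝓕 : Filtration ℝ≥0 m} {W : ℝ≥0 → Ω → ℝ}
    (hW : IsWiener P 𝓕 W) (τ : ℝ≥0) (n : ℕ) :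
    HasLaw (increment W τ n) (gaussianReal 0 τ) P := by
  have h := hW.brownian.toIsPreBrownianReal.hasLaw_sub ((n + 1 : ℕ) * τ) (n * τ)
  have e : nndist (((n + 1 : ℕ) * τ : ℝ≥0)).1 ((n * τ : ℝ≥0)).1 = τ := by
    refine NNReal.eq ?_
    rw [coe_nndist, Real.dist_eq]
    change |(((n + 1 : ℕ) * τ : ℝ≥0) : ℝ) - ((n * τ : ℝ≥0) : ℝ)| = τ
    push_cast
    rw [show ((n : ℝ) + 1) * τ - n * τ = τ by ring, abs_of_nonneg τ.coe_nonneg]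
  rw [e] at h
  exact h

theorem IsWiener.indep_increment {𝓕 : Filtration ℝ≥0 m} {W : ℝ≥0 → Ω → ℝ}
    (hW : IsWiener P 𝓕 W) (τ : ℝ≥0) (n : ℕ) :
    Indep (MeasurableSpace.comap (increment W τ n) inferInstance) (𝓕 (n * τ)) P :=
  hW.indep (n * τ) ((n + 1 : ℕ) * τ) (by gcongr; simp)

end Increment

variable {d : ℕ} {L : ℝ}

theorem norm_sq_eq (v : H10 d L) : ‖v‖ ^ 2 = ‖val v‖ ^ 2 + ‖grad v‖ ^ 2 :=
  WithLp.prod_norm_sq_eq_of_L2 v.1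

theorem norm_grad_le (v : H10 d L) : ‖grad v‖ ≤ ‖v‖ :=
  (sq_le_sq₀ (norm_nonneg _) (norm_nonneg _)).1
    (by rw [norm_sq_eq]; linarith [sq_nonneg ‖val v‖])

section Noise

variable {C : ℝ} {G : H10 d L → H10 d L} {DG : H10 d L → H10 d L →L[ℝ] H10 d L}
  {D2G : H10 d L → H10 d L →L[ℝ] H10 d L →L[ℝ] H10 d L}

theorem NoiseAssumptions.nonneg (h : NoiseAssumptions C G DG D2G) : 0 ≤ C :=
  (norm_nonneg _).trans (h.deriv_bound 0)

theorem NoiseAssumptions.continuous (h : NoiseAssumptions C G DG D2G) : Continuous G :=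
  (LipschitzWith.of_dist_le' (K := C) fun v w => by
    simpa only [dist_eq_norm] using h.lipschitz v w).continuous

theorem NoiseAssumptions.continuous_milstein (h : NoiseAssumptions C G DG D2G) :
    Continuous fun u => DG u (G u) := by
  refine (LipschitzWith.of_dist_le' (K := C * C + C) fun v w => ?_).continuous
  rw [dist_eq_norm, dist_eq_norm]
  -- This splitting matches the assumption on `(DG v - DG w) (G w)`.
  have e : DG v (G v) - DG w (G w) = DG v (G v - G w) + (DG v - DG w) (G w) := by
    simp
  rw [e, add_mul, mul_assoc]
  refine (norm_add_le _ _).trans (add_le_add ?_ (h.milstein v w))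
  exact (DG v).le_of_opNorm_le_of_le (h.deriv_bound v) (h.lipschitz v w)

/-- The constant in `‖G(v)‖² ≤ K (‖∇v‖² + 1)`. -/
def noiseConst (L C : ℝ) : ℝ := 2 * C ^ 2 * (L ^ 2 + 1)

theorem noiseConst_nonneg (L C : ℝ) : 0 ≤ noiseConst L C := by
  unfold noiseConst; positivity

theorem NoiseAssumptions.norm_sq_le (h : NoiseAssumptions C G DG D2G) (hd : 0 < d) (hL : 0 ≤ L)
    (v : H10 d L) : ‖G v‖ ^ 2 ≤ noiseConst L C * (‖grad v‖ ^ 2 + 1) := by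
  have h1 := pow_le_pow_left₀ (norm_nonneg _) (h.growth v) 2
  have h2 := pow_le_pow_left₀ (norm_nonneg _) (norm_val_le hd hL v) 2
  have h3 : ‖v‖ ^ 2 ≤ (L ^ 2 + 1) * ‖grad v‖ ^ 2 := by rw [norm_sq_eq]; linarith
  calc ‖G v‖ ^ 2 ≤ C ^ 2 * (‖v‖ + 1) ^ 2 := by rw [← mul_pow]; exact h1
    _ ≤ C ^ 2 * (2 * ((L ^ 2 + 1) * (‖grad v‖ ^ 2 + 1))) := by
      gcongr
      nlinarith [sq_nonneg (‖v‖ - 1), sq_nonneg L]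
    _ = _ := by unfold noiseConst; ring

theorem NoiseAssumptions.norm_milstein_sq_le (h : NoiseAssumptions C G DG D2G) (hd : 0 < d)
    (hL : 0 ≤ L) (v : H10 d L) :
    ‖DG v (G v)‖ ^ 2 ≤ C ^ 2 * noiseConst L C * (‖grad v‖ ^ 2 + 1) := by
  have h1 := (DG v).le_of_opNorm_le (h.deriv_bound v) (G v)
  calc ‖DG v (G v)‖ ^ 2 ≤ (C * ‖G v‖) ^ 2 := by gcongr
    _ = C ^ 2 * ‖G v‖ ^ 2 := by ring
    _ ≤ C ^ 2 * (noiseConst L C * (‖grad v‖ ^ 2 + 1)) := by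
      gcongr; exact h.norm_sq_le hd hL v
    _ = _ := by ring

end Noise

/-- A discrete Gronwall inequality that also controls the summed dissipation `b`. -/
theorem discrete_gronwall {a b : ℕ → ℝ≥0∞} {k : ℝ≥0∞} {N : ℕ}
    (h : ∀ n < N, a (n + 1) + b n ≤ a n + k * (a n + 1)) :
    (∀ n ≤ N, a n + 1 ≤ (1 + k) ^ n * (a 0 + 1)) ∧
      ∑ n ∈ Finset.range N, b n ≤ a 0 + N * k * ((1 + k) ^ N * (a 0 + 1)) := by
  have h1 : ∀ n ≤ N, a n + 1 ≤ (1 + k) ^ n * (a 0 + 1) := by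
    intro n
    induction n with
    | zero => simp
    | succ n ih =>
      intro hn
      calc a (n + 1) + 1 ≤ a n + k * (a n + 1) + 1 :=
            add_le_add (le_self_add.trans (h n hn)) le_rfl
        _ = (1 + k) * (a n + 1) := by ring
        _ ≤ (1 + k) * ((1 + k) ^ n * (a 0 + 1)) := by gcongr; exact ih (by omega)
        _ = _ := by ring
  have h2 : ∀ n ≤ N, a n + ∑ i ∈ Finset.range n, b i ≤
      a 0 + n * k * ((1 + k) ^ N * (a 0 + 1)) := by
    intro n
    induction n with
    | zero => simp
    | succ n ih =>
      intro hn
      rw [Finset.sum_range_succ]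
      have h3 : k * (a n + 1) ≤ k * ((1 + k) ^ N * (a 0 + 1)) := by
        gcongr
        refine (h1 n (by omega)).trans ?_
        gcongr
        · exact le_self_add
        · omega
      calc a (n + 1) + (∑ i ∈ Finset.range n, b i + b n)
          = (a (n + 1) + b n) + ∑ i ∈ Finset.range n, b i := by ring
        _ ≤ (a n + k * (a n + 1)) + ∑ i ∈ Finset.range n, b i :=
          add_le_add (h n hn) le_rfl
        _ = (a n + ∑ i ∈ Finset.range n, b i) + k * (a n + 1) := by ring
        _ ≤ (a 0 + n * k * ((1 + k) ^ N * (a 0 + 1))) + k * ((1 + k) ^ N * (a 0 + 1)) :=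
          add_le_add (ih (by omega)) h3
        _ = _ := by push_cast; ring
  exact ⟨h1, le_add_self.trans (h2 N le_rfl)⟩

/-- The `L²` projection onto `V_h` is stable in the `H¹` seminorm. -/
theorem Triangulation.norm_grad_proj_le (𝒯 : Triangulation d L) (hd : 0 < d) (hL : 0 < L) {σ : ℝ}
    (hσ : 0 < σ) (hQ : 𝒯.IsQuasiUniform σ) (v : H10 d L) :
    ‖grad (𝒯.proj (val v) : H10 d L)‖ ≤ stabConst d σ * ‖grad v‖ := by
  set p := 𝒯.proj (val v)
  have h1 := 𝒯.abs_inner_laplacian_le hd hL hσ hQ v p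
  rw [← 𝒯.proj_spec, real_inner_comm, 𝒯.laplacian_spec, abs_neg, real_inner_self_eq_norm_sq,
    abs_of_nonneg (sq_nonneg _)] at h1
  by_contra! h
  have h0 : 0 < ‖grad (p : H10 d L)‖ :=
    (mul_nonneg (stabConst_nonneg d σ) (norm_nonneg _)).trans_lt h
  nlinarith

end

/-! ### The energy inequality in expectation -/

section

theorem continuous_val {d : ℕ} {L : ℝ} : Continuous (val : H10 d L → L2 d L) :=
  (WithLp.prod_continuous_ofLp 2 _ _).fst.comp continuous_subtype_val

theorem continuous_grad {d : ℕ} {L : ℝ} : Continuous (grad : H10 d L → L2vec d L) :=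
  (WithLp.prod_continuous_ofLp 2 _ _).snd.comp continuous_subtype_val

theorem enorm_sq_eq_ofReal_norm_sq {F : Type*} [NormedAddCommGroup F] (x : F) :
    ‖x‖ₑ ^ 2 = ENNReal.ofReal (‖x‖ ^ 2) := by
  rw [← enorm_sq_eq_ofReal, enorm_norm]

/-- The growth rate of the expected energy. -/
def growthConst (d : ℕ) (L σ C T : ℝ) : ℝ :=
  cubeVolume d L + 4 * stabConst d σ ^ 2 * noiseConst L C +
    stabConst d σ ^ 2 * (C ^ 2 * noiseConst L C) * gaussianSqVariance * T

/-- One step of the scheme in expectation. -/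
theorem expected_energy_step {d : ℕ} {L : ℝ} (𝒯 : Triangulation d L)
    (hd : d = 1 ∨ d = 2) (hL : 0 < L) (hDel : 𝒯.IsDelaunay)
    {σ : ℝ} (hσ : 0 < σ) (hQ : 𝒯.IsQuasiUniform σ) {q : ℕ} (hq : 3 ≤ q) (hq_odd : Odd q)
    {C : ℝ} {G : H10 d L → H10 d L} {DG : H10 d L → H10 d L →L[ℝ] H10 d L}
    {D2G : H10 d L → H10 d L →L[ℝ] H10 d L →L[ℝ] H10 d L} (hG : NoiseAssumptions C G DG D2G)
    {Ω : Type*} {𝓖 m : MeasurableSpace Ω} {P : Measure Ω} [IsProbabilityMeasure P]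
    (h𝓖 : 𝓖 ≤ m) {ξ : Ω → ℝ} {τ : ℝ≥0} {T : ℝ} (hτ : τ ≤ T)
    (hind : Indep (MeasurableSpace.comap ξ inferInstance) 𝓖 P)
    (hξ : HasLaw ξ (gaussianReal 0 τ) P) {u v : Ω → 𝒯.Vh} (hu : StronglyMeasurable[𝓖] u)
    (hv : StronglyMeasurable[m] v)
    (h : ∀ᵐ ω ∂P, ∀ w : 𝒯.Vh, ⟪val (v ω - u ω : H10 d L), val (w : H10 d L)⟫_ℝ
      + τ * ⟪grad (v ω : H10 d L), grad (w : H10 d L)⟫_ℝ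
      = τ * (∫ x in cube d L, 𝒯.interp (fun y => 𝒯.rep (v ω) y - 𝒯.rep (v ω) y ^ q) x
          * val (w : H10 d L) x)
        + ⟪val (G (u ω)), val (w : H10 d L)⟫_ℝ * ξ ω
        + 1 / 2 * ⟪val (DG (u ω) (G (u ω))), val (w : H10 d L)⟫_ℝ * (ξ ω ^ 2 - τ)) :
    secondMoment P (fun ω => grad (v ω : H10 d L))
        + (1 / 2 * secondMoment P (fun ω => grad (v ω - u ω : H10 d L))
          + τ * secondMoment P (fun ω => val (𝒯.laplacian (v ω) : H10 d L))) ≤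
      secondMoment P (fun ω => grad (u ω : H10 d L)) + ENNReal.ofReal (growthConst d L σ C T * τ)
        * (secondMoment P (fun ω => grad (u ω : H10 d L)) + 1) := by
  have hd0 : 0 < d := by rcases hd with rfl | rfl <;> norm_num
  -- If the energy before the step is infinite there is nothing to prove.
  by_cases hfin : secondMoment P (fun ω => grad (u ω : H10 d L)) = ∞
  · rw [hfin, top_add]; exact le_top
  set c := stabConst d σ
  set K := noiseConst L C
  have hc : 0 ≤ c := stabConst_nonneg d σ
  have hK : 0 ≤ K := noiseConst_nonneg L C
  have hC := hG.nonneg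
  have hV : 0 ≤ cubeVolume d L := measureReal_nonneg
  have hκ := gaussianSqVariance_nonneg
  have hτ0 : (0 : ℝ) ≤ τ := τ.coe_nonneg
  -- The random variables `Y`, `X`, `Z` are known at the beginning of the step.
  set Y : Ω → ℝ := fun ω => ‖grad (u ω : H10 d L)‖ ^ 2
  set X : Ω → ℝ := fun ω => ⟪val (G (u ω)), val (𝒯.laplacian (u ω) : H10 d L)⟫_ℝ
  set Z : Ω → ℝ := fun ω => ⟪val (DG (u ω) (G (u ω))), val (𝒯.laplacian (u ω) : H10 d L)⟫_ℝ
  have hlap : Continuous fun w : 𝒯.Vh => val (𝒯.laplacian w : H10 d L) :=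
    continuous_val.comp (continuous_subtype_val.comp 𝒯.continuous_laplacian)
  have hY : StronglyMeasurable[𝓖] Y :=
    ((continuous_grad.comp continuous_subtype_val).norm.pow 2).comp_stronglyMeasurable hu
  have hX : StronglyMeasurable[𝓖] X :=
    ((continuous_val.comp (hG.continuous.comp continuous_subtype_val)).inner
      hlap).comp_stronglyMeasurable hu
  have hZ : StronglyMeasurable[𝓖] Z :=
    ((continuous_val.comp (hG.continuous_milstein.comp continuous_subtype_val)).inner
      hlap).comp_stronglyMeasurable hu
  have hYlin : ∫⁻ ω, ENNReal.ofReal (Y ω) ∂P = secondMoment P (fun ω => grad (u ω : H10 d L)) :=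
    lintegral_congr fun ω => (enorm_sq_eq_ofReal_norm_sq _).symm
  have hYi : Integrable Y P := by
    refine ⟨(hY.mono h𝓖).aestronglyMeasurable, ?_⟩
    rw [hasFiniteIntegral_iff_ofReal (Filter.Eventually.of_forall fun ω => sq_nonneg _), hYlin]
    exact lt_top_iff_ne_top.2 hfin
  have hY1 : Integrable (fun ω => Y ω + 1) P := hYi.add (integrable_const 1)
  have hg : ∀ w : H10 d L, ‖grad (G w)‖ ^ 2 ≤ K * (‖grad w‖ ^ 2 + 1) := fun w =>
    (pow_le_pow_left₀ (norm_nonneg _) (norm_grad_le _) 2).trans (hG.norm_sq_le hd0 hL.le w)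
  have hk : ∀ w : H10 d L, ‖grad (DG w (G w))‖ ^ 2 ≤ C ^ 2 * K * (‖grad w‖ ^ 2 + 1) := fun w =>
    (pow_le_pow_left₀ (norm_nonneg _) (norm_grad_le _) 2).trans
      (hG.norm_milstein_sq_le hd0 hL.le w)
  have hinner : ∀ (g : H10 d L) (w : 𝒯.Vh) (B : ℝ), 0 ≤ B →
      ‖grad g‖ ^ 2 ≤ B * (‖grad (w : H10 d L)‖ ^ 2 + 1) →
      |⟪val g, val (𝒯.laplacian w : H10 d L)⟫_ℝ| ≤
        c * (B + 1) * (‖grad (w : H10 d L)‖ ^ 2 + 1) := by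
    intro g w B hB hgB
    refine (𝒯.abs_inner_laplacian_le hd0 hL hσ hQ g w).trans ?_
    rw [mul_assoc, mul_assoc]
    refine mul_le_mul_of_nonneg_left ?_ hc
    nlinarith [sq_nonneg (‖grad g‖ - ‖grad (w : H10 d L)‖),
      mul_nonneg hB (sq_nonneg ‖grad (w : H10 d L)‖)]
  have hXi : Integrable X P := (hY1.const_mul (c * (K + 1))).mono'
    (hX.mono h𝓖).aestronglyMeasurable
    (Filter.Eventually.of_forall fun ω => hinner _ _ _ hK (hg _))
  have hZi : Integrable Z P := (hY1.const_mul (c * (C ^ 2 * K + 1))).mono'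
    (hZ.mono h𝓖).aestronglyMeasurable
    (Filter.Eventually.of_forall fun ω => hinner _ _ _ (by positivity) (hk _))
  obtain ⟨hRi, hR⟩ := integrable_and_integral_energy_bound hind hξ hX hXi hY hYi hZ hZi
    (τ * cubeVolume d L) (4 * c ^ 2 * K) (c ^ 2 * (C ^ 2 * K))
  set R : Ω → ℝ := fun ω => Y ω + τ * cubeVolume d L - 2 * X ω * ξ ω - Z ω * (ξ ω ^ 2 - τ)
      + (Y ω + 1) * (4 * c ^ 2 * K * ξ ω ^ 2 + c ^ 2 * (C ^ 2 * K) * (ξ ω ^ 2 - τ) ^ 2)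
  -- Insert the growth bounds for the noise into the pathwise inequality.
  have hpath : ∀ᵐ ω ∂P, ‖grad (v ω : H10 d L)‖ ^ 2 + 1 / 2 * ‖grad (v ω - u ω : H10 d L)‖ ^ 2
        + τ * ‖val (𝒯.laplacian (v ω) : H10 d L)‖ ^ 2 ≤ R ω := by
    filter_upwards [h] with ω hω
    refine (𝒯.energy_step hd hL hDel hσ hQ hq hq_odd hτ0 (G (u ω)) (DG (u ω) (G (u ω)))
      (u ω) (v ω) hω).trans ?_
    have h1 := mul_le_mul_of_nonneg_left (hg (u ω)) (by positivity : 0 ≤ 4 * c ^ 2 * ξ ω ^ 2)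
    have h2 := mul_le_mul_of_nonneg_left (hk (u ω))
      (by positivity : 0 ≤ c ^ 2 * (ξ ω ^ 2 - τ) ^ 2)
    simp only [R, X, Y, Z]
    linarith
  have hYint : secondMoment P (fun ω => grad (u ω : H10 d L)) =
      ENNReal.ofReal (∫ ω, Y ω ∂P) := by
    rw [ofReal_integral_eq_lintegral_ofReal hYi (Filter.Eventually.of_forall fun ω => sq_nonneg _),
      hYlin]
  have hY0 : 0 ≤ ∫ ω, Y ω ∂P := integral_nonneg fun ω => sq_nonneg _
  have hgc : 0 ≤ growthConst d L σ C T := by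
    have : 0 ≤ T := hτ0.trans hτ
    unfold growthConst
    positivity
  have mv : ∀ {F : Type _} [NormedAddCommGroup F] {f : 𝒯.Vh → F}, Continuous f →
      Measurable fun ω => ‖f (v ω)‖ₑ ^ 2 := fun hf =>
    (hf.comp_stronglyMeasurable hv).enorm.pow_const 2
  have m1 := mv (f := fun w => grad (w : H10 d L)) (continuous_grad.comp continuous_subtype_val)
  have m2 : Measurable fun ω => ‖grad (v ω - u ω : H10 d L)‖ₑ ^ 2 :=
    ((continuous_grad.comp continuous_subtype_val).comp_stronglyMeasurable
      (hv.sub (hu.mono h𝓖))).enorm.pow_const 2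
  have m3 := mv hlap
  calc _ = ∫⁻ ω, (‖grad (v ω : H10 d L)‖ₑ ^ 2 + (1 / 2 * ‖grad (v ω - u ω : H10 d L)‖ₑ ^ 2
        + τ * ‖val (𝒯.laplacian (v ω) : H10 d L)‖ₑ ^ 2)) ∂P := by
        rw [lintegral_add_left m1, lintegral_add_left (m2.const_mul _), lintegral_const_mul _ m2,
          lintegral_const_mul _ m3]
        rfl
    _ ≤ ∫⁻ ω, ENNReal.ofReal (R ω) ∂P := by
        refine lintegral_mono_ae ?_
        filter_upwards [hpath] with ω hω
        refine le_trans (le_of_eq ?_) (ENNReal.ofReal_le_ofReal hω)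
        rw [ENNReal.ofReal_add (by positivity) (by positivity),
          ENNReal.ofReal_add (by positivity) (by positivity), ENNReal.ofReal_mul (by norm_num),
          ENNReal.ofReal_mul hτ0, ENNReal.ofReal_coe_nnreal, ENNReal.ofReal_div_of_pos two_pos,
          enorm_sq_eq_ofReal_norm_sq, enorm_sq_eq_ofReal_norm_sq, enorm_sq_eq_ofReal_norm_sq]
        simp [add_assoc]
    _ = ENNReal.ofReal (∫ ω, R ω ∂P) := by
        refine (ofReal_integral_eq_lintegral_ofReal hRi ?_).symm
        filter_upwards [hpath] with ω hω
        exact le_trans (by positivity) hω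
    _ ≤ ENNReal.ofReal ((∫ ω, Y ω ∂P) + growthConst d L σ C T * τ * ((∫ ω, Y ω ∂P) + 1)) := by
        refine ENNReal.ofReal_le_ofReal ?_
        rw [hR]
        -- Here `τ ≤ T` turns the fourth-moment term, of order `τ²`, into one of order `τ`.
        have h1 : (τ : ℝ) * cubeVolume d L ≤ τ * cubeVolume d L * ((∫ ω, Y ω ∂P) + 1) :=
          le_mul_of_one_le_right (by positivity) (by linarith)
        have h2 : c ^ 2 * (C ^ 2 * K) * (gaussianSqVariance * τ ^ 2) ≤
            c ^ 2 * (C ^ 2 * K) * (gaussianSqVariance * (T * τ)) := by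
          rw [sq (τ : ℝ)]; gcongr
        have h3 := mul_le_mul_of_nonneg_left h2 (by linarith : 0 ≤ (∫ ω, Y ω ∂P) + 1)
        unfold growthConst
        linarith
    _ = _ := by
        rw [ENNReal.ofReal_add hY0 (by positivity), ENNReal.ofReal_mul (by positivity),
          ENNReal.ofReal_add hY0 zero_le_one, ENNReal.ofReal_one, ← hYint]

end

end MilsteinFEM

end

open MilsteinFEM in
theorem theorem4p1 (d : ℕ) (hd : d = 1 ∨ d = 2) (L : ℝ) (hL : 0 < L) (T : ℝ≥0) (hT : 0 < T)
    (q : ℕ) (hq : 3 ≤ q) (hq_odd : Odd q) (CG : ℝ) (σ : ℝ) (hσ : 0 < σ) (M : ℝ≥0) :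
    ∃ C : ℝ≥0, ∀ (Ω : Type*) (m : MeasurableSpace Ω) (P : Measure Ω) (_ : IsProbabilityMeasure P)
      (𝓕 : Filtration ℝ≥0 m) (W : ℝ≥0 → Ω → ℝ) (_ : IsWiener P 𝓕 W)
      (G : H10 d L → H10 d L) (DG : H10 d L → H10 d L →L[ℝ] H10 d L)
      (D2G : H10 d L → H10 d L →L[ℝ] H10 d L →L[ℝ] H10 d L) (_ : NoiseAssumptions CG G DG D2G)
      (u₀ : Ω → H10 d L) (_ : StronglyMeasurable[𝓕 0] u₀) (_ : secondMoment P u₀ ≤ M)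
      (𝒯 : Triangulation d L) (_ : 𝒯.IsDelaunay) (_ : 𝒯.IsQuasiUniform σ)
      (N : ℕ) (_ : 0 < N) (u : ℕ → Ω → 𝒯.Vh) (_ : IsSolution P 𝓕 W 𝒯 q G DG u₀ (T / N) N u),
      (⨆ n : Fin (N + 1), secondMoment P fun ω => grad (u n ω : H10 d L))
        + 1 / 4 * ∑ n ∈ Finset.range N,
            secondMoment P (fun ω => grad (u (n + 1) ω - u n ω : H10 d L))
        + ((T / N : ℝ≥0) : ℝ≥0∞) * ∑ n ∈ Finset.range N,
            secondMoment P (fun ω => val (𝒯.laplacian (u (n + 1) ω) : H10 d L))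
      ≤ C := by
  have hd0 : 0 < d := by rcases hd with rfl | rfl <;> norm_num
  -- `κ` is the growth rate, `E` bounds `(1 + κ τ) ^ N`, and `B` bounds the initial energy.
  set κ : ℝ≥0 := (growthConst d L σ CG T).toNNReal with hκ
  set E : ℝ≥0 := (Real.exp (κ * T)).toNNReal with hE
  set B : ℝ≥0 := (stabConst d σ ^ 2).toNNReal * M with hB
  refine ⟨E * (B + 1) + (B + κ * T * (E * (B + 1))), ?_⟩
  intro Ω m P _ 𝓕 W hW G DG D2G hG u₀ hu₀ hM 𝒯 hDel hQ N hN u hu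
  set τ : ℝ≥0 := T / N with hτ
  have hN0 : (N : ℝ≥0) ≠ 0 := by exact_mod_cast hN.ne'
  have hNτ : N * τ = T := by rw [hτ]; field_simp
  have hτT : (τ : ℝ) ≤ T := by
    have h1 : (1 : ℝ≥0) ≤ N := by exact_mod_cast hN
    have : τ ≤ T := by rw [← hNτ]; exact le_mul_of_one_le_left zero_le h1
    exact_mod_cast this
  set a : ℕ → ℝ≥0∞ := fun n => secondMoment P fun ω => grad (u n ω : H10 d L)
  set e : ℕ → ℝ≥0∞ := fun n => secondMoment P fun ω => grad (u (n + 1) ω - u n ω : H10 d L)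
  set l : ℕ → ℝ≥0∞ := fun n => secondMoment P fun ω => val (𝒯.laplacian (u (n + 1) ω) : H10 d L)
  have hstep : ∀ n < N, a (n + 1) + (1 / 2 * e n + τ * l n) ≤
      a n + ((κ * τ : ℝ≥0) : ℝ≥0∞) * (a n + 1) := by
    intro n hn
    have h := expected_energy_step 𝒯 hd hL hDel hσ hQ hq hq_odd hG (𝓕.le (n * τ)) hτT
      (hW.indep_increment τ n) (hW.hasLaw_increment τ n) (hu.adapted n hn.le)
      ((hu.adapted (n + 1) hn).mono (𝓕.le _)) (hu.step n hn)
    have hk : ENNReal.ofReal (growthConst d L σ CG T * τ) = ((κ * τ : ℝ≥0) : ℝ≥0∞) := by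
      rw [ENNReal.ofReal_mul' τ.coe_nonneg, ENNReal.ofReal_coe_nnreal, ENNReal.coe_mul, hκ]
      rfl
    rwa [hk] at h
  have ha0 : a 0 ≤ B := by
    calc a 0 ≤ ∫⁻ ω, ((stabConst d σ ^ 2).toNNReal : ℝ≥0∞) * ‖u₀ ω‖ₑ ^ 2 ∂P := by
          refine lintegral_mono_ae ?_
          filter_upwards [hu.initial] with ω hω
          rw [hω, enorm_sq_eq_ofReal_norm_sq, enorm_sq_eq_ofReal_norm_sq (u₀ ω),
            ← ENNReal.ofReal, ← ENNReal.ofReal_mul (sq_nonneg _), ← mul_pow]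
          refine ENNReal.ofReal_le_ofReal (pow_le_pow_left₀ (norm_nonneg _) ?_ 2)
          exact (𝒯.norm_grad_proj_le hd0 hL hσ hQ (u₀ ω)).trans
            (mul_le_mul_of_nonneg_left (norm_grad_le _) (stabConst_nonneg d σ))
      _ = ((stabConst d σ ^ 2).toNNReal : ℝ≥0∞) * secondMoment P u₀ :=
          lintegral_const_mul' _ _ ENNReal.coe_ne_top
      _ ≤ B := by rw [hB, ENNReal.coe_mul]; gcongr
  have hexp : (1 + ((κ * τ : ℝ≥0) : ℝ≥0∞)) ^ N ≤ E := by
    have : (1 + κ * τ) ^ N ≤ E := by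
      rw [← NNReal.coe_le_coe]
      push_cast
      calc (1 + (κ : ℝ) * τ) ^ N ≤ Real.exp (κ * τ) ^ N := by
            gcongr
            rw [add_comm]; exact Real.add_one_le_exp _
        _ = E := by
            rw [← Real.exp_nat_mul, hE, Real.coe_toNNReal _ (Real.exp_pos _).le, ← hNτ]
            push_cast
            ring_nf
    exact_mod_cast this
  obtain ⟨hsup, hsum⟩ := discrete_gronwall hstep
  have hbd : ∀ n ≤ N, (1 + ((κ * τ : ℝ≥0) : ℝ≥0∞)) ^ n * (a 0 + 1) ≤ E * (B + 1) := by
    intro n hn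
    gcongr
    exact (pow_le_pow_right₀ le_self_add hn).trans hexp
  have hS : (⨆ n : Fin (N + 1), a n) ≤ E * (B + 1) := iSup_le fun n =>
    (le_self_add.trans (hsup n (Nat.lt_succ_iff.1 n.2))).trans (hbd n (Nat.lt_succ_iff.1 n.2))
  have hD : 1 / 4 * ∑ n ∈ Finset.range N, e n + τ * ∑ n ∈ Finset.range N, l n ≤
      B + κ * T * (E * (B + 1)) := by
    have hq4 : (1 / 4 : ℝ≥0∞) ≤ 1 / 2 := by
      rw [one_div, one_div, ENNReal.inv_le_inv]; norm_num
    calc _ ≤ 1 / 2 * ∑ n ∈ Finset.range N, e n + τ * ∑ n ∈ Finset.range N, l n := by gcongr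
      _ = ∑ n ∈ Finset.range N, (1 / 2 * e n + τ * l n) := by
          rw [Finset.sum_add_distrib, Finset.mul_sum, Finset.mul_sum]
      _ ≤ _ := hsum
      _ ≤ B + N * ((κ * τ : ℝ≥0) : ℝ≥0∞) * (E * (B + 1)) := by
          gcongr
      _ = _ := by
          rw [← hNτ]
          push_cast
          ring
  rw [add_assoc]
  push_cast
  exact add_le_add hS hD
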